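/- All vector spaces are over $\mathbb C$. Let $\mathfrak g=\mathfrak g_{\bar 0}\oplus\mathfrak g_{\bar 1}$ be a finite-dimensional solvable Lie superalgebra. Let $$L=\{\lambda\in\mathfrak g^*:\ \lambda(\mathfrak g_{\bar 1})=0,\ \lambda([\mathfrak g_{\bar 0},\mathfrak g_{\bar 0}])=0\}.$$ For $\lambda\in L$ let $f_\lambda$ be the symmetric form $f_\lambda(\xi_1,\xi_2)=\lambda([\xi_1,\xi_2])$ on $\mathfrak g_{\bar 1}$. A polarization for $\lambda$ is a Lie subsuperalgebra $\mathfrak h\supset\mathfrak g_{\bar 0}$ such that $\lambda([\mathfrak h,\mathfrak h])=0$ and $\mathfrak h_{\bar 1}$ is a maximal isotropic subspace for $f_\lambda$. For a subsuperalgebra $\mathfrak h\supset\mathfrak g_{\bar 0}$ let $\theta_{\mathfrak h}\in L$ be given by $\theta_{\mathfrak h}(g)=\tfrac12\operatorname{str}_{\mathfrak g/\mathfrak h}(\operatorname{ad} g)$ for $g\in\mathfrak g_{\bar 0}$ and $\theta_{\mathfrak h}(g)=0$ for $g\in\mathfrak g_{\bar 1}$. If $\mathfrak h$ is a polarization for $\lambda\in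 L$, then $\lambda$ and $\theta_{\mathfrak h}$ are characters of $\mathfrak h$; for a character $\chi$ of $\mathfrak h$ write $\operatorname{Ind}^{\mathfrak g}_{\mathfrak h}(\chi)=U(\mathfrak g)\otimes_{U(\mathfrak h)}\chi$, where $\chi$ also denotes the $(1,0)$-dimensional $\mathfrak h$-module, and put $I^{\mathfrak g}_{\mathfrak h}(\lambda)=\operatorname{Ind}^{\mathfrak g}_{\mathfrak h}(\lambda+\theta_{\mathfrak h})$. Modules are $\mathbb Z/2$-graded. A nonzero module is irreducible if it has no invariant subsuperspaces other than $0$ and itself; an irreducible module is of $G$-type if it has no invariant subspaces at all (graded or not) other than $0$ and itself, and of $Q$-type otherwise. Let $\Pi$ be the change of parity functor. Write $V\cong W$ if there is an even isomorphism of modules, and $V\cong_\Pi W$ if $V\cong W$ or $V\cong\Pi W$. **Theorem.** 1. Every finite-dimensional irreducible $\mathfrak g$-module $V$ satisfies $V\cong_\Pi I^{\mathfrak g}_{\mathfrak h}(\lambda)$ for some $\lambda\in L$ and some polarization $\mathfrak h$ for $\lambda$. 2. Every $\lambda\in L$ has a polarization $\mathfrak h$; the module $I^{\mathfrak g}_{\mathfrak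 h}(\lambda)$ is finite-dimensional and irreducible and, up to $\cong_\Pi$, does not depend on the choice of $\mathfrak h$, so that one may write $I(\lambda)$ for it. The map $\lambda\mapsto I(\lambda)$ is a bijection from $L$ onto the set of $\cong_\Pi$-classes of finite-dimensional irreducible $\mathfrak g$-modules. 3. Let $\lambda,\mu\in L$, let $\mathfrak h$ be a polarization for $\lambda$ and $\mathfrak t$ a polarization for $\mu$. Then $\operatorname{Ind}^{\mathfrak g}_{\mathfrak h}(\lambda)\cong_\Pi\operatorname{Ind}^{\mathfrak g}_{\mathfrak t}(\mu)$ if and only if $\lambda-\theta_{\mathfrak h}=\mu-\theta_{\mathfrak t}$. 4. If $\operatorname{rk} f_\lambda$ is even, then $I(\lambda)$ is of $G$-type; if $\operatorname{rk} f_\lambda$ is odd, then $I(\lambda)$ is of $Q$-type. -/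

import Mathlib

open scoped TensorProduct

noncomputable section

/-! ### Signs and superspaces -/

/-- The sign `(-1)^{i j}` for parities `i`, `j`. -/
def koszulSign (i j : ZMod 2) : ℂ := (-1) ^ (i.val * j.val)

/-- The sign `(-1)^i` for a parity `i`. -/
def paritySign (i : ZMod 2) : ℂ := (-1) ^ i.val

theorem paritySign_zero : paritySign 0 = 1 := by simp [paritySign]

theorem paritySign_one : paritySign 1 = -1 := pow_one (-1 : ℂ)

theorem parity_cases (i : ZMod 2) : i = 0 ∨ i = 1 := by
  revert i
  decide

theorem paritySign_mul_self (i : ZMod 2) : paritySign i * paritySign i = 1 := by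
  rcases parity_cases i with rfl | rfl <;> simp [paritySign_zero, paritySign_one]

theorem paritySign_add (i j : ZMod 2) : paritySign (i + j) = paritySign i * paritySign j := by
  have h2 : (1 + 1 : ZMod 2) = 0 := by decide
  rcases parity_cases i with rfl | rfl <;> rcases parity_cases j with rfl | rfl <;>
    simp [paritySign_zero, paritySign_one, h2]

/-- A complex superspace: a vector space `V` with a decomposition `V = V₀ ⊕ V₁`. -/
structure Superspace (V : Type*) [AddCommGroup V] [Module ℂ V] where
  /-- The homogeneous components `V₀` (even) and `V₁` (odd). -/
  gr : ZMod 2 → Submodule ℂ V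
  isCompl : IsCompl (gr 0) (gr 1)

namespace Superspace

variable {V : Type*} [AddCommGroup V] [Module ℂ V]

/-- The projection of a superspace onto its even part. -/
def evenPart (E : Superspace V) : V →ₗ[ℂ] E.gr 0 :=
  Submodule.projectionOnto (E.gr 0) (E.gr 1) E.isCompl

/-- The parity involution, `v ↦ (-1)^i v` on `Vᵢ`. -/
def parityInv (E : Superspace V) : V →ₗ[ℂ] V :=
  Submodule.projection (E.gr 0) (E.gr 1) E.isCompl
    - Submodule.projection (E.gr 1) (E.gr 0) E.isCompl.symm

theorem parityInv_of_mem (E : Superspace V) {i : ZMod 2} {v : V} (hv : v ∈ E.gr i) :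
    E.parityInv v = paritySign i • v := by
  rcases parity_cases i with rfl | rfl
  · rw [parityInv, LinearMap.sub_apply, Submodule.projection_apply_of_mem_left E.isCompl hv,
      (Submodule.projection_apply_eq_zero_iff E.isCompl.symm).2 hv, paritySign_zero]
    simp
  · rw [parityInv, LinearMap.sub_apply, Submodule.projection_apply_of_mem_left E.isCompl.symm hv,
      (Submodule.projection_apply_eq_zero_iff E.isCompl).2 hv, paritySign_one]
    simp

/-- Every vector is a sum of an even and an odd one. -/
theorem exists_add (E : Superspace V) (v : V) : ∃ a ∈ E.gr 0, ∃ b ∈ E.gr 1, a + b = v :=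
  Submodule.mem_sup.1 (by rw [E.isCompl.sup_eq_top]; trivial)

theorem linearMap_ext (E : Superspace V) {W : Type*} [AddCommGroup W] [Module ℂ W]
    {f g : V →ₗ[ℂ] W} (h : ∀ i, ∀ v ∈ E.gr i, f v = g v) : f = g := by
  ext v
  obtain ⟨a, ha, b, hb, rfl⟩ := E.exists_add v
  rw [map_add, map_add, h 0 a ha, h 1 b hb]

theorem parityInv_parityInv (E : Superspace V) (v : V) : E.parityInv (E.parityInv v) = v := by
  have : E.parityInv ∘ₗ E.parityInv = LinearMap.id := by
    refine E.linearMap_ext fun i v hv => ?_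
    simp [E.parityInv_of_mem hv, smul_smul, paritySign_mul_self]
  exact LinearMap.congr_fun this v

/-- The superspace structure given by an involution `e`: the homogeneous components are the
eigenspaces of `e`, the even one for `1` and the odd one for `-1`. -/
def ofInvolution (e : V →ₗ[ℂ] V) (he : ∀ v, e (e v) = v) : Superspace V where
  gr i := LinearMap.ker (e - paritySign i • LinearMap.id)
  isCompl := by
    constructor
    · rw [Submodule.disjoint_def]
      intro v h0 h1
      rw [LinearMap.mem_ker] at h0 h1
      simp only [paritySign_zero, paritySign_one, LinearMap.sub_apply,
        LinearMap.id_apply, one_smul, neg_smul, sub_neg_eq_add] at h0 h1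
      have h2 : (2 : ℂ) • v = 0 := by
        rw [two_smul]
        have := congrArg₂ (· - ·) h1 h0
        simpa using this
      simpa using h2
    · rw [codisjoint_iff_le_sup]
      intro v _
      refine Submodule.mem_sup.2 ⟨(1 / 2 : ℂ) • (v + e v), ?_, (1 / 2 : ℂ) • (v - e v), ?_, ?_⟩
      · rw [LinearMap.mem_ker]
        simp [paritySign_zero, he, add_comm]
      · rw [LinearMap.mem_ker]
        simp only [paritySign_one, LinearMap.sub_apply, LinearMap.smul_apply,
          LinearMap.id_apply, map_smul, map_sub, he]
        module
      · module

theorem mem_ofInvolution {e : V →ₗ[ℂ] V} {he : ∀ v, e (e v) = v} {i : ZMod 2} {v : V} :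
    v ∈ (ofInvolution e he).gr i ↔ e v = paritySign i • v := by
  simp [ofInvolution, LinearMap.mem_ker, sub_eq_zero]

/-- The supertrace of an endomorphism `T`, i.e. the trace of the block of `T` on `V₀` minus the
trace of the block of `T` on `V₁`. -/
def supertrace (E : Superspace V) : Module.End ℂ V →ₗ[ℂ] ℂ :=
  LinearMap.trace ℂ V ∘ₗ LinearMap.mulLeft ℂ (E.parityInv : Module.End ℂ V)

end Superspace

/-! ### Lie superalgebras and their modules -/

/-- A complex Lie superalgebra structure on the vector space `𝔤`. -/
structure LieSuperalgebra (𝔤 : Type*) [AddCommGroup 𝔤] [Module ℂ 𝔤] extends Superspace 𝔤 where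
  bracket : 𝔤 →ₗ[ℂ] 𝔤 →ₗ[ℂ] 𝔤
  bracket_mem : ∀ {i j x y}, x ∈ gr i → y ∈ gr j → bracket x y ∈ gr (i + j)
  bracket_skew : ∀ {i j x y}, x ∈ gr i → y ∈ gr j →
    bracket x y = -(koszulSign i j • bracket y x)
  jacobi : ∀ {i j x y}, x ∈ gr i → y ∈ gr j → ∀ z,
    bracket x (bracket y z) = bracket (bracket x y) z + koszulSign i j • bracket y (bracket x z)

/-- A module over the Lie superalgebra `G` on the vector space `V`: a superspace structure on `V`
and an action of `G` on it. -/
structure SuperModule {𝔤 : Type*} [AddCommGroup 𝔤] [Module ℂ 𝔤] (G : LieSuperalgebra 𝔤)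
    (V : Type*) [AddCommGroup V] [Module ℂ V] extends Superspace V where
  act : 𝔤 →ₗ[ℂ] Module.End ℂ V
  act_mem : ∀ {i j x v}, x ∈ G.gr i → v ∈ gr j → act x v ∈ gr (i + j)
  act_bracket : ∀ {i j x y}, x ∈ G.gr i → y ∈ G.gr j →
    act (G.bracket x y) = act x * act y - koszulSign i j • (act y * act x)

section

variable {𝔤 : Type*} [AddCommGroup 𝔤] [Module ℂ 𝔤]

namespace LieSuperalgebra

theorem parityInv_bracket (G : LieSuperalgebra 𝔤) {i j : ZMod 2} {x y : 𝔤}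
    (hx : x ∈ G.gr i) (hy : y ∈ G.gr j) :
    G.parityInv (G.bracket x y) = G.bracket (G.parityInv x) (G.parityInv y) := by
  rw [G.parityInv_of_mem hx, G.parityInv_of_mem hy, G.parityInv_of_mem (G.bracket_mem hx hy),
    paritySign_add]
  simp [smul_smul, mul_comm]

/-- The derived series: `G⁽⁰⁾ = G`, and `G⁽ⁿ⁺¹⁾` is the span of the brackets of elements
of `G⁽ⁿ⁾`. -/
def derivedSeries (G : LieSuperalgebra 𝔤) : ℕ → Submodule ℂ 𝔤
  | 0 => ⊤
  | n + 1 => Submodule.map₂ G.bracket (derivedSeries G n) (derivedSeries G n)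

/-- A Lie superalgebra is solvable if its derived series reaches zero. -/
def IsSolvable (G : LieSuperalgebra 𝔤) : Prop := ∃ n, G.derivedSeries n = ⊥

end LieSuperalgebra

namespace SuperModule

variable {G : LieSuperalgebra 𝔤}
variable {V : Type*} [AddCommGroup V] [Module ℂ V] {W : Type*} [AddCommGroup W] [Module ℂ W]

theorem parityInv_act (M : SuperModule G V) (x : 𝔤) (v : V) :
    M.parityInv (M.act x v) = M.act (G.parityInv x) (M.parityInv v) := by
  have key : ∀ i, ∀ x ∈ G.gr i, ∀ j, ∀ v ∈ M.gr j,
      M.parityInv (M.act x v) = M.act (G.parityInv x) (M.parityInv v) := by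
    intro i x hx j v hv
    rw [M.parityInv_of_mem hv, G.parityInv_of_mem hx, M.parityInv_of_mem (M.act_mem hx hv),
      paritySign_add]
    simp [smul_smul, mul_comm]
  obtain ⟨a, ha, b, hb, rfl⟩ := G.exists_add x
  obtain ⟨c, hc, d, hd, rfl⟩ := M.exists_add v
  simp only [map_add, LinearMap.add_apply]
  rw [key 0 a ha 0 c hc, key 0 a ha 1 d hd, key 1 b hb 0 c hc, key 1 b hb 1 d hd]

/-- The module `Π V`: the same space with the opposite parity, where `x` acts as `(-1)^{p(x)} x`. -/
def parityChange (M : SuperModule G V) : SuperModule G V where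
  gr i := M.gr (i + 1)
  isCompl := by
    have : (1 + 1 : ZMod 2) = 0 := by decide
    rw [this, zero_add]
    exact M.isCompl.symm
  act := M.act ∘ₗ G.parityInv
  act_mem := by
    intro i j x v hx hv
    rw [LinearMap.comp_apply, G.parityInv_of_mem hx, map_smul, LinearMap.smul_apply, add_assoc]
    exact Submodule.smul_mem _ _ (M.act_mem hx hv)
  act_bracket := by
    intro i j x y hx hy
    simp only [LinearMap.comp_apply]
    rw [G.parityInv_bracket hx hy, G.parityInv_of_mem hx, G.parityInv_of_mem hy]
    simp only [map_smul, LinearMap.smul_apply]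
    rw [M.act_bracket hx hy]
    simp only [smul_mul_assoc, mul_smul_comm, smul_sub, smul_smul]
    ring_nf

/-- Isomorphism of modules: an invertible even map that commutes with the action. -/
def IsIso (M : SuperModule G V) (N : SuperModule G W) : Prop :=
  ∃ e : V ≃ₗ[ℂ] W, (∀ i, ∀ v ∈ M.gr i, e v ∈ N.gr i) ∧ ∀ x v, e (M.act x v) = N.act x (e v)

/-- Isomorphism up to the change of parity functor. -/
def IsIsoUpToParity (M : SuperModule G V) (N : SuperModule G W) : Prop :=
  M.IsIso N ∨ M.IsIso N.parityChange

/-- The subspace `U` of the module is stable under the action. It need not be graded. -/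
def IsInvariant (M : SuperModule G V) (U : Submodule ℂ V) : Prop :=
  ∀ x, ∀ v ∈ U, M.act x v ∈ U

/-- The subspace `U` is a subsuperspace, i.e. `U = (U ∩ V₀) ⊕ (U ∩ V₁)`. -/
def IsGraded (M : SuperModule G V) (U : Submodule ℂ V) : Prop :=
  U = (U ⊓ M.gr 0) ⊔ (U ⊓ M.gr 1)

/-- Irreducibility: the module is nonzero and has no invariant subsuperspaces except the
trivial ones. -/
def IsIrreducible (M : SuperModule G V) : Prop :=
  Nontrivial V ∧ ∀ U, M.IsInvariant U → M.IsGraded U → U = ⊥ ∨ U = ⊤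

/-- Irreducible of `G`-type: nonzero and without nontrivial invariant subspaces, graded or not. -/
def IsGType (M : SuperModule G V) : Prop :=
  Nontrivial V ∧ ∀ U, M.IsInvariant U → U = ⊥ ∨ U = ⊤

/-- Irreducible of `Q`-type: no nontrivial invariant subsuperspaces, but some nontrivial
(non-graded) invariant subspace. -/
def IsQType (M : SuperModule G V) : Prop :=
  M.IsIrreducible ∧ ∃ U, M.IsInvariant U ∧ U ≠ ⊥ ∧ U ≠ ⊤

end SuperModule

/-! ### The universal enveloping algebra -/

namespace LieSuperalgebra

/-- The defining relations `x y = [x, y] + (-1)^{p(x) p(y)} y x` of the enveloping algebra. -/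
inductive EnvRel (G : LieSuperalgebra 𝔤) : TensorAlgebra ℂ 𝔤 → TensorAlgebra ℂ 𝔤 → Prop
  | mk {i j : ZMod 2} {x y : 𝔤} (hx : x ∈ G.gr i) (hy : y ∈ G.gr j) :
    EnvRel G (TensorAlgebra.ι ℂ x * TensorAlgebra.ι ℂ y)
      (TensorAlgebra.ι ℂ (G.bracket x y)
        + koszulSign i j • (TensorAlgebra.ι ℂ y * TensorAlgebra.ι ℂ x))

/-- The universal enveloping algebra `U(G)`. -/
def Env (G : LieSuperalgebra 𝔤) := RingQuot G.EnvRel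

instance (G : LieSuperalgebra 𝔤) : Ring G.Env := inferInstanceAs (Ring (RingQuot G.EnvRel))

instance (G : LieSuperalgebra 𝔤) : Algebra ℂ G.Env :=
  inferInstanceAs (Algebra ℂ (RingQuot G.EnvRel))

/-- The quotient map from the tensor algebra to `U(G)`. -/
def envMk (G : LieSuperalgebra 𝔤) : TensorAlgebra ℂ 𝔤 →ₐ[ℂ] G.Env :=
  (RingQuot.mkAlgHom ℂ G.EnvRel : TensorAlgebra ℂ 𝔤 →ₐ[ℂ] RingQuot G.EnvRel)

/-- The canonical map `G → U(G)`. -/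
def ι (G : LieSuperalgebra 𝔤) : 𝔤 →ₗ[ℂ] G.Env :=
  G.envMk.toLinearMap ∘ₗ TensorAlgebra.ι ℂ

theorem ι_mul_ι (G : LieSuperalgebra 𝔤) {i j : ZMod 2} {x y : 𝔤}
    (hx : x ∈ G.gr i) (hy : y ∈ G.gr j) :
    G.ι x * G.ι y = G.ι (G.bracket x y) + koszulSign i j • (G.ι y * G.ι x) := by
  have h : G.envMk _ = G.envMk _ := RingQuot.mkAlgHom_rel ℂ (EnvRel.mk hx hy)
  rw [map_add, map_smul, map_mul, map_mul] at h
  exact h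

/-- The universal property of `U(G)`. -/
def envLift (G : LieSuperalgebra 𝔤) {A : Type*} [Ring A] [Algebra ℂ A] (f : 𝔤 →ₗ[ℂ] A)
    (hf : ∀ i j x y, x ∈ G.gr i → y ∈ G.gr j →
      f x * f y = f (G.bracket x y) + koszulSign i j • (f y * f x)) : G.Env →ₐ[ℂ] A :=
  (RingQuot.liftAlgHom ℂ ⟨TensorAlgebra.lift ℂ f, by
    intro a b h
    induction h with
    | mk hx hy => simpa using hf _ _ _ _ hx hy⟩ : RingQuot G.EnvRel →ₐ[ℂ] A)

@[simp]
theorem envLift_ι (G : LieSuperalgebra 𝔤) {A : Type*} [Ring A] [Algebra ℂ A] (f : 𝔤 →ₗ[ℂ] A)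
    (hf : ∀ i j x y, x ∈ G.gr i → y ∈ G.gr j →
      f x * f y = f (G.bracket x y) + koszulSign i j • (f y * f x)) (x : 𝔤) :
    G.envLift f hf (G.ι x) = f x := by
  have h : G.envLift f hf (G.envMk (TensorAlgebra.ι ℂ x))
      = TensorAlgebra.lift ℂ f (TensorAlgebra.ι ℂ x) :=
    RingQuot.liftAlgHom_mkAlgHom_apply ℂ _ _ _
  rwa [TensorAlgebra.lift_ι_apply] at h

theorem env_hom_ext (G : LieSuperalgebra 𝔤) {A : Type*} [Ring A] [Algebra ℂ A]
    {f g : G.Env →ₐ[ℂ] A} (h : ∀ x, f (G.ι x) = g (G.ι x)) : f = g := by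
  have hfg : f.comp G.envMk = g.comp G.envMk := by
    apply TensorAlgebra.hom_ext
    ext x
    exact h x
  exact RingQuot.ringQuot_ext' ℂ (s := G.EnvRel) f g hfg

/-- The parity involution of `U(G)`: the automorphism that extends the one of `G`. -/
def envParity (G : LieSuperalgebra 𝔤) : G.Env →ₐ[ℂ] G.Env :=
  G.envLift (G.ι ∘ₗ G.parityInv) (by
    intro i j x y hx hy
    simp only [LinearMap.comp_apply]
    rw [G.parityInv_bracket hx hy, G.parityInv_of_mem hx, G.parityInv_of_mem hy]
    simp only [map_smul, LinearMap.smul_apply, smul_mul_assoc, mul_smul_comm]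
    rw [G.ι_mul_ι hx hy]
    module)

@[simp]
theorem envParity_ι (G : LieSuperalgebra 𝔤) (x : 𝔤) :
    G.envParity (G.ι x) = G.ι (G.parityInv x) := by
  simp [envParity]

theorem envParity_envParity (G : LieSuperalgebra 𝔤) (u : G.Env) :
    G.envParity (G.envParity u) = u := by
  have : G.envParity.comp G.envParity = AlgHom.id ℂ G.Env :=
    G.env_hom_ext fun x => by simp [G.parityInv_parityInv]
  exact AlgHom.congr_fun this u

end LieSuperalgebra

namespace SuperModule

variable {G : LieSuperalgebra 𝔤} {V : Type*} [AddCommGroup V] [Module ℂ V]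

/-- The action of `U(G)` on a `G`-module. -/
def envAct (M : SuperModule G V) : G.Env →ₐ[ℂ] Module.End ℂ V :=
  G.envLift M.act (by
    intro i j x y hx hy
    rw [M.act_bracket hx hy]
    abel)

@[simp]
theorem envAct_ι (M : SuperModule G V) (x : 𝔤) : M.envAct (G.ι x) = M.act x := by
  simp [envAct]

end SuperModule

/-! ### Subsuperalgebras -/

/-- A Lie subsuperalgebra of `G`. -/
structure LieSubsuperalgebra (G : LieSuperalgebra 𝔤) where
  carrier : Submodule ℂ 𝔤
  graded : carrier = (carrier ⊓ G.gr 0) ⊔ (carrier ⊓ G.gr 1)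
  bracket_mem : ∀ {x y}, x ∈ carrier → y ∈ carrier → G.bracket x y ∈ carrier

namespace LieSubsuperalgebra

variable {G : LieSuperalgebra 𝔤}

/-- A Lie subsuperalgebra as a Lie superalgebra. -/
def toLie (h : LieSubsuperalgebra G) : LieSuperalgebra h.carrier where
  gr i := (G.gr i).comap h.carrier.subtype
  isCompl := by
    constructor
    · rw [Submodule.disjoint_def]
      intro x h0 h1
      exact Subtype.ext ((Submodule.disjoint_def.1 G.isCompl.disjoint) x h0 h1)
    · rw [codisjoint_iff_le_sup]
      intro x _
      have hx : (x : 𝔤) ∈ (h.carrier ⊓ G.gr 0) ⊔ (h.carrier ⊓ G.gr 1) := h.graded ▸ x.2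
      obtain ⟨a, ha, b, hb, hab⟩ := Submodule.mem_sup.1 hx
      exact Submodule.mem_sup.2 ⟨⟨a, ha.1⟩, ha.2, ⟨b, hb.1⟩, hb.2, Subtype.ext hab⟩
  bracket := LinearMap.mk₂ ℂ (fun x y => ⟨G.bracket x y, h.bracket_mem x.2 y.2⟩)
    (fun _ _ _ => by ext; simp) (fun _ _ _ => by ext; simp)
    (fun _ _ _ => by ext; simp) (fun _ _ _ => by ext; simp)
  bracket_mem hx hy := G.bracket_mem hx hy
  bracket_skew hx hy := by
    ext
    simpa using G.bracket_skew hx hy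
  jacobi hx hy z := by
    ext
    simpa using G.jacobi hx hy z

@[simp]
theorem coe_bracket (h : LieSubsuperalgebra G) (x y : h.carrier) :
    ((h.toLie.bracket x y : h.carrier) : 𝔤) = G.bracket x y := rfl

theorem coe_parityInv (h : LieSubsuperalgebra G) (x : h.carrier) :
    ((h.toLie.parityInv x : h.carrier) : 𝔤) = G.parityInv x := by
  have : h.carrier.subtype ∘ₗ h.toLie.parityInv = G.parityInv ∘ₗ h.carrier.subtype := by
    refine h.toLie.linearMap_ext fun i v hv => ?_
    have hv' : (v : 𝔤) ∈ G.gr i := hv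
    simp [h.toLie.parityInv_of_mem hv, G.parityInv_of_mem hv']
  exact LinearMap.congr_fun this x

/-- The map `U(H) → U(G)` induced by the inclusion of `H` in `G`. -/
def envMap (h : LieSubsuperalgebra G) : h.toLie.Env →ₐ[ℂ] G.Env :=
  h.toLie.envLift (G.ι ∘ₗ h.carrier.subtype) (by
    intro i j x y hx hy
    exact G.ι_mul_ι (x := x) (y := y) hx hy)

@[simp]
theorem envMap_ι (h : LieSubsuperalgebra G) (x : h.carrier) :
    h.envMap (h.toLie.ι x) = G.ι (x : 𝔤) :=
  h.toLie.envLift_ι _ _ x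

theorem envParity_envMap (h : LieSubsuperalgebra G) (a : h.toLie.Env) :
    G.envParity (h.envMap a) = h.envMap (h.toLie.envParity a) := by
  have : G.envParity.comp h.envMap = h.envMap.comp h.toLie.envParity :=
    h.toLie.env_hom_ext fun x => by simp [h.coe_parityInv]
  exact AlgHom.congr_fun this a

/-- The `H`-module `G / H`, on which `H` acts by `ad`. -/
def quotientModule (h : LieSubsuperalgebra G) : SuperModule h.toLie (𝔤 ⧸ h.carrier) where
  gr i := (G.gr i).map h.carrier.mkQ
  isCompl := by
    constructor
    · rw [Submodule.disjoint_def]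
      rintro _ ⟨a, ha, rfl⟩ ⟨b, hb, hab⟩
      have hmem : b - a ∈ h.carrier := (Submodule.Quotient.eq _).1 hab
      rw [h.graded] at hmem
      obtain ⟨c, hc, d, hd, hcd⟩ := Submodule.mem_sup.1 hmem
      have h0 : a + c = 0 := by
        refine Submodule.disjoint_def.1 G.isCompl.disjoint _ (add_mem ha hc.2) ?_
        have : a + c = b - d := by
          rw [← sub_eq_zero]
          have := sub_eq_zero.2 hcd
          rw [← this]; abel
        rw [this]
        exact sub_mem hb hd.2
      have : a = -c := eq_neg_of_add_eq_zero_left h0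
      rw [this]
      simpa using hc.1
    · rw [codisjoint_iff_le_sup]
      intro x _
      obtain ⟨y, rfl⟩ := Submodule.mkQ_surjective _ x
      obtain ⟨a, ha, b, hb, rfl⟩ := G.exists_add y
      exact Submodule.mem_sup.2 ⟨_, ⟨a, ha, rfl⟩, _, ⟨b, hb, rfl⟩, by simp⟩
  act :=
    { toFun := fun x => Submodule.mapQ _ _ (G.bracket x) fun _ hy => h.bracket_mem x.2 hy
      map_add' := fun x y => by ext; simp
      map_smul' := fun c x => by ext; simp }
  act_mem := by
    rintro i j x _ hx ⟨v, hv, rfl⟩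
    exact ⟨G.bracket x v, G.bracket_mem hx hv, by simp⟩
  act_bracket := by
    intro i j x y hx hy
    ext z
    have := G.jacobi (x := x) (y := y) hx hy z
    simp [this]

/-! ### Induced modules -/

variable {V : Type*} [AddCommGroup V] [Module ℂ V]

/-- The relations `u a ⊗ v = u ⊗ a v`, for `u ∈ U(G)`, `a ∈ U(H)`, `v ∈ V`, as a subspace
of `U(G) ⊗_ℂ V`. -/
def balanced (h : LieSubsuperalgebra G) (M : SuperModule h.toLie V) :
    Submodule ℂ (G.Env ⊗[ℂ] V) :=
  Submodule.span ℂ {w | ∃ (u : G.Env) (a : h.toLie.Env) (v : V),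
    w = (u * h.envMap a) ⊗ₜ[ℂ] v - u ⊗ₜ[ℂ] (M.envAct a v)}

/-- The space `U(G) ⊗_{U(H)} V` of the induced module. -/
abbrev IndSpace (h : LieSubsuperalgebra G) (M : SuperModule h.toLie V) :=
  (G.Env ⊗[ℂ] V) ⧸ h.balanced M

theorem balanced_mulLeft (h : LieSubsuperalgebra G) (M : SuperModule h.toLie V) (b : G.Env) :
    h.balanced M ≤ (h.balanced M).comap (LinearMap.rTensor V (LinearMap.mulLeft ℂ b)) := by
  rw [balanced, Submodule.span_le]
  rintro _ ⟨u, a, v, rfl⟩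
  refine Submodule.subset_span ⟨b * u, a, v, ?_⟩
  simp [mul_assoc]

theorem parityInv_envAct (h : LieSubsuperalgebra G) (M : SuperModule h.toLie V)
    (a : h.toLie.Env) (v : V) :
    M.parityInv (M.envAct a v) = M.envAct (h.toLie.envParity a) (M.parityInv v) := by
  let P : Module.End ℂ V := M.parityInv
  have hP : P * P = 1 := LinearMap.ext M.parityInv_parityInv
  let f : h.toLie.Env →ₐ[ℂ] Module.End ℂ V :=
    h.toLie.envLift (LinearMap.mulLeft ℂ P ∘ₗ LinearMap.mulRight ℂ P ∘ₗ M.act) (by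
      intro i j x y hx hy
      simp only [LinearMap.comp_apply, LinearMap.mulLeft_apply, LinearMap.mulRight_apply]
      rw [M.act_bracket hx hy]
      have e : ∀ A B : Module.End ℂ V, P * (A * P) * (P * (B * P)) = P * (A * B * P) := by
        intro A B
        calc _ = P * A * (P * P) * B * P := by simp only [mul_assoc]
          _ = _ := by rw [hP]; simp only [mul_assoc, mul_one]
      rw [e, e]
      simp only [sub_mul, mul_sub, smul_mul_assoc, mul_smul_comm]
      abel)
  have hf : f = M.envAct.comp h.toLie.envParity := by
    refine h.toLie.env_hom_ext fun x => LinearMap.ext fun w => ?_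
    simp only [f, LieSuperalgebra.envLift_ι, LinearMap.comp_apply, LinearMap.mulLeft_apply,
      LinearMap.mulRight_apply, Module.End.mul_apply, AlgHom.comp_apply,
      LieSuperalgebra.envParity_ι, SuperModule.envAct_ι, P]
    rw [M.parityInv_act, M.parityInv_parityInv]
  have hg : ∀ a, f a = P * M.envAct a * P := by
    intro a
    let g : h.toLie.Env →ₐ[ℂ] Module.End ℂ V := AlgHom.ofLinearMap
      (LinearMap.mulLeft ℂ P ∘ₗ LinearMap.mulRight ℂ P ∘ₗ M.envAct.toLinearMap)
      (by simp [hP])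
      (by
        intro x y
        simp only [LinearMap.comp_apply, LinearMap.mulLeft_apply, LinearMap.mulRight_apply,
          AlgHom.toLinearMap_apply, map_mul]
        calc _ = P * M.envAct x * 1 * M.envAct y * P := by simp only [mul_assoc, one_mul]
          _ = _ := by rw [← hP]; simp only [mul_assoc])
    have : f = g := h.toLie.env_hom_ext fun x => by simp [f, g]
    rw [this]
    simp [g, mul_assoc]
  have := LinearMap.congr_fun ((hg a).symm.trans (AlgHom.congr_fun hf a)) (M.parityInv v)
  simpa [P, M.parityInv_parityInv] using this

theorem balanced_parity (h : LieSubsuperalgebra G) (M : SuperModule h.toLie V) :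
    h.balanced M ≤
      (h.balanced M).comap (TensorProduct.map G.envParity.toLinearMap M.parityInv) := by
  rw [balanced, Submodule.span_le]
  rintro _ ⟨u, a, v, rfl⟩
  refine Submodule.subset_span ⟨G.envParity u, h.toLie.envParity a, M.parityInv v, ?_⟩
  simp [h.envParity_envMap, h.parityInv_envAct]

/-- The parity involution `u ⊗ v ↦ (-1)^{p(u) + p(v)} u ⊗ v` of the induced module. -/
def indParity (h : LieSubsuperalgebra G) (M : SuperModule h.toLie V) :
    h.IndSpace M →ₗ[ℂ] h.IndSpace M :=
  Submodule.mapQ _ _ _ (h.balanced_parity M)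

theorem indParity_mk (h : LieSubsuperalgebra G) (M : SuperModule h.toLie V)
    (u : G.Env) (v : V) :
    h.indParity M ((h.balanced M).mkQ (u ⊗ₜ v))
      = (h.balanced M).mkQ (G.envParity u ⊗ₜ M.parityInv v) := by
  simp [indParity]

theorem indParity_indParity (h : LieSubsuperalgebra G) (M : SuperModule h.toLie V)
    (w : h.IndSpace M) : h.indParity M (h.indParity M w) = w := by
  have : h.indParity M ∘ₗ h.indParity M = LinearMap.id := by
    apply Submodule.linearMap_qext
    apply TensorProduct.ext'
    intro u v
    simp only [LinearMap.comp_apply, indParity_mk, LinearMap.id_apply, G.envParity_envParity,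
      M.parityInv_parityInv]
  exact LinearMap.congr_fun this w

/-- Left multiplication by `x` on the induced module. -/
def indAct (h : LieSubsuperalgebra G) (M : SuperModule h.toLie V) :
    𝔤 →ₗ[ℂ] Module.End ℂ (h.IndSpace M) where
  toFun x := Submodule.mapQ _ _ _ (h.balanced_mulLeft M (G.ι x))
  map_add' x y := by
    apply Submodule.linearMap_qext
    apply TensorProduct.ext'
    intro u v
    simp [add_mul, TensorProduct.add_tmul]
  map_smul' c x := by
    apply Submodule.linearMap_qext
    apply TensorProduct.ext'
    intro u v
    simp [← TensorProduct.smul_tmul']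

theorem indAct_mk (h : LieSubsuperalgebra G) (M : SuperModule h.toLie V)
    (x : 𝔤) (u : G.Env) (v : V) :
    h.indAct M x ((h.balanced M).mkQ (u ⊗ₜ v)) = (h.balanced M).mkQ ((G.ι x * u) ⊗ₜ v) := by
  simp [indAct]

/-- The induced module `Ind_H^G V = U(G) ⊗_{U(H)} V`. -/
def ind (h : LieSubsuperalgebra G) (M : SuperModule h.toLie V) :
    SuperModule G (h.IndSpace M) where
  toSuperspace := Superspace.ofInvolution (h.indParity M) (h.indParity_indParity M)
  act := h.indAct M
  act_mem := by
    intro i j x w hx hw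
    rw [Superspace.mem_ofInvolution] at hw ⊢
    have : h.indParity M ∘ₗ h.indAct M x
        = (paritySign i • h.indAct M x) ∘ₗ h.indParity M := by
      apply Submodule.linearMap_qext
      apply TensorProduct.ext'
      intro u v
      simp only [LinearMap.comp_apply, LinearMap.smul_apply, indParity_mk, indAct_mk, map_mul,
        LieSuperalgebra.envParity_ι, G.parityInv_of_mem hx, map_smul, smul_mul_assoc,
        ← TensorProduct.smul_tmul']
    have := LinearMap.congr_fun this w
    simp only [LinearMap.comp_apply, LinearMap.smul_apply] at this
    rw [this, hw, map_smul, smul_smul, paritySign_add]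
  act_bracket := by
    intro i j x y hx hy
    apply Submodule.linearMap_qext
    apply TensorProduct.ext'
    intro u v
    simp only [LinearMap.comp_apply, LinearMap.sub_apply, LinearMap.smul_apply,
      Module.End.mul_apply, indAct_mk]
    rw [← map_smul, ← map_sub, TensorProduct.smul_tmul', ← TensorProduct.sub_tmul, ← mul_assoc,
      ← mul_assoc, G.ι_mul_ι hx hy, add_mul, smul_mul_assoc]
    congr 2
    abel

/-! ### Characters -/

/-- The functional `χ` restricts to a character of `H`: it vanishes on odd elements of `H` and on
`[H, H]`. -/
def IsCharacter (h : LieSubsuperalgebra G) (χ : Module.Dual ℂ 𝔤) : Prop :=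
  (∀ x ∈ h.carrier, x ∈ G.gr 1 → χ x = 0) ∧
    ∀ x ∈ h.carrier, ∀ y ∈ h.carrier, χ (G.bracket x y) = 0

theorem IsCharacter.add {h : LieSubsuperalgebra G} {χ ψ : Module.Dual ℂ 𝔤}
    (hχ : h.IsCharacter χ) (hψ : h.IsCharacter ψ) : h.IsCharacter (χ + ψ) :=
  ⟨fun x hx hx' => by simp [hχ.1 x hx hx', hψ.1 x hx hx'],
    fun x hx y hy => by simp [hχ.2 x hx y hy, hψ.2 x hx y hy]⟩

/-- The `(1, 0)`-dimensional module of `H` that is given by the character `χ`. -/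
def charModule (h : LieSubsuperalgebra G) (χ : Module.Dual ℂ 𝔤) (hχ : h.IsCharacter χ) :
    SuperModule h.toLie ℂ where
  gr i := if i = 0 then ⊤ else ⊥
  isCompl := by simpa using isCompl_top_bot
  act := LinearMap.toSpanSingleton ℂ (Module.End ℂ ℂ) 1 ∘ₗ χ ∘ₗ h.carrier.subtype
  act_mem := by
    intro i j x v hx hv
    rcases parity_cases i with rfl | rfl
    · rw [zero_add]
      exact Submodule.smul_mem _ _ hv
    · have : χ x = 0 := hχ.1 x x.2 hx
      simp [this]
  act_bracket := by
    intro i j x y hx hy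
    have h0 : χ (G.bracket x y) = 0 := hχ.2 x x.2 y y.2
    ext
    rcases parity_cases i with rfl | rfl
    · simp [koszulSign, h0, mul_comm]
    · have : χ x = 0 := hχ.1 x x.2 hx
      simp [h0, this]

/-- The functional `θ_H`: one half of the supertrace of `ad x` on `G / H` for even `x`, and zero
for odd `x`. Here `H` contains the even part of `G`. -/
def theta (h : LieSubsuperalgebra G) (h0 : G.gr 0 ≤ h.carrier) : Module.Dual ℂ 𝔤 :=
  (1 / 2 : ℂ) • (h.quotientModule.supertrace ∘ₗ h.quotientModule.act ∘ₗ
    Submodule.inclusion h0 ∘ₗ G.evenPart)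

theorem theta_odd (h : LieSubsuperalgebra G) (h0 : G.gr 0 ≤ h.carrier) {x : 𝔤}
    (hx : x ∈ G.gr 1) : h.theta h0 x = 0 := by
  have : G.evenPart x = 0 := (Submodule.projectionOnto_apply_eq_zero_iff G.isCompl).2 hx
  simp [theta, this]

theorem theta_even (h : LieSubsuperalgebra G) (h0 : G.gr 0 ≤ h.carrier) {x : 𝔤}
    (hx : x ∈ G.gr 0) :
    h.theta h0 x = 1 / 2 * h.quotientModule.supertrace (h.quotientModule.act ⟨x, h0 hx⟩) := by
  have : G.evenPart x = ⟨x, hx⟩ := Submodule.projectionOnto_apply_of_mem_left G.isCompl hx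
  change (1 / 2 : ℂ) • h.quotientModule.supertrace
    (h.quotientModule.act (Submodule.inclusion h0 (G.evenPart x))) = _
  rw [this]
  rfl

theorem quotient_act_odd (h : LieSubsuperalgebra G) (h0 : G.gr 0 ≤ h.carrier) {x : h.carrier}
    (hx : (x : 𝔤) ∈ G.gr 1) : h.quotientModule.act x = 0 := by
  ext z
  obtain ⟨a, ha, b, hb, rfl⟩ := G.exists_add z
  have h1 : G.bracket x a ∈ h.carrier := h.bracket_mem x.2 (h0 ha)
  have h2 : G.bracket x b ∈ h.carrier := h0 (G.bracket_mem hx hb)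
  have h3 : G.bracket x (a + b) ∈ h.carrier := by rw [map_add]; exact add_mem h1 h2
  exact (Submodule.Quotient.mk_eq_zero _).2 h3

/-- `θ_H` is a character of `H`. -/
theorem isCharacter_theta (h : LieSubsuperalgebra G) (h0 : G.gr 0 ≤ h.carrier) :
    h.IsCharacter (h.theta h0) := by
  refine ⟨fun x _ hx' => h.theta_odd h0 hx', fun x hx y hy => ?_⟩
  have e00 : ∀ x ∈ G.gr 0, ∀ y ∈ G.gr 0, h.theta h0 (G.bracket x y) = 0 := by
    intro x hx y hy
    have hb : G.bracket x y ∈ G.gr 0 := by simpa using G.bracket_mem hx hy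
    rw [h.theta_even h0 hb]
    have e : (⟨G.bracket x y, h0 hb⟩ : h.carrier)
        = h.toLie.bracket ⟨x, h0 hx⟩ ⟨y, h0 hy⟩ := rfl
    have hc : ∀ v, h.quotientModule.parityInv (h.quotientModule.act ⟨x, h0 hx⟩ v)
        = h.quotientModule.act ⟨x, h0 hx⟩ (h.quotientModule.parityInv v) := by
      intro v
      have hx' : (⟨x, h0 hx⟩ : h.carrier) ∈ h.toLie.gr 0 := hx
      rw [h.quotientModule.parityInv_act, h.toLie.parityInv_of_mem hx', paritySign_zero, one_smul]
    rw [e, h.quotientModule.act_bracket (i := 0) (j := 0) hx hy]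
    have hc' : (h.quotientModule.parityInv : Module.End ℂ _)
          * h.quotientModule.act ⟨x, h0 hx⟩
        = h.quotientModule.act ⟨x, h0 hx⟩ * h.quotientModule.parityInv := LinearMap.ext hc
    have ht : LinearMap.trace ℂ _ ((h.quotientModule.parityInv : Module.End ℂ _)
          * (h.quotientModule.act ⟨x, h0 hx⟩ * h.quotientModule.act ⟨y, h0 hy⟩))
        = LinearMap.trace ℂ _ ((h.quotientModule.parityInv : Module.End ℂ _)
          * (h.quotientModule.act ⟨y, h0 hy⟩ * h.quotientModule.act ⟨x, h0 hx⟩)) := by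
      rw [← mul_assoc, hc', mul_assoc, LinearMap.trace_mul_comm, mul_assoc]
    simp [Superspace.supertrace, koszulSign, mul_sub, ht]
  have e11 : ∀ x ∈ h.carrier, x ∈ G.gr 1 → ∀ y ∈ h.carrier, y ∈ G.gr 1 →
      h.theta h0 (G.bracket x y) = 0 := by
    intro x hx hx' y hy hy'
    have hb : G.bracket x y ∈ G.gr 0 := by
      have h2 : (1 + 1 : ZMod 2) = 0 := by decide
      simpa [h2] using G.bracket_mem hx' hy'
    rw [h.theta_even h0 hb]
    have e : (⟨G.bracket x y, h0 hb⟩ : h.carrier) = h.toLie.bracket ⟨x, hx⟩ ⟨y, hy⟩ := rfl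
    rw [e, h.quotientModule.act_bracket (i := 1) (j := 1) hx' hy',
      h.quotient_act_odd h0 (x := ⟨x, hx⟩) hx']
    simp
  have e01 : ∀ x ∈ G.gr 0, ∀ y ∈ G.gr 1, h.theta h0 (G.bracket x y) = 0 := fun x hx y hy =>
    h.theta_odd h0 (by simpa using G.bracket_mem hx hy)
  have e10 : ∀ x ∈ G.gr 1, ∀ y ∈ G.gr 0, h.theta h0 (G.bracket x y) = 0 := fun x hx y hy =>
    h.theta_odd h0 (by simpa using G.bracket_mem hx hy)
  rw [h.graded] at hx hy
  obtain ⟨a, ha, b, hb, rfl⟩ := Submodule.mem_sup.1 hx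
  obtain ⟨c, hc, d, hd, rfl⟩ := Submodule.mem_sup.1 hy
  simp [e00 a ha.2 c hc.2, e01 a ha.2 d hd.2, e10 b hb.2 c hc.2, e11 b hb.1 hb.2 d hd.1 hd.2]

end LieSubsuperalgebra

/-! ### Polarizations and twisted induced modules -/

namespace LieSuperalgebra

/-- The space `L` of functionals that vanish on the odd part and on `[G₀, G₀]`. -/
def charSpace (G : LieSuperalgebra 𝔤) : Submodule ℂ (Module.Dual ℂ 𝔤) where
  carrier := {l | (∀ x ∈ G.gr 1, l x = 0) ∧ ∀ x ∈ G.gr 0, ∀ y ∈ G.gr 0, l (G.bracket x y) = 0}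
  add_mem' := fun ha hb => ⟨fun x hx => by simp [ha.1 x hx, hb.1 x hx],
    fun x hx y hy => by simp [ha.2 x hx y hy, hb.2 x hx y hy]⟩
  zero_mem' := ⟨fun _ _ => rfl, fun _ _ _ _ => rfl⟩
  smul_mem' := fun c _ ha => ⟨fun x hx => by simp [ha.1 x hx],
    fun x hx y hy => by simp [ha.2 x hx y hy]⟩

/-- The form `f_l(ξ₁, ξ₂) = l([ξ₁, ξ₂])` on the odd part. -/
def oddForm (G : LieSuperalgebra 𝔤) (l : Module.Dual ℂ 𝔤) : LinearMap.BilinForm ℂ (G.gr 1) :=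
  (G.bracket.compr₂ l).domRestrict₁₂ (G.gr 1) (G.gr 1)

/-- The rank of the form `f_l`. -/
def oddRank (G : LieSuperalgebra 𝔤) (l : Module.Dual ℂ 𝔤) : ℕ :=
  Module.finrank ℂ (LinearMap.range (G.oddForm l))

/-- `H` is a polarization for `l`: `l([H, H]) = 0`, `H ⊇ G₀`, and `H₁` is a maximal isotropic
subspace of `G₁` for the form `f_l`. -/
structure IsPolarization (G : LieSuperalgebra 𝔤) (l : Module.Dual ℂ 𝔤)
    (h : LieSubsuperalgebra G) : Prop where
  bracket_eq_zero : ∀ x ∈ h.carrier, ∀ y ∈ h.carrier, l (G.bracket x y) = 0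
  even_le : G.gr 0 ≤ h.carrier
  maximal_isotropic : Maximal
    (fun P : Submodule ℂ (G.gr 1) => ∀ x ∈ P, ∀ y ∈ P, G.oddForm l x y = 0)
    (h.carrier.comap (G.gr 1).subtype)

variable {G : LieSuperalgebra 𝔤} {l : Module.Dual ℂ 𝔤} {h : LieSubsuperalgebra G}

theorem IsPolarization.isCharacter (hp : G.IsPolarization l h) (hl : l ∈ G.charSpace) :
    h.IsCharacter l :=
  ⟨fun x _ hx' => hl.1 x hx', hp.bracket_eq_zero⟩

/-- The functional `θ_H` for a polarization `H`. -/
abbrev IsPolarization.theta (hp : G.IsPolarization l h) : Module.Dual ℂ 𝔤 :=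
  h.theta hp.even_le

/-- The `H`-module given by the character `l`, for a polarization `H` of `l ∈ L`. -/
abbrev polChar (hl : l ∈ G.charSpace) (hp : G.IsPolarization l h) : SuperModule h.toLie ℂ :=
  h.charModule l (hp.isCharacter hl)

/-- The `H`-module given by the twisted character `l + θ_H`. -/
abbrev twistedChar (hl : l ∈ G.charSpace) (hp : G.IsPolarization l h) :
    SuperModule h.toLie ℂ :=
  h.charModule (l + hp.theta) ((hp.isCharacter hl).add (h.isCharacter_theta hp.even_le))

/-- The induced module `Ind_H^G(l)` for a polarization `H` of `l ∈ L`. -/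
abbrev indPol (hl : l ∈ G.charSpace) (hp : G.IsPolarization l h) :
    SuperModule G (h.IndSpace (polChar hl hp)) :=
  h.ind (polChar hl hp)

/-- The twisted induced module `I_H^G(l) = Ind_H^G(l + θ_H)` for a polarization `H` of `l ∈ L`. -/
abbrev twistedInd (hl : l ∈ G.charSpace) (hp : G.IsPolarization l h) :
    SuperModule G (h.IndSpace (twistedChar hl hp)) :=
  h.ind (twistedChar hl hp)

end LieSuperalgebra

end

end

/-! Solvability enters only through Lie's theorem for 𝔤₀: if A and B are 𝔤₀-stable subspaces of 𝔤
and B is not contained in A, then B contains a vector outside A that is a 𝔤₀-eigenvector modulo A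
(`exists_eigenvector_mod`). Hence odd vectors can be adjoined one at a time.

Induced modules. For 𝔤₀ ⊕ Q ⊂ 𝔤₀ ⊕ Q ⊕ ℂξ, inducing a module W gives W ⊕ ξW, and `stepRep` writes
down the action. Starting from a character χ of 𝔤₀ ⊕ P, this builds a concrete model of the induced
module without the PBW theorem. The model carries its universal property, the trace of every even x
and the eigenvalues of the ad-nilpotent ones (`InducedModel`).

Irreducibility. Let P be maximal isotropic for f_χ. Its orthogonal P^⊥ is P or P ⊕ ℂω with f_χ(ω,ω)
≠ 0. Elements of P lower the degree in the odd vectors adjoined beyond P^⊥, and they do so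
nondegenerately (`IsFiltration`). So every nonzero invariant subspace meets the span of v and ωv,
where v generates the module. If P^⊥ = P this forces v into the subspace, which gives G-type.
Otherwise a graded invariant subspace still contains v or ωv, hence is everything, while v ↦ ωv
extends to a module endomorphism with nonzero scalar square, whose eigenspaces are invariant but not
graded: Q-type. Counting dimensions, P^⊥ = P exactly when rk f_χ is even.

Invariant of the isomorphism class. An even x acts on Ind(χ) with trace dim · (χ − θ_𝔥)(x), and ≅_Π
does not change the action of even elements. Thus χ − θ_𝔥 is determined by the module
(`eq_of_isIsoUpToParity`).

Perturbation. Call x ∈ 𝔤₀ nil if (ad x)⁴ maps 𝔤₁ into the radical of f_λ. Brackets within a stable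
maximal isotropic P, and brackets of P ⊕ ℂξ with a 𝔤₀-eigenvector ξ modulo P, are nil. So if μ ∈ L
agrees with λ on nil elements, P stays maximal isotropic for f_μ (`MaxIsotropic.perturb`). Since θ_𝔥
is a trace, it kills nil elements, and a polarization for λ is also one for λ ± θ_𝔥.

Exhaustion. In an irreducible V take a homogeneous vector of 𝔤₀-weight μ killed by a stable P ⊂ 𝔤₁,
with P as large as possible. If P were not maximal isotropic for f_μ, an isotropic vector could be
adjoined, replacing w by ζw if needed. So P defines a polarization, and V is induced by Frobenius
reciprocity and Schur's lemma.

Independence. Run the same argument in I_𝔥(λ) with P confined to 𝔱₁ for a second polarization 𝔱. Nil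
elements have the single eigenvalue λ(x) there, so 𝔱₁ is isotropic for the weight found, P fills 𝔱₁,
and the module is Ind_𝔱(μ). The trace invariant forces μ = λ + θ_𝔱. -/

noncomputable section

namespace LieSuperalgebra

variable {𝔤 : Type*} [AddCommGroup 𝔤] [Module ℂ 𝔤] (G : LieSuperalgebra 𝔤)

/-! ### Brackets of homogeneous elements -/

theorem bracket_mem_of_even {i : ZMod 2} {x y : 𝔤} (hx : x ∈ G.gr 0) (hy : y ∈ G.gr i) :
    G.bracket x y ∈ G.gr i := by
  simpa using G.bracket_mem hx hy

theorem bracket_mem_of_odd {x y : 𝔤} (hx : x ∈ G.gr 1) (hy : y ∈ G.gr 1) :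
    G.bracket x y ∈ G.gr 0 := by
  have h2 : (1 + 1 : ZMod 2) = 0 := by decide
  simpa [h2] using G.bracket_mem hx hy

theorem bracket_comm_of_odd {x y : 𝔤} (hx : x ∈ G.gr 1) (hy : y ∈ G.gr 1) :
    G.bracket x y = G.bracket y x := by
  have h : koszulSign 1 1 = -1 := by
    have : (1 : ZMod 2).val = 1 := rfl
    simp [koszulSign, this]
  simpa [h] using G.bracket_skew hx hy

theorem bracket_skew_of_even {i : ZMod 2} {x y : 𝔤} (hx : x ∈ G.gr 0) (hy : y ∈ G.gr i) :
    G.bracket x y = -G.bracket y x := by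
  simpa [koszulSign] using G.bracket_skew hx hy

theorem bracket_skew_of_odd_even {x y : 𝔤} (hx : x ∈ G.gr 1) (hy : y ∈ G.gr 0) :
    G.bracket x y = -G.bracket y x := by
  rw [G.bracket_skew_of_even hy hx, neg_neg]

theorem jacobi_of_even {i : ZMod 2} {x y : 𝔤} (hx : x ∈ G.gr 0) (hy : y ∈ G.gr i) (z : 𝔤) :
    G.bracket x (G.bracket y z) = G.bracket (G.bracket x y) z + G.bracket y (G.bracket x z) := by
  simpa [koszulSign] using G.jacobi hx hy z

theorem jacobi_of_odd {x y : 𝔤} (hx : x ∈ G.gr 1) (hy : y ∈ G.gr 1) (z : 𝔤) :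
    G.bracket x (G.bracket y z) = G.bracket (G.bracket x y) z - G.bracket y (G.bracket x z) := by
  have h : koszulSign 1 1 = -1 := by
    have : (1 : ZMod 2).val = 1 := rfl
    simp [koszulSign, this]
  simpa [h, sub_eq_add_neg] using G.jacobi hx hy z

theorem jacobi_of_even' {i : ZMod 2} {x y : 𝔤} (hx : x ∈ G.gr 0) (hy : y ∈ G.gr i) (z : 𝔤) :
    G.bracket (G.bracket x y) z = G.bracket x (G.bracket y z) - G.bracket y (G.bracket x z) := by
  rw [G.jacobi_of_even hx hy z]; abel

theorem jacobi_of_odd' {x y : 𝔤} (hx : x ∈ G.gr 1) (hy : y ∈ G.gr 1) (z : 𝔤) :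
    G.bracket (G.bracket x y) z = G.bracket x (G.bracket y z) + G.bracket y (G.bracket x z) := by
  rw [G.jacobi_of_odd hx hy z]; abel

/-- A subspace of `𝔤` that is stable under the adjoint action of the even part. -/
def EvenStable (A : Submodule ℂ 𝔤) : Prop := ∀ x ∈ G.gr 0, ∀ y ∈ A, G.bracket x y ∈ A

variable {G}

theorem EvenStable.sup {A B : Submodule ℂ 𝔤} (hA : G.EvenStable A) (hB : G.EvenStable B) :
    G.EvenStable (A ⊔ B) := by
  intro x hx y hy
  obtain ⟨a, ha, b, hb, rfl⟩ := Submodule.mem_sup.1 hy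
  rw [map_add]
  exact add_mem (Submodule.mem_sup_left (hA x hx a ha)) (Submodule.mem_sup_right (hB x hx b hb))

theorem EvenStable.sup_span {A : Submodule ℂ 𝔤} (hA : G.EvenStable A) {ξ : 𝔤}
    (h : ∀ x ∈ G.gr 0, G.bracket x ξ ∈ A ⊔ ℂ ∙ ξ) : G.EvenStable (A ⊔ ℂ ∙ ξ) := by
  intro x hx y hy
  obtain ⟨a, ha, b, hb, rfl⟩ := Submodule.mem_sup.1 hy
  obtain ⟨c, rfl⟩ := Submodule.mem_span_singleton.1 hb
  rw [map_add, map_smul]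
  exact add_mem (Submodule.mem_sup_left (hA x hx a ha)) (Submodule.smul_mem _ _ (h x hx))

variable (G)

theorem evenStable_gr (i : ZMod 2) : G.EvenStable (G.gr i) :=
  fun _ hx _ hy => G.bracket_mem_of_even hx hy

theorem evenStable_bot : G.EvenStable ⊥ := by
  rintro x - y hy
  rw [(Submodule.mem_bot ℂ).1 hy]
  simp

/-! ### The even part as a Lie algebra, and Lie's theorem -/

/-- The even part of a Lie superalgebra is a Lie ring. -/
@[reducible] def evenLieRing : LieRing (G.gr 0) where
  bracket x y := ⟨G.bracket x y, G.bracket_mem_of_even x.2 y.2⟩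
  add_lie x y z := Subtype.ext (by simp)
  lie_add x y z := Subtype.ext (by simp)
  lie_self x := Subtype.ext (by
    have h := G.bracket_skew_of_even x.2 x.2
    have h2 : (2 : ℂ) • G.bracket (x : 𝔤) x = 0 := by
      rw [two_smul]
      nth_rewrite 1 [h]
      simp
    simpa using h2)
  leibniz_lie x y z := Subtype.ext (G.jacobi_of_even x.2 y.2 z)

/-- The even part of a Lie superalgebra is a Lie algebra. -/
@[reducible] def evenLieAlgebra : letI := G.evenLieRing; LieAlgebra ℂ (G.gr 0) :=
  letI := G.evenLieRing
  { lie_smul := fun c x y => Subtype.ext (by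
      change G.bracket x (c • y : G.gr 0) = c • G.bracket x y
      simp) }

theorem isSolvable_even (hG : G.IsSolvable) :
    letI := G.evenLieRing
    letI := G.evenLieAlgebra
    LieAlgebra.IsSolvable (G.gr 0) := by
  let := G.evenLieRing
  let := G.evenLieAlgebra
  have key : ∀ n, ∀ x ∈ LieAlgebra.derivedSeries ℂ (G.gr 0) n, (x : 𝔤) ∈ G.derivedSeries n := by
    intro n
    induction n with
    | zero => intro x _; exact Submodule.mem_top
    | succ n ih =>
      intro x hx
      rw [LieAlgebra.derivedSeries_def, LieAlgebra.derivedSeriesOfIdeal_succ,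
        ← LieSubmodule.mem_toSubmodule, LieSubmodule.lieIdeal_oper_eq_linear_span'] at hx
      induction hx using Submodule.span_induction with
      | mem y hy =>
        obtain ⟨a, ha, b, hb, rfl⟩ := hy
        exact Submodule.apply_mem_map₂ _ (ih a ha) (ih b hb)
      | zero => exact zero_mem _
      | add y z _ _ hy hz => exact add_mem hy hz
      | smul c y _ hy => exact Submodule.smul_mem _ c hy
  obtain ⟨n, hn⟩ := hG
  rw [LieAlgebra.isSolvable_iff ℂ]
  refine ⟨n, (LieSubmodule.eq_bot_iff _).2 fun x hx => Subtype.ext ?_⟩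
  have := key n x hx
  rw [hn] at this
  exact (Submodule.mem_bot ℂ).1 this

/-- Lie's theorem for the even part of a solvable Lie superalgebra. -/
theorem exists_eigenvector (hG : G.IsSolvable) {W : Type*} [AddCommGroup W] [Module ℂ W]
    [FiniteDimensional ℂ W] [Nontrivial W] (ρ : G.gr 0 →ₗ[ℂ] Module.End ℂ W)
    (hρ : ∀ x y z : G.gr 0, (z : 𝔤) = G.bracket x y →
      ∀ w, ρ z w = ρ x (ρ y w) - ρ y (ρ x w)) :
    ∃ w ≠ 0, ∀ x, ∃ c : ℂ, ρ x w = c • w := by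
  let := G.evenLieRing
  let := G.evenLieAlgebra
  have := G.isSolvable_even hG
  let : LieRingModule (G.gr 0) W :=
    { bracket := fun x w => ρ x w
      add_lie := fun x y w => by
        change ρ (x + y) w = ρ x w + ρ y w
        simp
      lie_add := fun x v w => map_add (ρ x) v w
      leibniz_lie := fun x y w => by
        have h := hρ x y ⁅x, y⁆ rfl w
        change ρ x (ρ y w) = ρ ⁅x, y⁆ w + ρ y (ρ x w)
        rw [h, sub_add_cancel] }
  have : LieModule ℂ (G.gr 0) W :=
    { smul_lie := fun c x w => by
        change ρ (c • x) w = c • ρ x w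
        simp
      lie_smul := fun c x w => map_smul (ρ x) c w }
  obtain ⟨χ, hχ⟩ := LieModule.exists_nontrivial_weightSpace_of_isSolvable ℂ (G.gr 0) W
  obtain ⟨⟨w, hw⟩, hw0⟩ := exists_ne (0 : LieModule.weightSpace W χ)
  refine ⟨w, fun h => hw0 (Subtype.ext h), fun x => ⟨χ x, ?_⟩⟩
  rw [LieModule.mem_weightSpace] at hw
  exact hw x

/-! ### Weights of the even part -/

/-- The projection of `𝔤` onto its even part along the odd part. -/
def projEven : 𝔤 →ₗ[ℂ] 𝔤 := Submodule.projection (G.gr 0) (G.gr 1) G.isCompl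

/-- The projection of `𝔤` onto its odd part along the even part. -/
def projOdd : 𝔤 →ₗ[ℂ] 𝔤 := Submodule.projection (G.gr 1) (G.gr 0) G.isCompl.symm

theorem projEven_of_even {x : 𝔤} (hx : x ∈ G.gr 0) : G.projEven x = x :=
  Submodule.projection_apply_of_mem_left G.isCompl hx

theorem projEven_of_odd {x : 𝔤} (hx : x ∈ G.gr 1) : G.projEven x = 0 :=
  (Submodule.projection_apply_eq_zero_iff G.isCompl).2 hx

theorem projOdd_of_odd {x : 𝔤} (hx : x ∈ G.gr 1) : G.projOdd x = x :=
  Submodule.projection_apply_of_mem_left G.isCompl.symm hx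

theorem projOdd_of_even {x : 𝔤} (hx : x ∈ G.gr 0) : G.projOdd x = 0 :=
  (Submodule.projection_apply_eq_zero_iff G.isCompl.symm).2 hx

variable {G}

theorem exists_dual_apply_eq_one {W : Type*} [AddCommGroup W] [Module ℂ W] {w : W}
    (hw : w ≠ 0) : ∃ ψ : Module.Dual ℂ W, ψ w = 1 := by
  obtain ⟨ψ, hψ⟩ := Module.Projective.exists_dual_ne_zero ℂ hw
  exact ⟨(ψ w)⁻¹ • ψ, by simp [hψ]⟩

/-- The eigenvalue is read off by a functional ψ with ψ(w) = 1. Composing with the even projection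
makes it vanish on 𝔤₁, and commutators act by 0 on an eigenvector, so it lies in L. -/
theorem exists_weight_of_eigenvector {W : Type*} [AddCommGroup W] [Module ℂ W]
    (ρ : 𝔤 →ₗ[ℂ] Module.End ℂ W)
    (hρ : ∀ x ∈ G.gr 0, ∀ y ∈ G.gr 0, ∀ w,
      ρ (G.bracket x y) w = ρ x (ρ y w) - ρ y (ρ x w))
    {w : W} (hw : w ≠ 0) (h : ∀ x ∈ G.gr 0, ∃ c : ℂ, ρ x w = c • w) :
    ∃ μ ∈ G.charSpace, ∀ x ∈ G.gr 0, ρ x w = μ x • w := by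
  obtain ⟨ψ, hψ⟩ : ∃ ψ : Module.Dual ℂ W, ψ w = 1 := exists_dual_apply_eq_one hw
  let μ : Module.Dual ℂ 𝔤 := ψ ∘ₗ LinearMap.applyₗ w ∘ₗ ρ ∘ₗ G.projEven
  have hμ : ∀ x ∈ G.gr 0, ρ x w = μ x • w := by
    intro x hx
    obtain ⟨c, hc⟩ := h x hx
    have : μ x = c := by simp [μ, G.projEven_of_even hx, hc, hψ]
    rw [this, hc]
  refine ⟨μ, ⟨fun x hx => by simp [μ, G.projEven_of_odd hx], fun x hx y hy => ?_⟩, hμ⟩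
  have h1 := hρ x hx y hy w
  rw [hμ _ (G.bracket_mem_of_even hx hy), hμ x hx, hμ y hy, map_smul, map_smul, hμ x hx, hμ y hy,
    smul_smul, smul_smul, mul_comm, sub_self] at h1
  exact (smul_eq_zero.1 h1).resolve_right hw

theorem exists_weight_vector (hG : G.IsSolvable) {W : Type*} [AddCommGroup W] [Module ℂ W]
    [FiniteDimensional ℂ W] [Nontrivial W] (ρ : 𝔤 →ₗ[ℂ] Module.End ℂ W)
    (hρ : ∀ x ∈ G.gr 0, ∀ y ∈ G.gr 0, ∀ w,
      ρ (G.bracket x y) w = ρ x (ρ y w) - ρ y (ρ x w)) :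
    ∃ μ ∈ G.charSpace, ∃ w ≠ 0, ∀ x ∈ G.gr 0, ρ x w = μ x • w := by
  obtain ⟨w, hw, h⟩ := G.exists_eigenvector hG (ρ ∘ₗ (G.gr 0).subtype) (by
    intro x y z hz w
    simp only [LinearMap.comp_apply, Submodule.subtype_apply, hz]
    exact hρ x x.2 y y.2 w)
  obtain ⟨μ, hμ, h'⟩ := exists_weight_of_eigenvector ρ hρ hw fun x hx => h ⟨x, hx⟩
  exact ⟨μ, hμ, w, hw, h'⟩

/-- Lie's theorem applied to B / (A ∩ B). This is how solvability is used in all the constructions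
below. -/
theorem exists_eigenvector_mod [FiniteDimensional ℂ 𝔤] (hG : G.IsSolvable) {A B : Submodule ℂ 𝔤}
    (hA : G.EvenStable A) (hB : G.EvenStable B) (hAB : ¬ B ≤ A) :
    ∃ ξ ∈ B, ξ ∉ A ∧ ∀ x ∈ G.gr 0, ∃ c : ℂ, G.bracket x ξ - c • ξ ∈ A := by
  let C : Submodule ℂ B := A.comap B.subtype
  have hC : ∀ x : G.gr 0, C ≤ C.comap ((G.bracket x).restrict (hB x x.2)) :=
    fun x y hy => hA x x.2 y hy
  let ρ : G.gr 0 →ₗ[ℂ] Module.End ℂ (B ⧸ C) :=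
    { toFun := fun x => C.mapQ C ((G.bracket x).restrict (hB x x.2)) (hC x)
      map_add' := fun x y => Submodule.linearMap_qext _ (LinearMap.ext fun b => by
        simp only [LinearMap.comp_apply, Submodule.mkQ_apply, Submodule.mapQ_apply,
          LinearMap.add_apply, ← Submodule.Quotient.mk_add]
        congr 1
        exact Subtype.ext (by simp))
      map_smul' := fun c x => Submodule.linearMap_qext _ (LinearMap.ext fun b => by
        simp only [LinearMap.comp_apply, Submodule.mkQ_apply, Submodule.mapQ_apply,
          LinearMap.smul_apply, RingHom.id_apply, ← Submodule.Quotient.mk_smul]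
        congr 1
        exact Subtype.ext (by simp)) }
  have hmk : ∀ (x : G.gr 0) (b : B), ρ x (Submodule.Quotient.mk b)
      = Submodule.Quotient.mk ⟨G.bracket x b, hB x x.2 b b.2⟩ := fun _ _ => rfl
  have hnt : Nontrivial (B ⧸ C) := by
    rw [Submodule.Quotient.nontrivial_iff]
    intro h
    exact hAB fun b hb => by
      have : (⟨b, hb⟩ : B) ∈ C := h ▸ Submodule.mem_top
      exact this
  obtain ⟨w, hw, h⟩ := G.exists_eigenvector hG ρ (by
    intro x y z hz w
    obtain ⟨b, rfl⟩ := Submodule.Quotient.mk_surjective _ w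
    rw [hmk, hmk, hmk, hmk, hmk, ← Submodule.Quotient.mk_sub]
    congr 1
    refine Subtype.ext ?_
    simp only [hz, AddSubgroupClass.coe_sub]
    exact G.jacobi_of_even' x.2 y.2 b)
  obtain ⟨b, rfl⟩ := Submodule.Quotient.mk_surjective _ w
  refine ⟨b, b.2, fun hb => hw ((Submodule.Quotient.mk_eq_zero _).2 hb), fun x hx => ?_⟩
  obtain ⟨c, hc⟩ := h ⟨x, hx⟩
  rw [hmk, ← Submodule.Quotient.mk_smul, Submodule.Quotient.eq] at hc
  exact ⟨c, hc⟩

/-! ### Maximal isotropic subspaces of the odd part -/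

variable (G)

/-- The vectors of the odd part that are orthogonal to `P` for the form `f_l`. -/
def orth (l : Module.Dual ℂ 𝔤) (P : Submodule ℂ 𝔤) : Submodule ℂ 𝔤 where
  carrier := {η | η ∈ G.gr 1 ∧ ∀ p ∈ P, l (G.bracket p η) = 0}
  add_mem' ha hb := ⟨add_mem ha.1 hb.1, fun p hp => by simp [ha.2 p hp, hb.2 p hp]⟩
  zero_mem' := ⟨zero_mem _, fun _ _ => by simp⟩
  smul_mem' c _ ha := ⟨Submodule.smul_mem _ c ha.1, fun p hp => by simp [ha.2 p hp]⟩

/-- `P` is a maximal isotropic subspace of the odd part for the form `f_l`. -/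
structure MaxIsotropic (l : Module.Dual ℂ 𝔤) (P : Submodule ℂ 𝔤) : Prop where
  le : P ≤ G.gr 1
  isotropic : ∀ x ∈ P, ∀ y ∈ P, l (G.bracket x y) = 0
  maximal : ∀ ξ ∈ G.orth l P, l (G.bracket ξ ξ) = 0 → ξ ∈ P

variable {G} {l m : Module.Dual ℂ 𝔤} {P : Submodule ℂ 𝔤}

/-- Apply the Jacobi identity to l([x,[a,b]]), which vanishes because [a,b] is even. In other words,
f_l is 𝔤₀-invariant. -/
theorem invariant (hl : l ∈ G.charSpace) {x a b : 𝔤} (hx : x ∈ G.gr 0) (ha : a ∈ G.gr 1)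
    (hb : b ∈ G.gr 1) : l (G.bracket (G.bracket x a) b) = -l (G.bracket a (G.bracket x b)) := by
  have h := hl.2 x hx _ (G.bracket_mem_of_odd ha hb)
  rw [G.jacobi_of_even hx ha b, map_add] at h
  exact eq_neg_of_add_eq_zero_left h

theorem evenStable_orth (hl : l ∈ G.charSpace) (hP1 : P ≤ G.gr 1) (hP : G.EvenStable P) :
    G.EvenStable (G.orth l P) := by
  refine fun x hx η hη => ⟨G.bracket_mem_of_even hx hη.1, fun p hp => ?_⟩
  have h := invariant hl hx (hP1 hp) hη.1
  rw [hη.2 _ (hP x hx p hp)] at h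
  exact neg_eq_zero.1 h.symm

theorem MaxIsotropic.le_orth (hm : G.MaxIsotropic l P) : P ≤ G.orth l P :=
  fun _ hx => ⟨hm.le hx, fun p hp => hm.isotropic p hp _ hx⟩

/-- A nonisotropic pair of orthogonal vectors spans an isotropic line. -/
theorem exists_isotropic_comb {a b : 𝔤} (ha : a ∈ G.gr 1) (hb : b ∈ G.gr 1)
    (haa : l (G.bracket a a) ≠ 0) (hab : l (G.bracket a b) = 0) :
    ∃ s : ℂ, l (G.bracket (b + s • a) (b + s • a)) = 0 ∧
      l (G.bracket a (b + s • a)) = s * l (G.bracket a a) ∧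
      (s = 0 → l (G.bracket b b) = 0) := by
  -- By orthogonality the value of the form at b + s a is l([b,b]) + s² l([a,a]), so s is a square
  -- root of −l([b,b]) / l([a,a]).
  obtain ⟨s, hs⟩ := IsAlgClosed.exists_pow_nat_eq (-l (G.bracket b b) / l (G.bracket a a))
    (n := 2) two_pos
  have hs' : s ^ 2 * l (G.bracket a a) = -l (G.bracket b b) := by rw [hs]; field_simp
  refine ⟨s, ?_, by simp [hab], fun h => ?_⟩
  · simp only [map_add, map_smul, LinearMap.add_apply, LinearMap.smul_apply, smul_eq_mul,
      G.bracket_comm_of_odd hb ha, hab]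
    linear_combination hs'
  · rw [h] at hs'
    linear_combination hs'

/-- An isotropic subspace that is stable under the even part and is not maximal isotropic can be
enlarged by a vector that is an eigenvector of the even part modulo the subspace. -/
theorem exists_isotropic_extension [FiniteDimensional ℂ 𝔤] (hG : G.IsSolvable)
    (hl : l ∈ G.charSpace) (hP1 : P ≤ G.gr 1) (hP : G.EvenStable P)
    (hiso : ∀ x ∈ P, ∀ y ∈ P, l (G.bracket x y) = 0) (hnot : ¬ G.MaxIsotropic l P) :
    ∃ ζ ∈ G.orth l P, ζ ∉ P ∧ l (G.bracket ζ ζ) = 0 ∧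
      ∀ x ∈ G.gr 0, ∃ c : ℂ, G.bracket x ζ - c • ζ ∈ P := by
  obtain ⟨τ, hτ, hττ, hτP⟩ : ∃ τ ∈ G.orth l P, l (G.bracket τ τ) = 0 ∧ τ ∉ P := by
    by_contra! h
    exact hnot ⟨hP1, hiso, fun ξ hξ h0 => h ξ hξ h0⟩
  have hPo : P ≤ G.orth l P := fun _ hx => ⟨hP1 hx, fun p hp => hiso p hp _ hx⟩
  have hO := evenStable_orth hl hP1 hP
  obtain ⟨ξ, hξ, hξP, hξe⟩ := exists_eigenvector_mod hG hP hO fun h => hτP (h hτ)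
  by_cases h0 : l (G.bracket ξ ξ) = 0
  · exact ⟨ξ, hξ, hξP, h0, hξe⟩
  -- Invariance gives f([x,ξ],ξ) = 0, while [x,ξ] is c ξ modulo P; as f(ξ,ξ) ≠ 0, the weight c must
  -- be 0.
  have hweight : ∀ ξ ∈ G.orth l P, l (G.bracket ξ ξ) ≠ 0 →
      (∀ x ∈ G.gr 0, ∃ c : ℂ, G.bracket x ξ - c • ξ ∈ P) →
      ∀ x ∈ G.gr 0, G.bracket x ξ ∈ P := by
    intro ξ hξ h0 hξe x hx
    obtain ⟨c, hc⟩ := hξe x hx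
    have h1 := invariant hl hx hξ.1 hξ.1
    rw [G.bracket_comm_of_odd hξ.1 (G.bracket_mem_of_even hx hξ.1)] at h1
    have h2 : l (G.bracket (G.bracket x ξ) ξ) = 0 := by linear_combination h1 / 2
    have h3 := hξ.2 _ hc
    rw [map_sub, map_smul, LinearMap.sub_apply, LinearMap.smul_apply, map_sub, h2, map_smul,
      smul_eq_mul, zero_sub, neg_eq_zero] at h3
    have hc0 := (mul_eq_zero.1 h3).resolve_right h0
    simpa [hc0] using hc
  have hξ0 := hweight ξ hξ h0 hξe
  have hξ0' : ∀ x ∈ G.gr 0, ∀ η ∈ G.orth l P, l (G.bracket (G.bracket x ξ) η) = 0 :=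
    fun x hx η hη => hη.2 _ (hξ0 x hx)
  -- Since ξ is nonisotropic, the search continues in its orthogonal complement inside P^⊥, which is
  -- stable because [x,ξ] ∈ P.
  have hO' : G.EvenStable (G.orth l P ⊓ G.orth l (ℂ ∙ ξ)) := by
    refine fun x hx η hη => ⟨hO x hx η hη.1, G.bracket_mem_of_even hx hη.1.1, fun p hp => ?_⟩
    obtain ⟨c, rfl⟩ := Submodule.mem_span_singleton.1 hp
    have h1 := invariant hl hx hξ.1 hη.1.1
    rw [hξ0' x hx η hη.1] at h1
    simp [neg_eq_zero.1 h1.symm]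
  have hnle : ¬ G.orth l P ⊓ G.orth l (ℂ ∙ ξ) ≤ P := by
    intro hle
    -- Subtract from τ its projection along ξ. If the difference lay in P, pairing it with the
    -- isotropic τ would force c = 0, hence τ ∈ P.
    let c := l (G.bracket ξ τ) / l (G.bracket ξ ξ)
    have hmem : τ - c • ξ ∈ P := by
      refine hle ⟨sub_mem hτ (Submodule.smul_mem _ _ hξ),
        sub_mem hτ.1 (Submodule.smul_mem _ _ hξ.1), fun p hp => ?_⟩
      obtain ⟨d, rfl⟩ := Submodule.mem_span_singleton.1 hp
      simp [c, h0]
    have h1 := hτ.2 _ hmem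
    simp only [map_sub, map_smul, LinearMap.sub_apply, LinearMap.smul_apply, hττ, smul_eq_mul,
      zero_sub, neg_eq_zero] at h1
    rcases mul_eq_zero.1 h1 with h2 | h2
    · exact hτP (by simpa [h2] using hmem)
    · exact hτP (by simpa [c, h2] using hmem)
  obtain ⟨ξ', hξ', hξ'P, hξ'e⟩ := exists_eigenvector_mod hG hP hO' hnle
  by_cases h0' : l (G.bracket ξ' ξ') = 0
  · exact ⟨ξ', hξ'.1, hξ'P, h0', hξ'e⟩
  have hξ'0 := hweight ξ' hξ'.1 h0' hξ'e
  have hξξ' : l (G.bracket ξ ξ') = 0 := hξ'.2.2 ξ (Submodule.mem_span_singleton_self ξ)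
  -- Both vectors have weight 0 modulo P, so every combination of them is again an eigenvector; an
  -- isotropic one is chosen.
  obtain ⟨s, hs1, hs2, hs3⟩ := exists_isotropic_comb hξ.1 hξ'.1.1 h0 hξξ'
  have hmem : ξ' + s • ξ ∈ G.orth l P := add_mem hξ'.1 (Submodule.smul_mem _ _ hξ)
  refine ⟨ξ' + s • ξ, hmem, fun hP' => ?_, hs1, fun x hx => ⟨0, ?_⟩⟩
  · have h1 := hξ.2 _ hP'
    rw [G.bracket_comm_of_odd hmem.1 hξ.1, hs2] at h1
    exact h0' (hs3 ((mul_eq_zero.1 h1).resolve_right h0))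
  · simpa using add_mem (hξ'0 x hx) (Submodule.smul_mem _ s (hξ0 x hx))

/-- A largest stable isotropic subspace is maximal among all isotropic subspaces, since otherwise it
would have a stable isotropic extension. -/
theorem exists_maxIsotropic [FiniteDimensional ℂ 𝔤] (hG : G.IsSolvable) (hl : l ∈ G.charSpace) :
    ∃ P, G.EvenStable P ∧ G.MaxIsotropic l P := by
  let S : Set (Submodule ℂ 𝔤) := {P | P ≤ G.gr 1 ∧ G.EvenStable P ∧
    ∀ x ∈ P, ∀ y ∈ P, l (G.bracket x y) = 0}
  have hS : S.Nonempty := ⟨⊥, bot_le, G.evenStable_bot, fun x hx y _ => by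
    simp [(Submodule.mem_bot ℂ).1 hx]⟩
  obtain ⟨P, hP, hmax⟩ := WellFounded.has_min (wellFounded_gt (α := Submodule ℂ 𝔤)) S hS
  refine ⟨P, hP.2.1, ?_⟩
  by_contra hnot
  obtain ⟨ζ, hζ, hζP, hζζ, hζe⟩ := exists_isotropic_extension hG hl hP.1 hP.2.1 hP.2.2 hnot
  refine hmax (P ⊔ ℂ ∙ ζ) ⟨?_, ?_, ?_⟩ ?_
  · exact sup_le hP.1 ((Submodule.span_singleton_le_iff_mem _ _).2 hζ.1)
  · refine hP.2.1.sup_span fun x hx => ?_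
    obtain ⟨c, hc⟩ := hζe x hx
    exact Submodule.mem_sup.2 ⟨_, hc, c • ζ,
      Submodule.smul_mem _ _ (Submodule.mem_span_singleton_self ζ), by simp⟩
  · intro x hx y hy
    obtain ⟨a, ha, b, hb, rfl⟩ := Submodule.mem_sup.1 hx
    obtain ⟨c, hc, d, hd, rfl⟩ := Submodule.mem_sup.1 hy
    obtain ⟨r, rfl⟩ := Submodule.mem_span_singleton.1 hb
    obtain ⟨s, rfl⟩ := Submodule.mem_span_singleton.1 hd
    simp [hP.2.2 a ha c hc, hζ.2 a ha, hζζ, G.bracket_comm_of_odd hζ.1 (hP.1 hc), hζ.2 c hc]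
  · refine lt_of_le_of_ne le_sup_left fun h => hζP ?_
    rw [h]
    exact Submodule.mem_sup_right (Submodule.mem_span_singleton_self ζ)

/-! ### Perturbation of the functional -/

variable (G) in
/-- The fourth power of `ad x` maps the odd part into `A`. -/
def NilMod (x : 𝔤) (A : Submodule ℂ 𝔤) : Prop :=
  ∀ η ∈ G.gr 1, G.bracket x (G.bracket x (G.bracket x (G.bracket x η))) ∈ A

theorem NilMod.mono {x : 𝔤} {A B : Submodule ℂ 𝔤} (h : G.NilMod x A) (hAB : A ≤ B) :
    G.NilMod x B := fun η hη => hAB (h η hη)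

/-- `G.orth l (G.gr 1)` is the radical of f_l; its vectors can be added to any isotropic subspace.
-/
theorem MaxIsotropic.orth_le (hm : G.MaxIsotropic l P) : G.orth l (G.gr 1) ≤ P :=
  fun ξ hξ => hm.maximal ξ ⟨hξ.1, fun p hp => hξ.2 p (hm.le hp)⟩ (hξ.2 ξ hξ.1)

/-- By invariance, f(p, x⁴η) = f(x²p, x²η), and both arguments on the right lie in the isotropic P.
This is where the exponent 4 comes from. -/
theorem nilMod_of_sq (hl : l ∈ G.charSpace) (hm : G.MaxIsotropic l P) {x : 𝔤} (hx : x ∈ G.gr 0)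
    (h : ∀ η ∈ G.gr 1, G.bracket x (G.bracket x η) ∈ P) : G.NilMod x (G.orth l (G.gr 1)) := by
  have hx1 : ∀ {η}, η ∈ G.gr 1 → G.bracket x η ∈ G.gr 1 := G.bracket_mem_of_even hx
  refine fun η hη => ⟨hx1 (hx1 (hx1 (hx1 hη))), fun p hp => ?_⟩
  have h1 := h η hη
  have e1 := invariant hl hx hp (hx1 (hm.le h1))
  have e2 := invariant hl hx (hx1 hp) (hm.le h1)
  rw [hm.isotropic _ (h p hp) _ h1] at e2
  rw [neg_eq_zero.1 e2.symm] at e1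
  exact neg_eq_zero.1 e1.symm

/-- Already ad [a,b] maps 𝔤₁ into P: by Jacobi, [[a,b],η] is a sum of brackets of elements of P with
even elements. -/
theorem nilMod_bracket (hl : l ∈ G.charSpace) (hP : G.EvenStable P) (hm : G.MaxIsotropic l P)
    {a b : 𝔤} (ha : a ∈ P) (hb : b ∈ P) :
    G.NilMod (G.bracket a b) (G.orth l (G.gr 1)) := by
  have ha1 := hm.le ha
  have hb1 := hm.le hb
  have hx := G.bracket_mem_of_odd ha1 hb1
  have hstep : ∀ {c d}, c ∈ P → d ∈ G.gr 0 → G.bracket c d ∈ P := by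
    intro c d hc hd
    rw [G.bracket_skew_of_odd_even (hm.le hc) hd]
    exact neg_mem (hP d hd c hc)
  refine nilMod_of_sq hl hm hx fun η hη => hP _ hx _ ?_
  rw [G.jacobi_of_odd' ha1 hb1]
  exact add_mem (hstep ha (G.bracket_mem_of_odd hb1 hη)) (hstep hb (G.bracket_mem_of_odd ha1 hη))

/-- With x = [ξ,b], ad x maps 𝔤₁ into P ⊕ ℂξ as before, and it maps ξ into P because [x,ξ] =
½[b,[ξ,ξ]] and [ξ,[ξ,ξ]] = 0. Hence (ad x)² maps 𝔤₁ into P. -/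
theorem nilMod_bracket_eigenvector (hl : l ∈ G.charSpace) (hP : G.EvenStable P)
    (hm : G.MaxIsotropic l P) {ξ b : 𝔤} (hξ : ξ ∈ G.gr 1)
    (hξe : ∀ x ∈ G.gr 0, ∃ c : ℂ, G.bracket x ξ - c • ξ ∈ P) (hb : b ∈ P ⊔ ℂ ∙ ξ) :
    G.NilMod (G.bracket ξ b) (G.orth l (G.gr 1)) := by
  have hQ1 : P ⊔ ℂ ∙ ξ ≤ G.gr 1 :=
    sup_le hm.le ((Submodule.span_singleton_le_iff_mem _ _).2 hξ)
  have hξQ : ξ ∈ P ⊔ ℂ ∙ ξ := Submodule.mem_sup_right (Submodule.mem_span_singleton_self ξ)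
  have hQ : G.EvenStable (P ⊔ ℂ ∙ ξ) := by
    refine hP.sup_span fun x hx => ?_
    obtain ⟨c, hc⟩ := hξe x hx
    exact Submodule.mem_sup.2 ⟨_, hc, c • ξ,
      Submodule.smul_mem _ _ (Submodule.mem_span_singleton_self ξ), by simp⟩
  have hb1 := hQ1 hb
  have hx := G.bracket_mem_of_odd hξ hb1
  have hstep : ∀ {c d}, c ∈ P ⊔ ℂ ∙ ξ → d ∈ G.gr 0 → G.bracket c d ∈ P ⊔ ℂ ∙ ξ := by
    intro c d hc hd
    rw [G.bracket_skew_of_odd_even (hQ1 hc) hd]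
    exact neg_mem (hQ d hd c hc)
  have hξξ : G.bracket ξ (G.bracket ξ ξ) = 0 := by
    have h := G.jacobi_of_odd' hξ hξ ξ
    rw [G.bracket_skew_of_even (G.bracket_mem_of_odd hξ hξ) hξ] at h
    have h3 : (3 : ℂ) • G.bracket ξ (G.bracket ξ ξ) = 0 := by
      linear_combination (norm := module) (-1 : ℂ) • h
    exact (smul_eq_zero.1 h3).resolve_left (by norm_num)
  have hxξ : G.bracket (G.bracket ξ b) ξ ∈ P := by
    have h := G.jacobi_of_odd' hξ hb1 ξ
    rw [G.bracket_comm_of_odd hb1 hξ,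
      G.bracket_skew_of_odd_even hξ (G.bracket_mem_of_odd hξ hb1)] at h
    have h2 : G.bracket (G.bracket ξ b) ξ = (1 / 2 : ℂ) • G.bracket b (G.bracket ξ ξ) := by
      linear_combination (norm := module) (1 / 2 : ℂ) • h
    rw [h2]
    refine Submodule.smul_mem _ _ ?_
    obtain ⟨p, hp, q, hq, rfl⟩ := Submodule.mem_sup.1 hb
    obtain ⟨s, rfl⟩ := Submodule.mem_span_singleton.1 hq
    rw [map_add, map_smul, LinearMap.add_apply, LinearMap.smul_apply, hξξ, smul_zero, add_zero,
      G.bracket_skew_of_odd_even (hm.le hp) (G.bracket_mem_of_odd hξ hξ)]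
    exact neg_mem (hP _ (G.bracket_mem_of_odd hξ hξ) p hp)
  refine nilMod_of_sq hl hm hx fun η hη => ?_
  have h1 : G.bracket (G.bracket ξ b) η ∈ P ⊔ ℂ ∙ ξ := by
    rw [G.jacobi_of_odd' hξ hb1]
    exact add_mem (hstep hξQ (G.bracket_mem_of_odd hb1 hη))
      (hstep hb (G.bracket_mem_of_odd hξ hη))
  obtain ⟨p, hp, q, hq, hpq⟩ := Submodule.mem_sup.1 h1
  obtain ⟨s, rfl⟩ := Submodule.mem_span_singleton.1 hq
  rw [← hpq, map_add, map_smul]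
  exact add_mem (hP _ hx p hp) (Submodule.smul_mem _ _ hxξ)

/-- A subspace that is maximal isotropic for `f_l` is so for `f_m` if `l` and `m` agree on the
elements that act nilpotently on the odd part modulo the radical of `f_l`. -/
theorem MaxIsotropic.perturb [FiniteDimensional ℂ 𝔤] (hG : G.IsSolvable) (hl : l ∈ G.charSpace)
    (hm : m ∈ G.charSpace) (hP : G.EvenStable P) (h : G.MaxIsotropic l P)
    (hlm : ∀ x ∈ G.gr 0, G.NilMod x (G.orth l (G.gr 1)) → m x = l x) : G.MaxIsotropic m P := by
  by_contra hnot
  -- A counterexample to maximality for m can be taken to be an eigenvector ζ modulo P. Then [ζ,p]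
  -- and [ζ,ζ] are nil, so l takes the same values on them as m and ζ contradicts maximality for l.
  obtain ⟨ζ, hζ, hζP, hζζ, hζe⟩ := exists_isotropic_extension hG hm h.le hP (fun x hx y hy => by
    rw [hlm _ (G.bracket_mem_of_odd (h.le hx) (h.le hy)) (nilMod_bracket hl hP h hx hy)]
    exact h.isotropic x hx y hy) hnot
  refine hζP (h.maximal ζ ⟨hζ.1, fun p hp => ?_⟩ ?_)
  · rw [G.bracket_comm_of_odd (h.le hp) hζ.1, ← hlm _ (G.bracket_mem_of_odd hζ.1 (h.le hp))
      (nilMod_bracket_eigenvector hl hP h hζ.1 hζe (Submodule.mem_sup_left hp)),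
      G.bracket_comm_of_odd hζ.1 (h.le hp)]
    exact hζ.2 p hp
  · rw [← hlm _ (G.bracket_mem_of_odd hζ.1 hζ.1) (nilMod_bracket_eigenvector hl hP h hζ.1 hζe
      (Submodule.mem_sup_right (Submodule.mem_span_singleton_self ζ)))]
    exact hζζ

/-- If P^⊥ is not contained in P for one of the forms, it contains an eigenvector outside P. Its
brackets with P are nil, so it is orthogonal to P for the other form too. This carries the parity of
rk f_l over to l + θ. -/
theorem MaxIsotropic.perturb_orth_le [FiniteDimensional ℂ 𝔤] (hG : G.IsSolvable)
    (hl : l ∈ G.charSpace) (hm : m ∈ G.charSpace) (hP : G.EvenStable P) (h : G.MaxIsotropic l P)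
    (hlm : ∀ x ∈ G.gr 0, G.NilMod x (G.orth l (G.gr 1)) → m x = l x) :
    G.orth m P ≤ P ↔ G.orth l P ≤ P := by
  have key : ∀ ξ ∈ G.gr 1, (∀ x ∈ G.gr 0, ∃ c : ℂ, G.bracket x ξ - c • ξ ∈ P) →
      ∀ p ∈ P, m (G.bracket p ξ) = l (G.bracket p ξ) := by
    intro ξ hξ hξe p hp
    rw [G.bracket_comm_of_odd (h.le hp) hξ]
    exact hlm _ (G.bracket_mem_of_odd hξ (h.le hp))
      (nilMod_bracket_eigenvector hl hP h hξ hξe (Submodule.mem_sup_left hp))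
  constructor
  · intro h1
    by_contra hnot
    obtain ⟨ξ, hξ, hξP, hξe⟩ := exists_eigenvector_mod hG hP (evenStable_orth hl h.le hP) hnot
    exact hξP (h1 ⟨hξ.1, fun p hp => by rw [key ξ hξ.1 hξe p hp]; exact hξ.2 p hp⟩)
  · intro h1
    by_contra hnot
    obtain ⟨ξ, hξ, hξP, hξe⟩ := exists_eigenvector_mod hG hP (evenStable_orth hm h.le hP) hnot
    exact hξP (h1 ⟨hξ.1, fun p hp => by rw [← key ξ hξ.1 hξe p hp]; exact hξ.2 p hp⟩)

/-- The orthogonal complement of a maximal isotropic subspace exceeds it by at most a line. -/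
theorem MaxIsotropic.exists_orth_le [FiniteDimensional ℂ 𝔤] (hG : G.IsSolvable)
    (hl : l ∈ G.charSpace) (hP : G.EvenStable P) (h : G.MaxIsotropic l P)
    (hnot : ¬ G.orth l P ≤ P) :
    ∃ ω ∈ G.orth l P, ω ∉ P ∧ l (G.bracket ω ω) ≠ 0 ∧ G.orth l P ≤ P ⊔ ℂ ∙ ω ∧
      ∀ x ∈ G.gr 0, G.bracket x ω ∈ P := by
  obtain ⟨ξ, hξ, hξP, hξe⟩ := exists_eigenvector_mod hG hP (evenStable_orth hl h.le hP) hnot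
  have h0 : l (G.bracket ξ ξ) ≠ 0 := fun h0 => hξP (h.maximal ξ hξ h0)
  refine ⟨ξ, hξ, hξP, h0, fun η hη => ?_, fun x hx => ?_⟩
  -- After projecting η off ξ, an isotropic combination η − cξ + sξ lies in P by maximality. It is
  -- then orthogonal to ξ, so s = 0, and η − cξ itself is isotropic and lies in P.
  · let c := l (G.bracket ξ η) / l (G.bracket ξ ξ)
    have hη' : η - c • ξ ∈ G.orth l P := sub_mem hη (Submodule.smul_mem _ _ hξ)
    have hc : l (G.bracket ξ (η - c • ξ)) = 0 := by simp [c, h0]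
    obtain ⟨s, hs1, hs2, hs3⟩ := exists_isotropic_comb hξ.1 hη'.1 h0 hc
    have hmem := h.maximal _ (add_mem hη' (Submodule.smul_mem _ s hξ)) hs1
    have h1 := hξ.2 _ hmem
    rw [G.bracket_comm_of_odd (h.le hmem) hξ.1, hs2] at h1
    have h2 := h.maximal _ hη' (hs3 ((mul_eq_zero.1 h1).resolve_right h0))
    exact Submodule.mem_sup.2 ⟨_, h2, c • ξ,
      Submodule.smul_mem _ _ (Submodule.mem_span_singleton_self ξ), by simp⟩
  · obtain ⟨c, hc⟩ := hξe x hx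
    have h1 := invariant hl hx hξ.1 hξ.1
    rw [G.bracket_comm_of_odd hξ.1 (G.bracket_mem_of_even hx hξ.1)] at h1
    have h2 : l (G.bracket (G.bracket x ξ) ξ) = 0 := by linear_combination h1 / 2
    have h3 := hξ.2 _ hc
    rw [map_sub, map_smul, LinearMap.sub_apply, LinearMap.smul_apply, map_sub, h2, map_smul,
      smul_eq_mul, zero_sub, neg_eq_zero] at h3
    simpa [(mul_eq_zero.1 h3).resolve_right h0] using hc

/-- Vectors outside a subspace `Q ⊇ P^⊥` are separated from `Q` by a vector of `P`. -/
theorem exists_mem_orth_separating [FiniteDimensional ℂ 𝔤]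
    {Q : Submodule ℂ 𝔤} (hQ1 : Q ≤ G.gr 1) (hQ : G.orth l P ≤ Q) {ξ : 𝔤} (hξ : ξ ∈ G.gr 1)
    (hξQ : ξ ∉ Q) :
    ∃ ζ ∈ P, (∀ η ∈ Q, l (G.bracket ζ η) = 0) ∧ l (G.bracket ζ ξ) ≠ 0 := by
  by_contra! hcon
  -- Φ sends η to the functional f(·,η) on P. If every p ∈ P orthogonal to Q is orthogonal to ξ, the
  -- double annihilator puts Φ(ξ) in Φ(Q), so ξ differs from an element of Q by one of P^⊥ ⊂ Q.
  let Φ : 𝔤 →ₗ[ℂ] Module.Dual ℂ P := LinearMap.mk₂ ℂ (fun η (p : P) => l (G.bracket p η))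
    (by intros; simp) (by intros; simp) (by intros; simp) (by intros; simp)
  have hΦ : ∀ η p, Φ η p = l (G.bracket p η) := fun η p => by simp [Φ]
  have hmem : Φ ξ ∈ Q.map Φ := by
    rw [← Subspace.dualCoannihilator_dualAnnihilator_eq (W := Q.map Φ),
      Submodule.mem_dualAnnihilator]
    intro p hp
    rw [Submodule.mem_dualCoannihilator] at hp
    rw [hΦ]
    exact hcon p p.2 fun η hη => by
      rw [← hΦ]
      exact hp _ (Submodule.mem_map_of_mem hη)
  obtain ⟨η, hη, he⟩ := hmem
  have : ξ - η ∈ G.orth l P := by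
    refine ⟨sub_mem hξ (hQ1 hη), fun p hp => ?_⟩
    have := LinearMap.congr_fun he ⟨p, hp⟩
    rw [hΦ, hΦ] at this
    simp only [map_sub]
    rw [this, sub_self]
  exact hξQ (by simpa using add_mem (hQ this) hη)

end LieSuperalgebra

/-! ### Traces -/

theorem trace_prod_eq {W W' : Type*} [AddCommGroup W] [Module ℂ W] [FiniteDimensional ℂ W]
    [AddCommGroup W'] [Module ℂ W'] [FiniteDimensional ℂ W'] (f : Module.End ℂ (W × W')) :
    LinearMap.trace ℂ _ f
      = LinearMap.trace ℂ _ (LinearMap.fst ℂ W W' ∘ₗ f ∘ₗ LinearMap.inl ℂ W W')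
        + LinearMap.trace ℂ _ (LinearMap.snd ℂ W W' ∘ₗ f ∘ₗ LinearMap.inr ℂ W W') := by
  have h : f = (f ∘ₗ LinearMap.inl ℂ W W') ∘ₗ LinearMap.fst ℂ W W'
      + (f ∘ₗ LinearMap.inr ℂ W W') ∘ₗ LinearMap.snd ℂ W W' := by
    refine LinearMap.ext fun w => ?_
    simp [← map_add]
  conv_lhs => rw [h]
  rw [map_add, LinearMap.trace_comp_comm', LinearMap.trace_comp_comm' _ (LinearMap.snd ℂ W W')]

/-- B / A is a line on which D acts by α. A section s of V/A → V/B splits the identity of V/A into s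
∘ π plus a rank-one part along ξ, and cyclicity of the trace evaluates the two summands. -/
theorem trace_mapQ_eq_add {V : Type*} [AddCommGroup V] [Module ℂ V] [FiniteDimensional ℂ V]
    (D : Module.End ℂ V) {A B : Submodule ℂ V} (hA : A ≤ A.comap D) (hB : B ≤ B.comap D)
    (hAB : A ≤ B) {ξ : V} (hξB : ξ ∈ B) (c : Module.Dual ℂ V) (hcA : ∀ a ∈ A, c a = 0)
    (hcξ : c ξ = 1) (hBA : ∀ b ∈ B, b - c b • ξ ∈ A) {α : ℂ} (hξ : D ξ - α • ξ ∈ A) :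
    LinearMap.trace ℂ _ (A.mapQ A D hA) = LinearMap.trace ℂ _ (B.mapQ B D hB) + α := by
  let π : V ⧸ A →ₗ[ℂ] V ⧸ B := Submodule.factor hAB
  have hπ : ∀ z, π (A.mkQ z) = B.mkQ z := fun z => rfl
  obtain ⟨s, hs⟩ := π.exists_rightInverse_of_surjective
    (LinearMap.range_eq_top.2 (Submodule.factor_surjective hAB))
  let c' : V ⧸ A →ₗ[ℂ] ℂ := A.liftQ c fun a ha => hcA a ha
  have hc' : ∀ z, c' (A.mkQ z) = c z := fun z => rfl
  let r : V ⧸ A →ₗ[ℂ] ℂ := c' ∘ₗ (LinearMap.id - s ∘ₗ π)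
  let i : ℂ →ₗ[ℂ] V ⧸ A := LinearMap.toSpanSingleton ℂ _ (A.mkQ ξ)
  have hdec : ∀ z, z = s (π z) + r z • A.mkQ ξ := by
    intro z
    obtain ⟨b, hb⟩ := Submodule.mkQ_surjective A (z - s (π z))
    have h1 : π (z - s (π z)) = 0 := by
      rw [map_sub, ← LinearMap.comp_apply π s, hs]
      simp
    have hbB : b ∈ B := by
      rw [← hb, hπ] at h1
      exact (Submodule.Quotient.mk_eq_zero _).1 h1
    have h2 : A.mkQ b = c b • A.mkQ ξ := by
      rw [← map_smul, ← sub_eq_zero, ← map_sub]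
      exact (Submodule.Quotient.mk_eq_zero _).2 (hBA b hbB)
    have h3 : r z = c b := by
      change c' (z - s (π z)) = c b
      rw [← hb, hc']
    rw [h3, ← h2, hb]
    abel
  set f := A.mapQ A D hA with hf
  set g := B.mapQ B D hB with hg
  have hfg : π ∘ₗ f = g ∘ₗ π := Submodule.linearMap_qext _ (LinearMap.ext fun z => rfl)
  have hfd : f = (f ∘ₗ s) ∘ₗ π + (f ∘ₗ i) ∘ₗ r := by
    refine LinearMap.ext fun z => ?_
    conv_lhs => rw [hdec z]
    simp [i]
  have hfξ : f (A.mkQ ξ) = α • A.mkQ ξ := by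
    rw [← map_smul, ← sub_eq_zero]
    have : f (A.mkQ ξ) = A.mkQ (D ξ) := rfl
    rw [this, ← map_sub]
    exact (Submodule.Quotient.mk_eq_zero _).2 hξ
  have hrξ : r (A.mkQ ξ) = 1 := by
    have h0 : π (A.mkQ ξ) = 0 := (Submodule.Quotient.mk_eq_zero _).2 hξB
    change c' (A.mkQ ξ - s (π (A.mkQ ξ))) = 1
    rw [h0, map_zero, sub_zero, hc', hcξ]
  have hrfi : r ∘ₗ f ∘ₗ i = α • LinearMap.id := by
    ext
    simp only [LinearMap.comp_apply, i, LinearMap.toSpanSingleton_apply, one_smul, hfξ, map_smul,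
      hrξ, LinearMap.smul_apply, LinearMap.id_apply]
  conv_lhs => rw [hfd]
  rw [map_add, LinearMap.trace_comp_comm', LinearMap.trace_comp_comm' r, ← LinearMap.comp_assoc,
    hfg, LinearMap.comp_assoc, hs, LinearMap.comp_id, hrfi]
  simp

namespace LieSuperalgebra

universe u

variable {𝔤 : Type u} [AddCommGroup 𝔤] [Module ℂ 𝔤] (G : LieSuperalgebra 𝔤)

/-- The linear map `ρ` restricts to a representation of `G₀ ⊕ Q`, where `Q` is a subspace of the
odd part. -/
structure IsRepOn (Q : Submodule ℂ 𝔤) {W : Type*} [AddCommGroup W] [Module ℂ W]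
    (ρ : 𝔤 →ₗ[ℂ] Module.End ℂ W) : Prop where
  even_even : ∀ x ∈ G.gr 0, ∀ y ∈ G.gr 0, ∀ w,
    ρ (G.bracket x y) w = ρ x (ρ y w) - ρ y (ρ x w)
  even_odd : ∀ x ∈ G.gr 0, ∀ y ∈ Q, ∀ w, ρ (G.bracket x y) w = ρ x (ρ y w) - ρ y (ρ x w)
  odd_odd : ∀ x ∈ Q, ∀ y ∈ Q, ∀ w, ρ (G.bracket x y) w = ρ x (ρ y w) + ρ y (ρ x w)

variable {G}

theorem IsRepOn.mono {Q Q' : Submodule ℂ 𝔤} {W : Type*} [AddCommGroup W] [Module ℂ W]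
    {ρ : 𝔤 →ₗ[ℂ] Module.End ℂ W} (h : G.IsRepOn Q' ρ) (hQ : Q ≤ Q') : G.IsRepOn Q ρ :=
  ⟨h.even_even, fun x hx y hy => h.even_odd x hx y (hQ hy),
    fun x hx y hy => h.odd_odd x (hQ hx) y (hQ hy)⟩

variable (G) in
/-- A vector `v` on which `G₀ ⊕ P` acts by the character `χ`. -/
structure IsWeightVector (χ : Module.Dual ℂ 𝔤) (P : Submodule ℂ 𝔤) {W : Type*} [AddCommGroup W]
    [Module ℂ W] (ρ : 𝔤 →ₗ[ℂ] Module.End ℂ W) (v : W) : Prop where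
  even : ∀ x ∈ G.gr 0, ρ x v = χ x • v
  odd : ∀ y ∈ P, ρ y v = 0

/-! ### Extension of a representation by one odd element -/

section Step

variable (G) in
/-- The data for passing from `G₀ ⊕ Q` to `G₀ ⊕ Q ⊕ ℂ ξ`: the functional `c` is the coordinate
along `ξ`. -/
structure IsStep (Q : Submodule ℂ 𝔤) (ξ : 𝔤) (c : Module.Dual ℂ 𝔤) : Prop where
  le : Q ≤ G.gr 1
  stable : G.EvenStable Q
  mem : ξ ∈ G.gr 1
  even : ∀ x ∈ G.gr 0, c x = 0
  odd : ∀ y ∈ Q, c y = 0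
  self : c ξ = 1
  bracket : ∀ x ∈ G.gr 0, G.bracket x ξ - c (G.bracket x ξ) • ξ ∈ Q

/-- ξ is nonzero modulo 𝔤₀ ⊕ Q, so a functional on that quotient serves as the coordinate; it then
computes the eigenvalues a. -/
theorem exists_isStep {Q : Submodule ℂ 𝔤} (hQ1 : Q ≤ G.gr 1) (hQ : G.EvenStable Q) {ξ : 𝔤}
    (hξ : ξ ∈ G.gr 1) (hξQ : ξ ∉ Q)
    (h : ∀ x ∈ G.gr 0, ∃ a : ℂ, G.bracket x ξ - a • ξ ∈ Q) : ∃ c, G.IsStep Q ξ c := by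
  have hne : (G.gr 0 ⊔ Q).mkQ ξ ≠ 0 := by
    intro h0
    obtain ⟨a, ha, b, hb, hab⟩ := Submodule.mem_sup.1 ((Submodule.Quotient.mk_eq_zero _).1 h0)
    have h1 : a = ξ - b := by rw [← hab]; abel
    have h2 : a = 0 := Submodule.disjoint_def.1 G.isCompl.disjoint a ha
      (h1 ▸ sub_mem hξ (hQ1 hb))
    rw [h2, zero_add] at hab
    exact hξQ (hab ▸ hb)
  obtain ⟨ψ, hψ⟩ := exists_dual_apply_eq_one hne
  have hker : ∀ z ∈ G.gr 0 ⊔ Q, (ψ ∘ₗ (G.gr 0 ⊔ Q).mkQ) z = 0 := by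
    intro z hz
    rw [LinearMap.comp_apply, Submodule.mkQ_apply, (Submodule.Quotient.mk_eq_zero _).2 hz, map_zero]
  refine ⟨ψ ∘ₗ (G.gr 0 ⊔ Q).mkQ, hQ1, hQ, hξ, fun x hx => hker x (Submodule.mem_sup_left hx),
    fun y hy => hker y (Submodule.mem_sup_right hy), hψ, fun x hx => ?_⟩
  obtain ⟨a, ha⟩ := h x hx
  have h1 := hker _ (Submodule.mem_sup_right ha)
  rw [map_sub, map_smul, LinearMap.comp_apply _ _ ξ, hψ, smul_eq_mul, mul_one, sub_eq_zero] at h1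
  rwa [h1]

variable {W : Type*} [AddCommGroup W] [Module ℂ W]

variable (G) in
/-- The action on `W ⊕ ξ W` that is induced by the action `ρ` on `W`. -/
def stepRep (ξ : 𝔤) (c : Module.Dual ℂ 𝔤) (ρ : 𝔤 →ₗ[ℂ] Module.End ℂ W) :
    𝔤 →ₗ[ℂ] Module.End ℂ (W × W) :=
  -- The pair w stands for w.1 + ξ w.2, and `G.projOdd z - c z • ξ` is the Q-component of z. The
  -- terms come from moving z past ξ: x ξ = [x,ξ] + ξ x for even x, y ξ = [y,ξ] − ξ y for y ∈ Q, and
  -- ξ ξ = ½[ξ,ξ].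
  LinearMap.mk₂ ℂ (fun z w =>
    (ρ (G.projEven z + (G.projOdd z - c z • ξ)) w.1
      + ρ (G.bracket (G.projEven z) ξ - c (G.bracket (G.projEven z) ξ) • ξ
        + G.bracket (G.projOdd z - c z • ξ) ξ + (c z / 2) • G.bracket ξ ξ) w.2,
      ρ (G.projEven z - (G.projOdd z - c z • ξ)) w.2 + c (G.bracket (G.projEven z) ξ) • w.2
        + c z • w.1))
    (fun a b w => by
      simp only [map_add, map_sub, map_smul, LinearMap.add_apply, LinearMap.sub_apply,
        LinearMap.smul_apply, Prod.mk_add_mk]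
      congr 1 <;> module)
    (fun r a w => by
      simp only [map_add, map_sub, map_smul, LinearMap.add_apply, LinearMap.sub_apply,
        LinearMap.smul_apply, Prod.smul_mk, smul_eq_mul]
      congr 1 <;> module)
    (fun a w w' => by
      simp only [map_add, Prod.fst_add, Prod.snd_add, smul_add, Prod.mk_add_mk]
      congr 1 <;> abel)
    (fun r a w => by
      simp only [map_smul, Prod.smul_fst, Prod.smul_snd, Prod.smul_mk, smul_add]
      congr 1
      congr 1
      · congr 1
        exact smul_comm _ _ _
      · exact smul_comm _ _ _)

variable {Q : Submodule ℂ 𝔤} {ξ : 𝔤} {c : Module.Dual ℂ 𝔤} {ρ : 𝔤 →ₗ[ℂ] Module.End ℂ W}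

theorem IsStep.rep_even (h : G.IsStep Q ξ c) {x : 𝔤} (hx : x ∈ G.gr 0) (w : W × W) :
    G.stepRep ξ c ρ x w = (ρ x w.1 + ρ (G.bracket x ξ - c (G.bracket x ξ) • ξ) w.2,
      ρ x w.2 + c (G.bracket x ξ) • w.2) := by
  simp [stepRep, G.projEven_of_even hx, G.projOdd_of_even hx, h.even x hx]

theorem IsStep.rep_odd (h : G.IsStep Q ξ c) {y : 𝔤} (hy : y ∈ Q) (w : W × W) :
    G.stepRep ξ c ρ y w = (ρ y w.1 + ρ (G.bracket y ξ) w.2, -ρ y w.2) := by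
  simp [stepRep, G.projEven_of_odd (h.le hy), G.projOdd_of_odd (h.le hy), h.odd y hy]

theorem IsStep.rep_self (h : G.IsStep Q ξ c) (w : W × W) :
    G.stepRep ξ c ρ ξ w = ((1 / 2 : ℂ) • ρ (G.bracket ξ ξ) w.2, w.1) := by
  simp [stepRep, G.projEven_of_odd h.mem, G.projOdd_of_odd h.mem, h.self]

theorem IsStep.bracket_eq (h : G.IsStep Q ξ c) {x : 𝔤} (hx : x ∈ G.gr 0) :
    ∃ q ∈ Q, G.bracket x ξ = q + c (G.bracket x ξ) • ξ :=
  ⟨_, h.bracket x hx, by simp⟩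

theorem IsStep.rep_even' (h : G.IsStep Q ξ c) {x q : 𝔤} {a : ℂ} (hx : x ∈ G.gr 0) (hq : q ∈ Q)
    (e : G.bracket x ξ = q + a • ξ) (w : W × W) :
    G.stepRep ξ c ρ x w = (ρ x w.1 + ρ q w.2, ρ x w.2 + a • w.2) := by
  have : c (G.bracket x ξ) = a := by simp [e, h.odd q hq, h.self]
  rw [h.rep_even hx, this, e]
  simp

/-- The relations are checked for each pair of kinds among even, Q and ξ. In each case Jacobi writes
the relevant bracket with ξ as an element of Q plus a multiple of ξ, and the relations on W finish.
This is the substitute for PBW: the induced module really has the size W ⊕ ξW. -/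
theorem IsStep.isRepOn (h : G.IsStep Q ξ c) (hρ : G.IsRepOn Q ρ) :
    G.IsRepOn (Q ⊔ ℂ ∙ ξ) (G.stepRep ξ c ρ) := by
  have hξξ : G.bracket ξ (G.bracket ξ ξ) = 0 := by
    have h := G.jacobi_of_odd' h.mem h.mem ξ
    rw [G.bracket_skew_of_even (G.bracket_mem_of_odd ‹G.IsStep Q ξ c›.mem
      ‹G.IsStep Q ξ c›.mem) ‹G.IsStep Q ξ c›.mem] at h
    have h3 : (3 : ℂ) • G.bracket ξ (G.bracket ξ ξ) = 0 := by
      linear_combination (norm := module) (-1 : ℂ) • h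
    exact (smul_eq_zero.1 h3).resolve_left (by norm_num)
  have e00 : ∀ x ∈ G.gr 0, ∀ y ∈ G.gr 0, ∀ w, G.stepRep ξ c ρ (G.bracket x y) w
      = G.stepRep ξ c ρ x (G.stepRep ξ c ρ y w) - G.stepRep ξ c ρ y (G.stepRep ξ c ρ x w) := by
    intro x hx y hy w
    obtain ⟨p, hp, ep⟩ := h.bracket_eq hx
    obtain ⟨q, hq, eq⟩ := h.bracket_eq hy
    set a := c (G.bracket x ξ)
    set b := c (G.bracket y ξ)
    -- The ξ-coefficient is ab − ba = 0: commutators have weight 0 on ξ.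
    have e : G.bracket (G.bracket x y) ξ
        = (G.bracket x q - G.bracket y p + b • p - a • q) + (0 : ℂ) • ξ := by
      rw [G.jacobi_of_even' hx hy, ep, eq]
      simp only [map_add, map_smul, ep, eq]
      module
    rw [h.rep_even' (G.bracket_mem_of_even hx hy) (sub_mem (add_mem (sub_mem (h.stable x hx q hq)
      (h.stable y hy p hp)) (Submodule.smul_mem _ _ hp)) (Submodule.smul_mem _ _ hq)) e,
      h.rep_even' hx hp ep, h.rep_even' hy hq eq, h.rep_even' hx hp ep, h.rep_even' hy hq eq,
      Prod.mk_sub_mk]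
    simp only [map_add, map_sub, map_smul, LinearMap.add_apply, LinearMap.sub_apply,
      LinearMap.smul_apply, hρ.even_even x hx y hy, hρ.even_odd x hx q hq, hρ.even_odd y hy p hp]
    congr 1 <;> module
  have e0Q : ∀ x ∈ G.gr 0, ∀ y ∈ Q, ∀ w, G.stepRep ξ c ρ (G.bracket x y) w
      = G.stepRep ξ c ρ x (G.stepRep ξ c ρ y w) - G.stepRep ξ c ρ y (G.stepRep ξ c ρ x w) := by
    intro x hx y hy w
    obtain ⟨p, hp, ep⟩ := h.bracket_eq hx
    set a := c (G.bracket x ξ)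
    have hyξ := G.bracket_mem_of_odd (h.le hy) h.mem
    have e : G.bracket (G.bracket x y) ξ
        = G.bracket x (G.bracket y ξ) - G.bracket y p - a • G.bracket y ξ := by
      rw [G.jacobi_of_even' hx (h.le hy), ep]
      simp only [map_add, map_smul]
      module
    rw [h.rep_odd (h.stable x hx y hy), h.rep_even' hx hp ep, h.rep_odd hy, h.rep_even' hx hp ep,
      h.rep_odd hy, Prod.mk_sub_mk, e]
    simp only [map_add, map_sub, map_smul, map_neg, LinearMap.sub_apply,
      LinearMap.smul_apply, hρ.even_even x hx _ hyξ, hρ.even_odd x hx y hy, hρ.odd_odd y hy p hp]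
    congr 1 <;> module
  have e0ξ : ∀ x ∈ G.gr 0, ∀ w, G.stepRep ξ c ρ (G.bracket x ξ) w
      = G.stepRep ξ c ρ x (G.stepRep ξ c ρ ξ w) - G.stepRep ξ c ρ ξ (G.stepRep ξ c ρ x w) := by
    intro x hx w
    obtain ⟨p, hp, ep⟩ := h.bracket_eq hx
    set a := c (G.bracket x ξ)
    have hξξ0 := G.bracket_mem_of_odd h.mem h.mem
    have e : G.bracket x (G.bracket ξ ξ) = (2 : ℂ) • G.bracket p ξ + (2 * a) • G.bracket ξ ξ := by
      rw [G.jacobi_of_even hx h.mem, ep]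
      simp only [map_add, map_smul, LinearMap.add_apply, LinearMap.smul_apply,
        G.bracket_comm_of_odd h.mem (h.le hp)]
      module
    have e' := hρ.even_even x hx _ hξξ0 w.2
    rw [e] at e'
    simp only [map_add, map_smul, LinearMap.add_apply, LinearMap.smul_apply] at e'
    rw [h.rep_self, h.rep_even' hx hp ep, h.rep_even' hx hp ep, h.rep_self, ep, map_add, map_smul,
      LinearMap.add_apply, LinearMap.smul_apply, h.rep_self, h.rep_odd hp]
    simp only [map_add, map_smul, Prod.mk_add_mk, Prod.smul_mk, Prod.mk_sub_mk]
    congr 1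
    · linear_combination (norm := module) (1 / 2 : ℂ) • e'
    · module
  have eQQ : ∀ x ∈ Q, ∀ y ∈ Q, ∀ w, G.stepRep ξ c ρ (G.bracket x y) w
      = G.stepRep ξ c ρ x (G.stepRep ξ c ρ y w) + G.stepRep ξ c ρ y (G.stepRep ξ c ρ x w) := by
    intro x hx y hy w
    have hx0 := G.bracket_mem_of_odd (h.le hx) h.mem
    have hy0 := G.bracket_mem_of_odd (h.le hy) h.mem
    have e : G.bracket (G.bracket x y) ξ
        = (-(G.bracket (G.bracket y ξ) x + G.bracket (G.bracket x ξ) y)) + (0 : ℂ) • ξ := by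
      rw [G.jacobi_of_odd' (h.le hx) (h.le hy), G.bracket_skew_of_odd_even (h.le hx) hy0,
        G.bracket_skew_of_odd_even (h.le hy) hx0]
      module
    rw [h.rep_even' (G.bracket_mem_of_odd (h.le hx) (h.le hy))
      (neg_mem (add_mem (h.stable _ hy0 x hx) (h.stable _ hx0 y hy))) e, h.rep_odd hx, h.rep_odd hy,
      h.rep_odd hy, h.rep_odd hx, Prod.mk_add_mk]
    simp only [map_add, map_neg, LinearMap.add_apply, LinearMap.neg_apply,
      hρ.odd_odd x hx y hy, hρ.even_odd _ hx0 y hy, hρ.even_odd _ hy0 x hx]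
    congr 1 <;> module
  have eQξ : ∀ y ∈ Q, ∀ w, G.stepRep ξ c ρ (G.bracket y ξ) w
      = G.stepRep ξ c ρ y (G.stepRep ξ c ρ ξ w) + G.stepRep ξ c ρ ξ (G.stepRep ξ c ρ y w) := by
    intro y hy w
    have hy0 := G.bracket_mem_of_odd (h.le hy) h.mem
    have hξξ0 := G.bracket_mem_of_odd h.mem h.mem
    have e : G.bracket (G.bracket y ξ) ξ
        = (-((1 / 2 : ℂ) • G.bracket (G.bracket ξ ξ) y)) + (0 : ℂ) • ξ := by
      have h1 := G.jacobi_of_odd' h.mem h.mem y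
      have h2 : G.bracket ξ (G.bracket ξ y) = -G.bracket (G.bracket y ξ) ξ := by
        rw [G.bracket_comm_of_odd h.mem (h.le hy), G.bracket_skew_of_odd_even h.mem hy0]
      rw [h2] at h1
      linear_combination (norm := module) (1 / 2 : ℂ) • h1
    rw [h.rep_even' hy0 (neg_mem (Submodule.smul_mem _ _ (h.stable _ hξξ0 y hy))) e,
      h.rep_self, h.rep_odd hy, h.rep_odd hy, h.rep_self, Prod.mk_add_mk]
    simp only [map_neg, map_smul, LinearMap.neg_apply, LinearMap.smul_apply,
      hρ.even_odd _ hξξ0 y hy]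
    congr 1 <;> module
  have eξξ : ∀ w, G.stepRep ξ c ρ (G.bracket ξ ξ) w
      = G.stepRep ξ c ρ ξ (G.stepRep ξ c ρ ξ w) + G.stepRep ξ c ρ ξ (G.stepRep ξ c ρ ξ w) := by
    intro w
    have hξξ0 := G.bracket_mem_of_odd h.mem h.mem
    have e : G.bracket (G.bracket ξ ξ) ξ = 0 + (0 : ℂ) • ξ := by
      rw [G.bracket_skew_of_even hξξ0 h.mem, hξξ]
      simp
    rw [h.rep_even' hξξ0 (zero_mem _) e, h.rep_self, h.rep_self, Prod.mk_add_mk]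
    simp only [map_zero, LinearMap.zero_apply]
    congr 1 <;> module
  refine ⟨e00, fun x hx y hy w => ?_, fun x hx y hy w => ?_⟩
  · obtain ⟨a, ha, b, hb, rfl⟩ := Submodule.mem_sup.1 hy
    obtain ⟨r, rfl⟩ := Submodule.mem_span_singleton.1 hb
    simp only [map_add, map_smul, LinearMap.add_apply, LinearMap.smul_apply, e0Q x hx a ha,
      e0ξ x hx]
    module
  · obtain ⟨a, ha, b, hb, rfl⟩ := Submodule.mem_sup.1 hx
    obtain ⟨r, rfl⟩ := Submodule.mem_span_singleton.1 hb
    obtain ⟨a', ha', b', hb', rfl⟩ := Submodule.mem_sup.1 hy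
    obtain ⟨s, rfl⟩ := Submodule.mem_span_singleton.1 hb'
    simp only [map_add, map_smul, LinearMap.add_apply, LinearMap.smul_apply, eQQ a ha a' ha',
      eQξ a ha, eξξ, G.bracket_comm_of_odd h.mem (h.le ha'), eQξ a' ha']
    module

end Step

variable (G)

/-! ### Explicit models of induced modules -/

theorem le_comap_bracket {Q : Submodule ℂ 𝔤} (hQ : G.EvenStable Q) {x : 𝔤} (hx : x ∈ G.gr 0) :
    G.gr 0 ⊔ Q ≤ (G.gr 0 ⊔ Q).comap (G.bracket x) :=
  fun y hy => ((G.evenStable_gr 0).sup hQ) x hx y hy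

/-- The trace of `ad x` on the quotient of `𝔤` by `G₀ ⊕ Q`. -/
def quotientTrace {Q : Submodule ℂ 𝔤} (hQ : G.EvenStable Q) {x : 𝔤} (hx : x ∈ G.gr 0) : ℂ :=
  LinearMap.trace ℂ _ ((G.gr 0 ⊔ Q).mapQ (G.gr 0 ⊔ Q) (G.bracket x) (G.le_comap_bracket hQ hx))

/-- A model of the module over `G₀ ⊕ Q` that is induced from the character `χ` of `G₀ ⊕ P`. -/
structure InducedModel (χ : Module.Dual ℂ 𝔤) (P Q : Submodule ℂ 𝔤) where
  W : Type
  [addCommGroup : AddCommGroup W]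
  [module : Module ℂ W]
  [finiteDimensional : FiniteDimensional ℂ W]
  ρ : 𝔤 →ₗ[ℂ] Module.End ℂ W
  σ : W →ₗ[ℂ] W
  v : W
  le : P ≤ Q
  odd : Q ≤ G.gr 1
  stable : G.EvenStable P
  stable' : G.EvenStable Q
  isRepOn : G.IsRepOn Q ρ
  σ_σ : ∀ w, σ (σ w) = w
  σ_even : ∀ x ∈ G.gr 0, ∀ w, σ (ρ x w) = ρ x (σ w)
  σ_odd : ∀ y ∈ Q, ∀ w, σ (ρ y w) = -ρ y (σ w)
  σ_v : σ v = v
  v_ne_zero : v ≠ 0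
  isWeightVector : G.IsWeightVector χ P ρ v
  generates : ∀ U : Submodule ℂ W, (∀ x ∈ G.gr 0, ∀ w ∈ U, ρ x w ∈ U) →
    (∀ y ∈ Q, ∀ w ∈ U, ρ y w ∈ U) → v ∈ U → U = ⊤
  -- Frobenius reciprocity. X lives in the universe of 𝔤 because it will be the tensor product
  -- defining the induced module.
  universal : ∀ (X : Type u) [AddCommGroup X] [Module ℂ X] (π : 𝔤 →ₗ[ℂ] Module.End ℂ X),
    G.IsRepOn Q π → ∀ x₀, G.IsWeightVector χ P π x₀ → ∃ T : W →ₗ[ℂ] X, T v = x₀ ∧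
      (∀ x ∈ G.gr 0, ∀ w, T (ρ x w) = π x (T w)) ∧ ∀ y ∈ Q, ∀ w, T (ρ y w) = π y (T w)
  -- For Q = 𝔤₁ the last trace is 0 and the one for P is −2θ, so this becomes tr = dim · (χ − θ).
  trace : ∀ x (hx : x ∈ G.gr 0), 2 * LinearMap.trace ℂ W (ρ x) = Module.finrank ℂ W *
    (2 * χ x + G.quotientTrace stable hx - G.quotientTrace stable' hx)
  -- An x that is ad-nilpotent modulo P has weight 0 on each adjoined vector, so its eigenvalue
  -- never moves away from χ(x).
  eigenvalue : ∀ x ∈ G.gr 0, G.NilMod x P → ∀ w ≠ 0, ∀ a : ℂ, ρ x w = a • w → a = χ x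

attribute [instance] InducedModel.addCommGroup InducedModel.module InducedModel.finiteDimensional

variable {G} {χ : Module.Dual ℂ 𝔤} {P Q : Submodule ℂ 𝔤}

theorem charRep_isRepOn (hχ : χ ∈ G.charSpace) (hP1 : P ≤ G.gr 1)
    (hiso : ∀ x ∈ P, ∀ y ∈ P, χ (G.bracket x y) = 0) :
    G.IsRepOn P (LinearMap.toSpanSingleton ℂ (Module.End ℂ ℂ) 1 ∘ₗ χ) where
  even_even x hx y hy w := by
    simp only [LinearMap.comp_apply, LinearMap.toSpanSingleton_apply, hχ.2 x hx y hy,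
      LinearMap.smul_apply, Module.End.one_apply, smul_eq_mul]
    ring
  even_odd x hx y hy w := by
    simp [hχ.1 _ (G.bracket_mem_of_even hx (hP1 hy)), hχ.1 y (hP1 hy)]
  odd_odd x hx y hy w := by
    simp [hiso x hx y hy, hχ.1 y (hP1 hy), hχ.1 x (hP1 hx)]

/-- The one-dimensional model. -/
def InducedModel.base (hχ : χ ∈ G.charSpace) (hP1 : P ≤ G.gr 1) (hP : G.EvenStable P)
    (hiso : ∀ x ∈ P, ∀ y ∈ P, χ (G.bracket x y) = 0) : G.InducedModel χ P P where
  W := ℂ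
  ρ := LinearMap.toSpanSingleton ℂ (Module.End ℂ ℂ) 1 ∘ₗ χ
  σ := LinearMap.id
  v := 1
  le := le_rfl
  odd := hP1
  stable := hP
  stable' := hP
  isRepOn := charRep_isRepOn hχ hP1 hiso
  σ_σ _ := rfl
  σ_even _ _ _ := rfl
  σ_odd y hy w := by simp [hχ.1 y (hP1 hy)]
  σ_v := rfl
  v_ne_zero := one_ne_zero
  isWeightVector := ⟨fun x _ => by simp, fun y hy => by simp [hχ.1 y (hP1 hy)]⟩
  generates U _ _ h := by
    rw [eq_top_iff]
    intro w _
    simpa using U.smul_mem w h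
  universal X _ _ π _ x₀ h := by
    refine ⟨LinearMap.toSpanSingleton ℂ X x₀, by simp, fun x hx w => ?_, fun y hy w => ?_⟩
    · simp [h.even x hx, smul_smul, mul_comm]
    · simp [h.odd y hy, hχ.1 y (hP1 hy)]
  trace x hx := by
    simp only [LinearMap.comp_apply, LinearMap.toSpanSingleton_apply, map_smul,
      LinearMap.trace_one, Module.finrank_self]
    simp
  eigenvalue x _ _ w hw a h := by
    have : χ x * w = a * w := by simpa using h
    exact (mul_right_cancel₀ hw this).symm

theorem IsStep.stable_sup {ξ : 𝔤} {c : Module.Dual ℂ 𝔤} (h : G.IsStep Q ξ c) :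
    G.EvenStable (Q ⊔ ℂ ∙ ξ) := by
  refine h.stable.sup_span fun x hx => ?_
  obtain ⟨q, hq, e⟩ := h.bracket_eq hx
  exact Submodule.mem_sup.2 ⟨q, hq, _,
    Submodule.smul_mem _ _ (Submodule.mem_span_singleton_self ξ), e.symm⟩

/-- Modulo Q, x acts on ξ by a scalar a, so (ad x)⁴ξ ∈ Q has coordinate a⁴ = 0. -/
theorem IsStep.coord_eq_zero {ξ : 𝔤} {c : Module.Dual ℂ 𝔤} (h : G.IsStep Q ξ c) {x : 𝔤}
    (hx : x ∈ G.gr 0) (hn : G.NilMod x Q) : c (G.bracket x ξ) = 0 := by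
  have key : ∀ z ∈ G.gr 1, z - c z • ξ ∈ Q → G.bracket x z - c (G.bracket x z) • ξ ∈ Q ∧
      c (G.bracket x z) = c z * c (G.bracket x ξ) := by
    intro z _ hz
    have h1 := h.stable x hx _ hz
    have h2 := h.odd _ h1
    simp only [map_sub, map_smul, smul_eq_mul] at h1 h2
    have h3 : c (G.bracket x z) = c z * c (G.bracket x ξ) := by linear_combination h2
    refine ⟨?_, h3⟩
    have h4 := add_mem h1 (Submodule.smul_mem _ (c z) (h.bracket x hx))
    rw [h3]
    convert h4 using 1
    module
  have h1 := G.bracket_mem_of_even hx h.mem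
  have h2 := G.bracket_mem_of_even hx h1
  have h3 := G.bracket_mem_of_even hx h2
  have k1 := h.bracket x hx
  obtain ⟨k2, e2⟩ := key _ h1 k1
  obtain ⟨k3, e3⟩ := key _ h2 k2
  obtain ⟨-, e4⟩ := key _ h3 k3
  have h0 := h.odd _ (hn ξ h.mem)
  rw [e4, e3, e2] at h0
  have : c (G.bracket x ξ) ^ 4 = 0 := by rw [← h0]; ring
  exact pow_eq_zero_iff (by norm_num) |>.1 this

theorem IsStep.quotientTrace_eq [FiniteDimensional ℂ 𝔤] {ξ : 𝔤} {c : Module.Dual ℂ 𝔤}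
    (h : G.IsStep Q ξ c) {x : 𝔤} (hx : x ∈ G.gr 0) :
    G.quotientTrace h.stable hx = G.quotientTrace h.stable_sup hx + c (G.bracket x ξ) := by
  have hξ : ξ ∈ Q ⊔ ℂ ∙ ξ := Submodule.mem_sup_right (Submodule.mem_span_singleton_self ξ)
  refine trace_mapQ_eq_add (G.bracket x) _ _ (sup_le_sup_left le_sup_left _) (ξ := ξ)
    (Submodule.mem_sup_right hξ) c ?_ h.self ?_ (Submodule.mem_sup_right (h.bracket x hx))
  · intro a ha
    obtain ⟨p, hp, q, hq, rfl⟩ := Submodule.mem_sup.1 ha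
    simp [h.even p hp, h.odd q hq]
  · intro b hb
    obtain ⟨p, hp, r, hr, rfl⟩ := Submodule.mem_sup.1 hb
    obtain ⟨q, hq, s, hs, rfl⟩ := Submodule.mem_sup.1 hr
    obtain ⟨t, rfl⟩ := Submodule.mem_span_singleton.1 hs
    have : p + (q + t • ξ) - c (p + (q + t • ξ)) • ξ = p + q := by
      simp only [map_add, map_smul, h.even p hp, h.odd q hq, h.self, smul_eq_mul, mul_one, zero_add]
      abel
    rw [this]
    exact Submodule.mem_sup.2 ⟨p, hp, q, hq, rfl⟩

theorem mem_sup_span_cases {ξ : 𝔤} {p : 𝔤 → Prop} (hQ : ∀ y ∈ Q, p y) (hξ : p ξ)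
    (hadd : ∀ a b, p a → p b → p (a + b)) (hsmul : ∀ (r : ℂ) a, p a → p (r • a)) {y : 𝔤}
    (hy : y ∈ Q ⊔ ℂ ∙ ξ) : p y := by
  obtain ⟨a, ha, b, hb, rfl⟩ := Submodule.mem_sup.1 hy
  obtain ⟨r, rfl⟩ := Submodule.mem_span_singleton.1 hb
  exact hadd _ _ (hQ a ha) (hsmul r ξ hξ)

/-- The model `W ⊕ ξ W`. -/
def InducedModel.step [FiniteDimensional ℂ 𝔤] (M : G.InducedModel χ P Q) {ξ : 𝔤}
    {c : Module.Dual ℂ 𝔤} (h : G.IsStep Q ξ c) : G.InducedModel χ P (Q ⊔ ℂ ∙ ξ) where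
  W := M.W × M.W
  ρ := G.stepRep ξ c M.ρ
  -- The sign on the second factor records that ξ is odd.
  σ := M.σ.prodMap (-M.σ)
  v := (M.v, 0)
  le := M.le.trans le_sup_left
  odd := sup_le h.le ((Submodule.span_singleton_le_iff_mem _ _).2 h.mem)
  stable := M.stable
  stable' := h.stable_sup
  isRepOn := h.isRepOn M.isRepOn
  σ_σ w := by simp [M.σ_σ]
  σ_even x hx w := by
    rw [h.rep_even hx, h.rep_even hx]
    simp [M.σ_even x hx, M.σ_odd _ (h.bracket x hx), -map_sub]
    abel
  σ_odd y hy w := by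
    refine mem_sup_span_cases (p := fun y => M.σ.prodMap (-M.σ) (G.stepRep ξ c M.ρ y w)
      = -G.stepRep ξ c M.ρ y (M.σ.prodMap (-M.σ) w)) ?_ ?_ ?_ ?_ hy
    · intro y hy
      rw [h.rep_odd hy, h.rep_odd hy]
      simp [M.σ_odd y hy, M.σ_even _ (G.bracket_mem_of_odd (h.le hy) h.mem), add_comm]
    · rw [h.rep_self, h.rep_self]
      simp [M.σ_even _ (G.bracket_mem_of_odd h.mem h.mem)]
    · intro a b ha hb
      rw [map_add, LinearMap.add_apply, map_add, ha, hb, LinearMap.add_apply]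
      abel
    · intro r a ha
      rw [map_smul, LinearMap.smul_apply, map_smul, ha, LinearMap.smul_apply, smul_neg]
  σ_v := by simp [M.σ_v]
  v_ne_zero := fun e => M.v_ne_zero (congrArg Prod.fst e)
  isWeightVector := ⟨fun x hx => by
    rw [h.rep_even hx]
    simp [M.isWeightVector.even x hx], fun y hy => by
    rw [h.rep_odd (M.le hy)]
    simp [M.isWeightVector.odd y hy]⟩
  generates U h0 h1 hv := by
    have hQ : ∀ y ∈ Q, y ∈ Q ⊔ ℂ ∙ ξ := fun y hy => Submodule.mem_sup_left hy
    have e1 : U.comap (LinearMap.inl ℂ M.W M.W) = ⊤ := by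
      refine M.generates _ (fun x hx w hw => ?_) (fun y hy w hw => ?_) hv
      · have := h0 x hx _ hw
        rw [h.rep_even hx] at this
        simpa using this
      · have := h1 y (hQ y hy) _ hw
        rw [h.rep_odd hy] at this
        simpa using this
    have e2 : ∀ w : M.W, (w, (0 : M.W)) ∈ U := fun w => by
      have : w ∈ U.comap (LinearMap.inl ℂ M.W M.W) := e1 ▸ Submodule.mem_top
      exact this
    have e3 : ∀ w : M.W, ((0 : M.W), w) ∈ U := fun w => by
      have := h1 ξ (Submodule.mem_sup_right (Submodule.mem_span_singleton_self ξ)) _ (e2 w)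
      rw [h.rep_self] at this
      simpa using this
    rw [eq_top_iff]
    rintro ⟨a, b⟩ -
    simpa using add_mem (e2 a) (e3 b)
  universal X _ _ π hπ x₀ hx₀ := by
    have hξQ : ξ ∈ Q ⊔ ℂ ∙ ξ := Submodule.mem_sup_right (Submodule.mem_span_singleton_self ξ)
    have hQ : ∀ {y}, y ∈ Q → y ∈ Q ⊔ ℂ ∙ ξ := fun hy => Submodule.mem_sup_left hy
    obtain ⟨T, hT, hT0, hT1⟩ := M.universal X π (hπ.mono le_sup_left) x₀ hx₀
    -- The forced extension w₁ + ξ w₂ ↦ T w₁ + ξ T w₂.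
    let T' : M.W × M.W →ₗ[ℂ] X := T.coprod (π ξ ∘ₗ T)
    have hT' : ∀ a b, T' (a, b) = T a + π ξ (T b) := fun a b => by simp [T']
    refine ⟨T', by simp [hT', hT], fun x hx w => ?_, fun y hy w => ?_⟩
    · obtain ⟨q, hq, e⟩ := h.bracket_eq hx
      have e' := hπ.even_odd x hx ξ hξQ (T w.2)
      rw [e, map_add, map_smul, LinearMap.add_apply, LinearMap.smul_apply] at e'
      obtain ⟨a, b⟩ := w
      rw [h.rep_even' hx hq e, hT', hT']
      simp only [map_add, map_smul, hT0 x hx, hT1 q hq] at e' ⊢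
      linear_combination (norm := module) e'
    · refine mem_sup_span_cases (p := fun y => T' (G.stepRep ξ c M.ρ y w) = π y (T' w))
        ?_ ?_ ?_ ?_ hy
      · intro y hy
        have e' := hπ.odd_odd y (hQ hy) ξ hξQ (T w.2)
        obtain ⟨a, b⟩ := w
        rw [h.rep_odd hy, hT', hT']
        simp only [map_add, map_neg, hT1 y hy, hT0 _ (G.bracket_mem_of_odd (h.le hy) h.mem)] at e' ⊢
        linear_combination (norm := module) e'
      · have e' := hπ.odd_odd ξ hξQ ξ hξQ (T w.2)
        obtain ⟨a, b⟩ := w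
        rw [h.rep_self, hT', hT']
        simp only [map_add, map_smul, hT0 _ (G.bracket_mem_of_odd h.mem h.mem)] at e' ⊢
        linear_combination (norm := module) (1 / 2 : ℂ) • e'
      · intro a b ha hb
        rw [map_add, LinearMap.add_apply, map_add, ha, hb, map_add, LinearMap.add_apply]
      · intro r a ha
        rw [map_smul, LinearMap.smul_apply, map_smul, ha, map_smul, LinearMap.smul_apply]
  trace x hx := by
    have e1 : LinearMap.fst ℂ M.W M.W ∘ₗ G.stepRep ξ c M.ρ x ∘ₗ LinearMap.inl ℂ M.W M.W
        = M.ρ x := LinearMap.ext fun w => by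
      simp only [LinearMap.comp_apply, h.rep_even hx]
      simp
    -- On ξW the action is shifted by the weight of ξ; the shift matches the change of the quotient
    -- trace in `IsStep.quotientTrace_eq`.
    have e2 : LinearMap.snd ℂ M.W M.W ∘ₗ G.stepRep ξ c M.ρ x ∘ₗ LinearMap.inr ℂ M.W M.W
        = M.ρ x + c (G.bracket x ξ) • LinearMap.id := LinearMap.ext fun w => by
      simp only [LinearMap.comp_apply, h.rep_even hx]
      simp
    have e3 := M.trace x hx
    have e4 := h.quotientTrace_eq hx
    rw [trace_prod_eq, e1, e2, map_add, map_smul, LinearMap.trace_id, Module.finrank_prod,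
      smul_eq_mul]
    push_cast
    linear_combination 2 * e3 - 2 * (Module.finrank ℂ M.W : ℂ) * e4
  eigenvalue x hx hn w hw a ha := by
    have hα := h.coord_eq_zero hx (hn.mono M.le)
    rw [h.rep_even hx, hα] at ha
    obtain ⟨w₁, w₂⟩ := w
    rw [Prod.smul_mk, Prod.mk.injEq] at ha
    by_cases h2 : w₂ = 0
    · refine M.eigenvalue x hx hn w₁ (fun h1 => hw (by rw [h1, h2]; rfl)) a ?_
      simpa [h2] using ha.1
    · exact M.eigenvalue x hx hn w₂ h2 a (by simpa using ha.2)

/-! ### Filtrations -/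

section Filtration

variable {W : Type*} [AddCommGroup W] [Module ℂ W]

variable (G) in
/-- A filtration of a representation of `G₀ ⊕ Q`; it controls the vectors that are annihilated
by `P`. -/
structure IsFiltration (χ : Module.Dual ℂ 𝔤) (P Q : Submodule ℂ 𝔤) (ω : 𝔤)
    (ρ : 𝔤 →ₗ[ℂ] Module.End ℂ W) (v : W) (F : ℕ → Submodule ℂ W) : Prop where
  zero : F 0 = ⊥
  mono : ∀ d, F d ≤ F (d + 1)
  exhaustive : ∃ d, F d = ⊤
  even_mem : ∀ d, ∀ x ∈ G.gr 0, ∀ w ∈ F d, ρ x w ∈ F d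
  lower : ∀ d, ∀ ζ ∈ P, ∀ w ∈ F (d + 1), ρ ζ w ∈ F d
  raise : ∀ d, ∀ y ∈ Q, ∀ w ∈ F d, ρ y w ∈ F (d + 1)
  weight : ∀ x ∈ G.gr 0, ∀ w ∈ F 1, ρ x w = χ x • w
  first : ∀ w ∈ F 1, ∃ a b : ℂ, w = a • v + b • ρ ω v
  -- From degree d + 2 on, no vector is lowered by two degrees by all of P unless its top part
  -- vanishes: P acts nondegenerately on the graded pieces above the first.
  singular : ∀ d, ∀ w ∈ F (d + 2), (∀ ζ ∈ P, ρ ζ w ∈ F d) → w ∈ F (d + 1)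
  -- This supplies the lowest case of `singular` when a new vector is adjoined.
  orthogonal : ∀ w ∈ F 2, ∀ ζ ∈ P, (∀ η ∈ Q, χ (G.bracket ζ η) = 0) → ρ ζ w = 0

variable {ρ : 𝔤 →ₗ[ℂ] Module.End ℂ W} {v : W} {ω : 𝔤} {F : ℕ → Submodule ℂ W}

/-- The trivial filtration of a representation on which `G₀ ⊕ P` acts by `χ`. -/
theorem isFiltration_trivial (h : ∀ w, G.IsWeightVector χ P ρ w)
    (hω : ∀ w, ∃ a b : ℂ, w = a • v + b • ρ ω v) :
    G.IsFiltration χ P Q ω ρ v (fun d => if d = 0 then ⊥ else ⊤) where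
  zero := rfl
  mono d := by simp
  exhaustive := ⟨1, rfl⟩
  even_mem d x hx w hw := by
    by_cases hd : d = 0
    · simp only [hd, if_true, Submodule.mem_bot] at hw ⊢
      rw [hw, map_zero]
    · simp [hd]
  lower d ζ hζ w _ := by
    rw [(h w).odd ζ hζ]
    exact zero_mem _
  raise d y hy w hw := by simp
  weight x hx w _ := (h w).even x hx
  first w _ := hω w
  singular d w _ _ := by simp
  orthogonal w _ ζ hζ _ := (h w).odd ζ hζ

/-- Adjoining ξ raises the degree by one, so w₁ + ξ w₂ has degree d when w₁ has degree d and w₂ has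
degree d − 1. The separating ζ detects ξ, since ζ ξ w₂ = [ζ,ξ] w₂ − ξ ζ w₂ and [ζ,ξ] acts on F 1 by
a nonzero scalar. -/
theorem IsFiltration.step (hF : G.IsFiltration χ P Q ω ρ v F) (hPQ : P ≤ Q) {ξ : 𝔤}
    {c : Module.Dual ℂ 𝔤} (h : G.IsStep Q ξ c) (hω : ω ∈ Q)
    (hsep : ∃ ζ ∈ P, (∀ η ∈ Q, χ (G.bracket ζ η) = 0) ∧ χ (G.bracket ζ ξ) ≠ 0) :
    G.IsFiltration χ P (Q ⊔ ℂ ∙ ξ) ω (G.stepRep ξ c ρ) (v, 0)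
      -- Truncated subtraction is harmless at d = 0, because F 0 = 0.
      (fun d => (F d).prod (F (d - 1))) where
  zero := by simp only [Nat.zero_sub, hF.zero, Submodule.prod_bot]
  mono d := by
    refine Submodule.prod_mono (hF.mono d) ?_
    cases d with
    | zero => exact le_rfl
    | succ d => exact hF.mono d
  exhaustive := by
    obtain ⟨d, hd⟩ := hF.exhaustive
    refine ⟨d + 1, ?_⟩
    have : F (d + 1) = ⊤ := top_le_iff.1 (hd ▸ hF.mono d)
    rw [Nat.add_sub_cancel, hd, this, Submodule.prod_top]
  even_mem d x hx w hw := by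
    obtain ⟨h1, h2⟩ := Submodule.mem_prod.1 hw
    rw [h.rep_even hx]
    refine Submodule.mem_prod.2 ⟨add_mem (hF.even_mem d x hx _ h1) ?_,
      add_mem (hF.even_mem _ x hx _ h2) (Submodule.smul_mem _ _ h2)⟩
    cases d with
    | zero =>
      rw [Nat.zero_sub, hF.zero, Submodule.mem_bot] at h2
      rw [h2, map_zero]
      exact zero_mem _
    | succ d => exact hF.raise d _ (h.bracket x hx) _ h2
  lower d ζ hζ w hw := by
    obtain ⟨h1, h2⟩ := Submodule.mem_prod.1 hw
    rw [Nat.add_sub_cancel] at h2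
    rw [h.rep_odd (hPQ hζ)]
    refine Submodule.mem_prod.2 ⟨add_mem (hF.lower d ζ hζ _ h1) (hF.even_mem d _
      (G.bracket_mem_of_odd (h.le (hPQ hζ)) h.mem) _ h2), neg_mem ?_⟩
    cases d with
    | zero =>
      rw [hF.zero, Submodule.mem_bot] at h2
      rw [h2, map_zero]
      exact zero_mem _
    | succ d => exact hF.lower d ζ hζ _ h2
  raise d y hy w hw := by
    obtain ⟨h1, h2⟩ := Submodule.mem_prod.1 hw
    have h2' : w.2 ∈ F d := by
      cases d with
      | zero => exact h2
      | succ d => exact hF.mono d h2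
    refine mem_sup_span_cases (p := fun y => G.stepRep ξ c ρ y w ∈ (F (d + 1)).prod (F d))
      ?_ ?_ ?_ ?_ hy
    · intro y hy
      rw [h.rep_odd hy]
      refine Submodule.mem_prod.2 ⟨add_mem (hF.raise d y hy _ h1) (hF.mono d (hF.even_mem d _
        (G.bracket_mem_of_odd (h.le hy) h.mem) _ h2')), neg_mem ?_⟩
      cases d with
      | zero =>
        rw [Nat.zero_sub, hF.zero, Submodule.mem_bot] at h2
        rw [h2, map_zero]
        exact zero_mem _
      | succ d => exact hF.raise d y hy _ h2
    · rw [h.rep_self]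
      exact Submodule.mem_prod.2 ⟨Submodule.smul_mem _ _ (hF.mono d (hF.even_mem d _
        (G.bracket_mem_of_odd h.mem h.mem) _ h2')), h1⟩
    · intro a b ha hb
      rw [map_add, LinearMap.add_apply]
      exact add_mem ha hb
    · intro r a ha
      rw [map_smul, LinearMap.smul_apply]
      exact Submodule.smul_mem _ _ ha
  weight x hx w hw := by
    obtain ⟨h1, h2⟩ := Submodule.mem_prod.1 hw
    rw [Nat.sub_self, hF.zero, Submodule.mem_bot] at h2
    rw [h.rep_even hx, h2, hF.weight x hx _ h1]
    refine Prod.ext ?_ ?_ <;> simp [h2]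
  first w hw := by
    obtain ⟨h1, h2⟩ := Submodule.mem_prod.1 hw
    rw [Nat.sub_self, hF.zero, Submodule.mem_bot] at h2
    obtain ⟨a, b, e⟩ := hF.first _ h1
    refine ⟨a, b, ?_⟩
    rw [h.rep_odd hω]
    refine Prod.ext ?_ ?_
    · simp [e]
    · simp [h2]
  singular d w hw hs := by
    obtain ⟨h1, h2⟩ := Submodule.mem_prod.1 hw
    change w.2 ∈ F (d + 1) at h2
    have hs' : ∀ ζ ∈ P, ρ ζ w.1 + ρ (G.bracket ζ ξ) w.2 ∈ F d ∧ ρ ζ w.2 ∈ F (d - 1) := by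
      intro ζ hζ
      have := hs ζ hζ
      rw [h.rep_odd (hPQ hζ)] at this
      obtain ⟨h3, h4⟩ := Submodule.mem_prod.1 this
      exact ⟨h3, (Submodule.neg_mem_iff _).1 h4⟩
    have h2' : w.2 ∈ F d := by
      cases d with
      | zero =>
        -- Here w₂ ∈ F 1 must be shown to vanish. The separating ζ kills w₁, so the first component
        -- of ζ w is χ([ζ,ξ]) w₂, and it lies in F 0 = 0.
        obtain ⟨ζ, hζ, hζQ, hζξ⟩ := hsep
        have h3 := (hs' ζ hζ).1
        rw [hF.orthogonal _ h1 ζ hζ hζQ, zero_add, hF.weight _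
          (G.bracket_mem_of_odd (h.le (hPQ hζ)) h.mem) _ h2] at h3
        simpa [smul_smul, inv_mul_cancel₀ hζξ] using Submodule.smul_mem _ (χ (G.bracket ζ ξ))⁻¹ h3
      | succ e => exact hF.singular e _ h2 fun ζ hζ => (hs' ζ hζ).2
    refine Submodule.mem_prod.2 ⟨hF.singular d _ h1 fun ζ hζ => ?_, h2'⟩
    have h3 := sub_mem (hs' ζ hζ).1
      (hF.even_mem d _ (G.bracket_mem_of_odd (h.le (hPQ hζ)) h.mem) _ h2')
    simpa using h3
  orthogonal w hw ζ hζ hη := by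
    obtain ⟨h1, h2⟩ := Submodule.mem_prod.1 hw
    change w.2 ∈ F 1 at h2
    have h3 := hF.lower 0 ζ hζ _ h2
    rw [hF.zero, Submodule.mem_bot] at h3
    rw [h.rep_odd (hPQ hζ), h3, hF.orthogonal _ h1 ζ hζ fun η hη' =>
      hη η (Submodule.mem_sup_left hη'),
      hF.weight _ (G.bracket_mem_of_odd (h.le (hPQ hζ)) h.mem) _ h2,
      hη ξ (Submodule.mem_sup_right (Submodule.mem_span_singleton_self ξ))]
    simp

/-- A nonzero subspace that is stable under `P` contains a nonzero vector of `F 1`. -/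
theorem IsFiltration.exists_mem_first (hF : G.IsFiltration χ P Q ω ρ v F) {U : Submodule ℂ W}
    (hU : ∀ ζ ∈ P, ∀ u ∈ U, ρ ζ u ∈ U) (hU0 : U ≠ ⊥) : ∃ u ∈ U, u ≠ 0 ∧ u ∈ F 1 := by
  classical
  have hex : ∃ d, ∃ u ∈ U, u ≠ 0 ∧ u ∈ F d := by
    obtain ⟨d, hd⟩ := hF.exhaustive
    obtain ⟨u, hu, hu0⟩ := Submodule.exists_mem_ne_zero_of_ne_bot hU0
    exact ⟨d, u, hu, hu0, hd ▸ Submodule.mem_top⟩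
  obtain ⟨u, hu, hu0, hud⟩ := Nat.find_spec hex
  have hmin := fun m => Nat.find_min hex (m := m)
  generalize Nat.find hex = d at hud hmin
  match d with
  | 0 =>
    rw [hF.zero, Submodule.mem_bot] at hud
    exact absurd hud hu0
  | 1 => exact ⟨u, hu, hu0, hud⟩
  | d + 2 =>
    -- With d + 2 the least degree of a nonzero vector of U, each ζ u ∈ U has degree at most d + 1
    -- and hence vanishes; then `singular` lowers the degree of u, a contradiction.
    refine absurd ⟨u, hu, hu0, hF.singular d u hud fun ζ hζ => ?_⟩
      (hmin (d + 1) (Nat.lt_succ_self _))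
    by_contra h0
    exact hmin (d + 1) (Nat.lt_succ_self _)
      ⟨ρ ζ u, hU ζ hζ u hu, fun h => h0 (h ▸ zero_mem _), hF.lower (d + 1) ζ hζ u hud⟩

end Filtration

/-- Every model can be extended to the whole odd part. -/
theorem InducedModel.exists_extension [FiniteDimensional ℂ 𝔤] (hG : G.IsSolvable) {ω : 𝔤}
    (M : G.InducedModel χ P Q) {F : ℕ → Submodule ℂ M.W}
    (hF : G.IsFiltration χ P Q ω M.ρ M.v F) (hω : ω ∈ Q) (hQ : G.orth χ P ≤ Q) :
    ∃ (M' : G.InducedModel χ P (G.gr 1)) (F' : ℕ → Submodule ℂ M'.W),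
      G.IsFiltration χ P (G.gr 1) ω M'.ρ M'.v F' := by
  induction Q using WellFoundedGT.induction with
  | ind Q ih =>
    by_cases hle : G.gr 1 ≤ Q
    · obtain rfl := le_antisymm M.odd hle
      exact ⟨M, F, hF⟩
    · obtain ⟨ξ, hξ, hξQ, hξe⟩ := exists_eigenvector_mod hG M.stable' (G.evenStable_gr 1) hle
      obtain ⟨c, h⟩ := exists_isStep M.odd M.stable' hξ hξQ hξe
      refine ih (Q ⊔ ℂ ∙ ξ) (lt_of_le_of_ne le_sup_left fun e => hξQ ?_) (M.step h)
        (hF.step M.le h hω (exists_mem_orth_separating M.odd hQ hξ hξQ))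
        (Submodule.mem_sup_left hω) (hQ.trans le_sup_left)
      rw [e]
      exact Submodule.mem_sup_right (Submodule.mem_span_singleton_self ξ)

/-- The model of the module induced from a polarization. -/
theorem MaxIsotropic.exists_model [FiniteDimensional ℂ 𝔤] (hG : G.IsSolvable)
    (hχ : χ ∈ G.charSpace) (hP : G.EvenStable P) (h : G.MaxIsotropic χ P) :
    ∃ ω ∈ G.orth χ P, (G.orth χ P ≤ P → ω = 0) ∧
      (¬ G.orth χ P ≤ P → χ (G.bracket ω ω) ≠ 0 ∧ ∀ x ∈ G.gr 0, G.bracket x ω ∈ P) ∧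
      ∃ (M : G.InducedModel χ P (G.gr 1)) (F : ℕ → Submodule ℂ M.W),
        G.IsFiltration χ P (G.gr 1) ω M.ρ M.v F := by
  let M₀ := InducedModel.base hχ h.le hP h.isotropic
  by_cases hd : G.orth χ P ≤ P
  · refine ⟨0, zero_mem _, fun _ => rfl, fun hn => absurd hd hn, ?_⟩
    refine M₀.exists_extension hG (isFiltration_trivial (W := ℂ)
      (ρ := LinearMap.toSpanSingleton ℂ (Module.End ℂ ℂ) 1 ∘ₗ χ) (v := 1) (fun w => ?_)
      fun w => ⟨w, 0, by simp⟩) (zero_mem _) hd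
    exact ⟨fun x _ => by simp, fun y hy => by simp [hχ.1 y (h.le hy)]⟩
  · obtain ⟨ω, hω, hωP, hωω, hle, hωe⟩ := h.exists_orth_le hG hχ hP hd
    refine ⟨ω, hω, fun hn => absurd hn hd, fun _ => ⟨hωω, hωe⟩, ?_⟩
    obtain ⟨c, hs⟩ := exists_isStep h.le hP hω.1 hωP fun x hx => ⟨0, by simpa using hωe x hx⟩
    -- ω is adjoined before the filtration starts: 𝔤₀ ⊕ P acts by χ on both v and ωv, since [𝔤₀,ω] ⊂
    -- P and ω ⊥ P. Hence both sit in F 1.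
    refine (M₀.step hs).exists_extension hG (ω := ω)
      (isFiltration_trivial (W := ℂ × ℂ)
        (ρ := G.stepRep ω c (LinearMap.toSpanSingleton ℂ (Module.End ℂ ℂ) 1 ∘ₗ χ))
        (v := (1, 0)) (fun w => ?_) fun w => ⟨w.1, w.2, ?_⟩)
      (Submodule.mem_sup_right (Submodule.mem_span_singleton_self ω)) hle
    · refine ⟨fun x hx => ?_, fun y hy => ?_⟩
      · have e : G.bracket x ω = G.bracket x ω + (0 : ℂ) • ω := by simp
        rw [hs.rep_even' hx (hωe x hx) e]
        refine Prod.ext ?_ ?_ <;> simp [hχ.1 _ (h.le (hωe x hx))]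
      · rw [hs.rep_odd hy]
        refine Prod.ext ?_ ?_ <;> simp [hχ.1 _ (h.le hy), hω.2 y hy]
    · rw [hs.rep_self]
      refine Prod.ext ?_ ?_ <;> simp

end LieSuperalgebra

/-! ### Generalities on modules -/

theorem Superspace.mem_gr_iff {V : Type*} [AddCommGroup V] [Module ℂ V] (E : Superspace V)
    {i : ZMod 2} {v : V} : v ∈ E.gr i ↔ E.parityInv v = paritySign i • v := by
  refine ⟨E.parityInv_of_mem, fun h => ?_⟩
  obtain ⟨a, ha, b, hb, rfl⟩ := E.exists_add v
  rw [map_add, E.parityInv_of_mem ha, E.parityInv_of_mem hb, paritySign_zero,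
    paritySign_one] at h
  rcases parity_cases i with rfl | rfl
  · rw [paritySign_zero] at h
    have h2 : (2 : ℂ) • b = 0 := by linear_combination (norm := module) (-1 : ℂ) • h
    rw [(smul_eq_zero.1 h2).resolve_left two_ne_zero, add_zero]
    exact ha
  · rw [paritySign_one] at h
    have h2 : (2 : ℂ) • a = 0 := by linear_combination (norm := module) h
    rw [(smul_eq_zero.1 h2).resolve_left two_ne_zero, zero_add]
    exact hb

theorem koszulSign_one_one : koszulSign 1 1 = -1 := by
  have : (1 : ZMod 2).val = 1 := rfl
  simp [koszulSign, this]

theorem koszulSign_zero_left (j : ZMod 2) : koszulSign 0 j = 1 := by simp [koszulSign]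

universe u

variable {𝔤 : Type u} [AddCommGroup 𝔤] [Module ℂ 𝔤] {G : LieSuperalgebra 𝔤}

/-- The elements satisfying p form a subalgebra; lifting 𝔤 → U(𝔤) into it and including back gives
the identity. -/
theorem LieSuperalgebra.env_induction (G : LieSuperalgebra 𝔤) {p : G.Env → Prop}
    (algebraMap : ∀ r : ℂ, p (algebraMap ℂ G.Env r)) (ι : ∀ x, p (G.ι x))
    (mul : ∀ a b, p a → p b → p (a * b)) (add : ∀ a b, p a → p b → p (a + b)) (u : G.Env) :
    p u := by
  let S : Subalgebra ℂ G.Env :=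
    { carrier := {u | p u}
      mul_mem' := fun ha hb => mul _ _ ha hb
      add_mem' := fun ha hb => add _ _ ha hb
      algebraMap_mem' := algebraMap }
  let f : G.Env →ₐ[ℂ] S := G.envLift
    ((G.ι).codRestrict S.toSubmodule ι) fun i j x y hx hy => Subtype.ext (G.ι_mul_ι hx hy)
  have h : S.val.comp f = AlgHom.id ℂ G.Env := G.env_hom_ext fun x => by
    rw [AlgHom.comp_apply, LieSuperalgebra.envLift_ι]
    rfl
  have hu := AlgHom.congr_fun h u
  rw [AlgHom.comp_apply, AlgHom.id_apply] at hu
  rw [← hu]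
  exact (f u).2

namespace SuperModule

variable {V : Type*} [AddCommGroup V] [Module ℂ V] {W : Type*} [AddCommGroup W] [Module ℂ W]
  {X : Type*} [AddCommGroup X] [Module ℂ X]

theorem act_even (M : SuperModule G V) {i : ZMod 2} {x y : 𝔤} (hx : x ∈ G.gr 0) (hy : y ∈ G.gr i)
    (v : V) : M.act (G.bracket x y) v = M.act x (M.act y v) - M.act y (M.act x v) := by
  rw [M.act_bracket hx hy, koszulSign_zero_left, one_smul]
  rfl

theorem act_odd (M : SuperModule G V) {x y : 𝔤} (hx : x ∈ G.gr 1) (hy : y ∈ G.gr 1)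
    (v : V) : M.act (G.bracket x y) v = M.act x (M.act y v) + M.act y (M.act x v) := by
  rw [M.act_bracket hx hy, koszulSign_one_one, neg_one_smul, sub_neg_eq_add]
  rfl

theorem isRepOn (M : SuperModule G V) : G.IsRepOn (G.gr 1) M.act where
  even_even _ hx _ hy := M.act_even hx hy
  even_odd _ hx _ hy := M.act_even hx hy
  odd_odd _ hx _ hy := M.act_odd hx hy

theorem act_even_mem (M : SuperModule G V) {i : ZMod 2} {x : 𝔤} {v : V} (hx : x ∈ G.gr 0)
    (hv : v ∈ M.gr i) : M.act x v ∈ M.gr i := by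
  simpa using M.act_mem hx hv

theorem IsInvariant.envAct_mem {M : SuperModule G V} {U : Submodule ℂ V} (hU : M.IsInvariant U)
    (u : G.Env) : ∀ w ∈ U, M.envAct u w ∈ U := by
  induction u using G.env_induction with
  | algebraMap r =>
    intro w hw
    rw [AlgHom.commutes]
    exact U.smul_mem r hw
  | ι x =>
    intro w hw
    rw [M.envAct_ι]
    exact hU x w hw
  | mul a b ha hb =>
    intro w hw
    rw [map_mul]
    exact ha _ (hb w hw)
  | add a b ha hb =>
    intro w hw
    rw [map_add]
    exact add_mem (ha w hw) (hb w hw)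

theorem isGraded_iff (M : SuperModule G V) {U : Submodule ℂ V} :
    M.IsGraded U ↔ ∀ u ∈ U, M.parityInv u ∈ U := by
  constructor
  · intro h u hu
    rw [h] at hu
    obtain ⟨a, ha, b, hb, rfl⟩ := Submodule.mem_sup.1 hu
    rw [map_add, M.parityInv_of_mem ha.2, M.parityInv_of_mem hb.2]
    exact add_mem (U.smul_mem _ ha.1) (U.smul_mem _ hb.1)
  · intro h
    refine le_antisymm (fun u hu => ?_) (sup_le inf_le_left inf_le_left)
    obtain ⟨a, ha, b, hb, rfl⟩ := M.exists_add u
    have h1 := h _ hu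
    rw [map_add, M.parityInv_of_mem ha, M.parityInv_of_mem hb, paritySign_zero,
      paritySign_one] at h1
    have ha' : a = (1 / 2 : ℂ) • ((a + b) + ((1 : ℂ) • a + (-1 : ℂ) • b)) := by module
    have hb' : b = (1 / 2 : ℂ) • ((a + b) - ((1 : ℂ) • a + (-1 : ℂ) • b)) := by module
    refine Submodule.mem_sup.2 ⟨a, ⟨?_, ha⟩, b, ⟨?_, hb⟩, rfl⟩
    · rw [ha']
      exact U.smul_mem _ (add_mem hu h1)
    · rw [hb']
      exact U.smul_mem _ (sub_mem hu h1)

theorem IsIso.symm {M : SuperModule G V} {N : SuperModule G W} (h : M.IsIso N) : N.IsIso M := by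
  obtain ⟨e, he, ha⟩ := h
  refine ⟨e.symm, fun i w hw => ?_, fun x w => ?_⟩
  · have hpar : ∀ v, e (M.parityInv v) = N.parityInv (e v) := by
      intro v
      obtain ⟨a, ha, b, hb, rfl⟩ := M.exists_add v
      simp only [map_add]
      rw [M.parityInv_of_mem ha, M.parityInv_of_mem hb, N.parityInv_of_mem (he 0 a ha),
        N.parityInv_of_mem (he 1 b hb), map_smul, map_smul]
    rw [M.mem_gr_iff]
    apply e.injective
    rw [hpar, map_smul, e.apply_symm_apply]
    exact N.parityInv_of_mem hw
  · apply e.injective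
    rw [ha, e.apply_symm_apply, e.apply_symm_apply]

theorem IsIso.trans {M : SuperModule G V} {N : SuperModule G W} {L : SuperModule G X}
    (h : M.IsIso N) (h' : N.IsIso L) : M.IsIso L := by
  obtain ⟨e, he, ha⟩ := h
  obtain ⟨e', he', ha'⟩ := h'
  exact ⟨e.trans e', fun i v hv => he' i _ (he i v hv), fun x v => by simp [ha, ha']⟩

theorem IsIso.parityChange {M : SuperModule G V} {N : SuperModule G W} (h : M.IsIso N) :
    M.parityChange.IsIso N.parityChange := by
  obtain ⟨e, he, ha⟩ := h
  exact ⟨e, fun i v hv => he (i + 1) v hv, fun x v => ha (G.parityInv x) v⟩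

theorem parityChange_parityChange_isIso (M : SuperModule G V) :
    M.parityChange.parityChange.IsIso M := by
  refine ⟨LinearEquiv.refl ℂ V, fun i v hv => ?_, fun x v => ?_⟩
  · have h2 : i + 1 + 1 = i := by
      have : (1 + 1 : ZMod 2) = 0 := by decide
      rw [add_assoc, this, add_zero]
    have : v ∈ M.gr (i + 1 + 1) := hv
    rwa [h2] at this
  · change M.act (G.parityInv (G.parityInv x)) v = M.act x v
    rw [G.parityInv_parityInv]

theorem IsIsoUpToParity.symm {M : SuperModule G V} {N : SuperModule G W}
    (h : M.IsIsoUpToParity N) : N.IsIsoUpToParity M := by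
  rcases h with h | h
  · exact Or.inl h.symm
  · exact Or.inr (N.parityChange_parityChange_isIso.symm.trans h.symm.parityChange)

theorem IsIsoUpToParity.trans {M : SuperModule G V} {N : SuperModule G W} {L : SuperModule G X}
    (h : M.IsIsoUpToParity N) (h' : N.IsIsoUpToParity L) : M.IsIsoUpToParity L := by
  rcases h with h | h <;> rcases h' with h' | h'
  · exact Or.inl (h.trans h')
  · exact Or.inr (h.trans h')
  · exact Or.inr (h.trans h'.parityChange)
  · exact Or.inl ((h.trans h'.parityChange).trans L.parityChange_parityChange_isIso)

/-- Change of parity alters the action of odd elements only, so traces of even elements are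
invariants of ≅_Π. -/
theorem IsIsoUpToParity.exists_equiv {M : SuperModule G V} {N : SuperModule G W}
    (h : M.IsIsoUpToParity N) :
    ∃ e : V ≃ₗ[ℂ] W, ∀ x ∈ G.gr 0, ∀ v, e (M.act x v) = N.act x (e v) := by
  rcases h with ⟨e, -, he⟩ | ⟨e, -, he⟩
  · exact ⟨e, fun x _ => he x⟩
  · refine ⟨e, fun x hx v => ?_⟩
    rw [he x v]
    change N.act (G.parityInv x) (e v) = _
    rw [G.parityInv_of_mem hx, paritySign_zero, one_smul]

theorem IsIsoUpToParity.trace_eq {M : SuperModule G V} {N : SuperModule G W}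
    (h : M.IsIsoUpToParity N) {x : 𝔤} (hx : x ∈ G.gr 0) :
    LinearMap.trace ℂ V (M.act x) = LinearMap.trace ℂ W (N.act x) ∧
      Module.finrank ℂ V = Module.finrank ℂ W := by
  obtain ⟨e, he⟩ := h.exists_equiv
  refine ⟨?_, e.finrank_eq⟩
  rw [← LinearMap.trace_conj' _ e]
  congr 1
  refine LinearMap.ext fun w => ?_
  simp [LinearEquiv.conj_apply, he x hx]

end SuperModule

/-! ### Modules induced from characters -/

namespace LieSubsuperalgebra

variable (h : LieSubsuperalgebra G) (χ : Module.Dual ℂ 𝔤) (hχ : h.IsCharacter χ)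

/-- The module that is induced from a character. -/
abbrev charInd : SuperModule G (h.IndSpace (h.charModule χ hχ)) := h.ind (h.charModule χ hχ)

/-- The canonical generator `1 ⊗ 1` of the module that is induced from a character. -/
def charVec : h.IndSpace (h.charModule χ hχ) := (h.balanced (h.charModule χ hχ)).mkQ (1 ⊗ₜ 1)

variable {h χ} {hχ}

theorem charInd_act_mk (x : 𝔤) (a : G.Env) (c : ℂ) :
    (h.charInd χ hχ).act x ((h.balanced (h.charModule χ hχ)).mkQ (a ⊗ₜ c))
      = (h.balanced (h.charModule χ hχ)).mkQ ((G.ι x * a) ⊗ₜ c) :=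
  h.indAct_mk _ x a c

theorem charModule_act (x : h.carrier) (c : ℂ) : (h.charModule χ hχ).act x c = χ x * c := by
  change ((LinearMap.toSpanSingleton ℂ (Module.End ℂ ℂ) 1 ∘ₗ χ ∘ₗ h.carrier.subtype) x) c = _
  simp

theorem charInd_act_charVec {x : 𝔤} (hx : x ∈ h.carrier) :
    (h.charInd χ hχ).act x (h.charVec χ hχ) = χ x • h.charVec χ hχ := by
  have hmem : (1 * h.envMap (h.toLie.ι ⟨x, hx⟩)) ⊗ₜ[ℂ] (1 : ℂ)
      - (1 : G.Env) ⊗ₜ[ℂ] ((h.charModule χ hχ).envAct (h.toLie.ι ⟨x, hx⟩) 1)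
      ∈ h.balanced (h.charModule χ hχ) := Submodule.subset_span ⟨_, _, _, rfl⟩
  rw [SuperModule.envAct_ι, charModule_act, h.envMap_ι, one_mul, mul_one] at hmem
  rw [charVec, charInd_act_mk, mul_one, ← map_smul, ← sub_eq_zero, ← map_sub,
    ← TensorProduct.tmul_smul, smul_eq_mul, mul_one]
  exact (Submodule.Quotient.mk_eq_zero _).2 hmem

theorem charVec_mem : h.charVec χ hχ ∈ (h.charInd χ hχ).gr 0 := by
  change _ ∈ (Superspace.ofInvolution (h.indParity (h.charModule χ hχ))
    (h.indParity_indParity _)).gr 0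
  rw [Superspace.mem_ofInvolution, charVec, h.indParity_mk, map_one, paritySign_zero, one_smul,
    (h.charModule χ hχ).parityInv_of_mem (i := 0) (v := (1 : ℂ)), paritySign_zero, one_smul]
  change (1 : ℂ) ∈ (if (0 : ZMod 2) = 0 then (⊤ : Submodule ℂ ℂ) else ⊥)
  simp

theorem charInd_envAct_mk (a b : G.Env) (c : ℂ) :
    (h.charInd χ hχ).envAct a ((h.balanced (h.charModule χ hχ)).mkQ (b ⊗ₜ c))
      = (h.balanced (h.charModule χ hχ)).mkQ ((a * b) ⊗ₜ c) := by
  induction a using G.env_induction generalizing b with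
  | algebraMap r =>
    rw [AlgHom.commutes, Module.algebraMap_end_apply, ← map_smul, TensorProduct.smul_tmul',
      Algebra.smul_def]
  | ι x => rw [SuperModule.envAct_ι, charInd_act_mk]
  | mul a a' ha ha' =>
    rw [map_mul, Module.End.mul_apply, ha', ha, mul_assoc]
  | add a a' ha ha' =>
    rw [map_add, LinearMap.add_apply, ha, ha', ← map_add, ← TensorProduct.add_tmul, add_mul]

theorem charInd_generates {U : Submodule ℂ (h.IndSpace (h.charModule χ hχ))}
    (hU : (h.charInd χ hχ).IsInvariant U) (hv : h.charVec χ hχ ∈ U) : U = ⊤ := by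
  have key : (⊤ : Submodule ℂ (G.Env ⊗[ℂ] ℂ)) ≤ U.comap (h.balanced (h.charModule χ hχ)).mkQ := by
    rw [← TensorProduct.span_tmul_eq_top, Submodule.span_le]
    rintro _ ⟨a, c, rfl⟩
    have h1 := U.smul_mem c (hU.envAct_mem a _ hv)
    rw [charVec, charInd_envAct_mk, mul_one, ← map_smul, ← TensorProduct.tmul_smul, smul_eq_mul,
      mul_one] at h1
    exact h1
  rw [eq_top_iff]
  intro w _
  obtain ⟨t, rfl⟩ := Submodule.mkQ_surjective _ w
  exact key Submodule.mem_top

theorem charInd_hom_ext {X : Type*} [AddCommGroup X] [Module ℂ X]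
    (π : 𝔤 → X → X) {S T : h.IndSpace (h.charModule χ hχ) →ₗ[ℂ] X}
    (hS : ∀ x w, S ((h.charInd χ hχ).act x w) = π x (S w))
    (hT : ∀ x w, T ((h.charInd χ hχ).act x w) = π x (T w))
    (hST : S (h.charVec χ hχ) = T (h.charVec χ hχ)) : S = T := by
  have : LinearMap.eqLocus S T = ⊤ := by
    refine charInd_generates (fun x w hw => ?_) hST
    have hw' : S w = T w := hw
    change S _ = T _
    rw [hS, hT, hw']
  exact LinearMap.ext fun w => (this ▸ Submodule.mem_top : w ∈ LinearMap.eqLocus S T)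

variable {V : Type*} [AddCommGroup V] [Module ℂ V]

/-- Frobenius reciprocity for a character, with the tensor product given explicitly as a quotient.
-/
theorem exists_charInd_hom (N : SuperModule G V) {w : V}
    (hw : ∀ x ∈ h.carrier, N.act x w = χ x • w) :
    ∃ T : h.IndSpace (h.charModule χ hχ) →ₗ[ℂ] V, T (h.charVec χ hχ) = w ∧
      ∀ x z, T ((h.charInd χ hχ).act x z) = N.act x (T z) := by
  have key : ∀ a : h.toLie.Env,
      N.envAct (h.envMap a) w = ((h.charModule χ hχ).envAct a 1) • w := by
    intro a
    induction a using h.toLie.env_induction with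
    | algebraMap r => simp [AlgHom.commutes, Module.algebraMap_end_apply]
    | ι x =>
      rw [h.envMap_ι, SuperModule.envAct_ι, SuperModule.envAct_ι, charModule_act, mul_one]
      exact hw x x.2
    | mul a b ha hb =>
      rw [map_mul, map_mul, map_mul, Module.End.mul_apply, hb, map_smul, ha, Module.End.mul_apply,
        smul_smul]
      congr 1
      conv_rhs => rw [← mul_one ((h.charModule χ hχ).envAct b 1), ← smul_eq_mul, map_smul]
      rfl
    | add a b ha hb =>
      rw [map_add, map_add, map_add, LinearMap.add_apply, ha, hb, LinearMap.add_apply, add_smul]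
  let t : G.Env ⊗[ℂ] ℂ →ₗ[ℂ] V := TensorProduct.lift
    (LinearMap.mk₂ ℂ (fun (a : G.Env) (c : ℂ) => c • N.envAct a w)
      (fun _ _ _ => by simp)
      (fun r a c => by
        simp only [map_smul, LinearMap.smul_apply]
        exact smul_comm _ _ _)
      (fun _ _ _ => by simp [add_smul]) (fun _ _ _ => by simp [smul_smul]))
  have ht : ∀ a c, t (a ⊗ₜ c) = c • N.envAct a w := fun a c => by simp [t]
  have hker : h.balanced (h.charModule χ hχ) ≤ LinearMap.ker t := by
    rw [balanced, Submodule.span_le]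
    rintro _ ⟨a, b, c, rfl⟩
    change t _ = 0
    rw [map_sub, ht, ht, map_mul, Module.End.mul_apply, key, map_smul, smul_smul, sub_eq_zero]
    congr 1
    conv_rhs => rw [← mul_one c, ← smul_eq_mul, map_smul, smul_eq_mul]
  refine ⟨(h.balanced (h.charModule χ hχ)).liftQ t hker, ?_, fun x z => ?_⟩
  · rw [charVec, Submodule.mkQ_apply, Submodule.liftQ_apply, ht, map_one]
    simp
  · obtain ⟨z, rfl⟩ := Submodule.mkQ_surjective _ z
    induction z using TensorProduct.induction_on with
    | zero => simp
    | add a b ha hb => simp only [map_add, ha, hb]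
    | tmul a c =>
      rw [charInd_act_mk, Submodule.mkQ_apply, Submodule.mkQ_apply, Submodule.liftQ_apply,
        Submodule.liftQ_apply, ht, ht, map_mul, Module.End.mul_apply, SuperModule.envAct_ι,
        map_smul]

/-- Both composites with the parity involutions intertwine the action twisted by the parity of 𝔤,
and they agree on the even generator. -/
theorem charInd_hom_mem_gr {N : SuperModule G V}
    {T : h.IndSpace (h.charModule χ hχ) →ₗ[ℂ] V}
    (hT : ∀ x z, T ((h.charInd χ hχ).act x z) = N.act x (T z))
    (hv : T (h.charVec χ hχ) ∈ N.gr 0) :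
    ∀ i, ∀ z ∈ (h.charInd χ hχ).gr i, T z ∈ N.gr i := by
  have key : T ∘ₗ (h.charInd χ hχ).parityInv = N.parityInv ∘ₗ T := by
    refine charInd_hom_ext (fun x w => N.act (G.parityInv x) w) (fun x w => ?_) (fun x w => ?_) ?_
    · rw [LinearMap.comp_apply, SuperModule.parityInv_act, hT, LinearMap.comp_apply]
    · rw [LinearMap.comp_apply, hT, SuperModule.parityInv_act, LinearMap.comp_apply]
    · rw [LinearMap.comp_apply, LinearMap.comp_apply, Superspace.parityInv_of_mem _ charVec_mem,
        N.parityInv_of_mem hv, map_smul]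
  intro i z hz
  have h1 := LinearMap.congr_fun key z
  rw [LinearMap.comp_apply, Superspace.parityInv_of_mem _ hz, map_smul] at h1
  rw [N.mem_gr_iff]
  exact h1.symm

end LieSubsuperalgebra

/-! ### Polarizations and maximal isotropic subspaces -/

namespace LieSubsuperalgebra

variable (h : LieSubsuperalgebra G)

/-- The odd part of a subsuperalgebra. -/
def oddPart : Submodule ℂ 𝔤 := h.carrier ⊓ G.gr 1

variable {h}

theorem evenStable_oddPart (h0 : G.gr 0 ≤ h.carrier) : G.EvenStable h.oddPart :=
  fun _ hx _ hy => ⟨h.bracket_mem (h0 hx) hy.1, G.bracket_mem_of_even hx hy.2⟩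

theorem sup_oddPart (h0 : G.gr 0 ≤ h.carrier) : G.gr 0 ⊔ h.oddPart = h.carrier := by
  refine le_antisymm (sup_le h0 inf_le_left) ?_
  conv_lhs => rw [h.graded]
  exact sup_le_sup_right inf_le_right _

theorem exists_add_of_mem {x : 𝔤} (hx : x ∈ h.carrier) :
    ∃ a ∈ G.gr 0, ∃ b ∈ h.oddPart, a + b = x := by
  rw [h.graded] at hx
  obtain ⟨a, ha, b, hb, e⟩ := Submodule.mem_sup.1 hx
  exact ⟨a, ha.2, b, hb, e⟩

end LieSubsuperalgebra

namespace LieSuperalgebra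

variable {l χ : Module.Dual ℂ 𝔤} {h : LieSubsuperalgebra G}

/-- A vector that is isotropic and orthogonal to 𝔥₁ can be added to 𝔥₁, so maximality among
subspaces gives maximality tested vector by vector. -/
theorem IsPolarization.maxIsotropic (hp : G.IsPolarization l h) : G.MaxIsotropic l h.oddPart where
  le := inf_le_right
  isotropic x hx y hy := hp.bracket_eq_zero x hx.1 y hy.1
  maximal ξ hξ h0 := by
    let P : Submodule ℂ (G.gr 1) := h.carrier.comap (G.gr 1).subtype
    have hle : P ≤ P ⊔ ℂ ∙ (⟨ξ, hξ.1⟩ : G.gr 1) := le_sup_left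
    refine ⟨?_, hξ.1⟩
    refine hp.maximal_isotropic.2 ?_ hle (Submodule.mem_sup_right (Submodule.mem_span_singleton_self
      (⟨ξ, hξ.1⟩ : G.gr 1)))
    intro x hx y hy
    obtain ⟨a, ha, b, hb, rfl⟩ := Submodule.mem_sup.1 hx
    obtain ⟨a', ha', b', hb', rfl⟩ := Submodule.mem_sup.1 hy
    obtain ⟨r, rfl⟩ := Submodule.mem_span_singleton.1 hb
    obtain ⟨s, rfl⟩ := Submodule.mem_span_singleton.1 hb'
    have e1 : l (G.bracket a a') = 0 := hp.bracket_eq_zero _ ha _ ha'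
    have e2 : l (G.bracket a ξ) = 0 := hξ.2 a ⟨ha, a.2⟩
    have e3 : l (G.bracket ξ a') = 0 := by
      rw [G.bracket_comm_of_odd hξ.1 a'.2]
      exact hξ.2 a' ⟨ha', a'.2⟩
    change l (G.bracket ((a : 𝔤) + r • ξ) ((a' : 𝔤) + s • ξ)) = 0
    simp [e1, e2, e3, h0]

theorem MaxIsotropic.isPolarization (hl : l ∈ G.charSpace) (h0 : G.gr 0 ≤ h.carrier)
    (hm : G.MaxIsotropic l h.oddPart) : G.IsPolarization l h where
  bracket_eq_zero x hx y hy := by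
    obtain ⟨a, ha, b, hb, rfl⟩ := LieSubsuperalgebra.exists_add_of_mem hx
    obtain ⟨c, hc, d, hd, rfl⟩ := LieSubsuperalgebra.exists_add_of_mem hy
    simp [hl.2 a ha c hc, hl.1 _ (G.bracket_mem_of_even ha hd.2), hm.isotropic b hb d hd,
      G.bracket_skew_of_odd_even hb.2 hc, hl.1 _ (G.bracket_mem_of_even hc hb.2)]
  even_le := h0
  maximal_isotropic := by
    refine ⟨fun x hx y hy => hm.isotropic x ⟨hx, x.2⟩ y ⟨hy, y.2⟩, fun P hP hle x hx => ?_⟩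
    exact (hm.maximal x ⟨x.2, fun p hp => hP ⟨p, hp.2⟩ (hle hp.1) x hx⟩ (hP x hx x hx)).1

theorem MaxIsotropic.exists_subsuperalgebra {P : Submodule ℂ 𝔤} (hP : G.EvenStable P)
    (hm : G.MaxIsotropic l P) :
    ∃ h : LieSubsuperalgebra G, G.gr 0 ≤ h.carrier ∧ h.oddPart = P := by
  have hinf : (G.gr 0 ⊔ P) ⊓ G.gr 1 = P := by
    rw [sup_comm, sup_inf_assoc_of_le _ hm.le, G.isCompl.inf_eq_bot, sup_bot_eq]
  refine ⟨⟨G.gr 0 ⊔ P, ?_, ?_⟩, le_sup_left, hinf⟩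
  · rw [hinf, inf_eq_right.2 (le_sup_left : G.gr 0 ≤ G.gr 0 ⊔ P)]
  · intro x y hx hy
    obtain ⟨a, ha, b, hb, rfl⟩ := Submodule.mem_sup.1 hx
    obtain ⟨c, hc, d, hd, rfl⟩ := Submodule.mem_sup.1 hy
    simp only [map_add, LinearMap.add_apply]
    refine add_mem (add_mem (Submodule.mem_sup_left (G.bracket_mem_of_even ha hc)) ?_)
      (add_mem (Submodule.mem_sup_right (hP a ha d hd))
        (Submodule.mem_sup_left (G.bracket_mem_of_odd (hm.le hb) (hm.le hd))))
    rw [G.bracket_skew_of_odd_even (hm.le hb) hc]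
    exact Submodule.mem_sup_right (neg_mem (hP c hc b hb))

theorem exists_isPolarization [FiniteDimensional ℂ 𝔤] (hG : G.IsSolvable)
    (hl : l ∈ G.charSpace) : ∃ h : LieSubsuperalgebra G, G.IsPolarization l h := by
  obtain ⟨P, hP, hm⟩ := exists_maxIsotropic hG hl
  obtain ⟨h, h0, rfl⟩ := hm.exists_subsuperalgebra hP
  exact ⟨h, hm.isPolarization hl h0⟩

end LieSuperalgebra

/-! ### The functional `θ` -/

namespace LieSubsuperalgebra

variable {h : LieSubsuperalgebra G}

theorem trace_mapQ_congr {V : Type*} [AddCommGroup V] [Module ℂ V] {A B : Submodule ℂ V}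
    (e : A = B) (D : Module.End ℂ V) (hA : A ≤ A.comap D) (hB : B ≤ B.comap D) :
    LinearMap.trace ℂ _ (A.mapQ A D hA) = LinearMap.trace ℂ _ (B.mapQ B D hB) := by
  subst e
  rfl

/-- Since 𝔤₀ ⊂ 𝔥, the quotient 𝔤/𝔥 is purely odd and the supertrace is minus the trace. -/
theorem theta_eq (h0 : G.gr 0 ≤ h.carrier) {x : 𝔤} (hx : x ∈ G.gr 0) :
    h.theta h0 x = -(1 / 2) * G.quotientTrace (evenStable_oddPart h0) hx := by
  have hpar : (h.quotientModule.parityInv : Module.End ℂ (𝔤 ⧸ h.carrier)) = -1 := by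
    refine Submodule.linearMap_qext _ (LinearMap.ext fun z => ?_)
    obtain ⟨a, ha, b, hb, rfl⟩ := G.exists_add z
    have e : h.carrier.mkQ (a + b) = h.carrier.mkQ b := by
      rw [map_add, Submodule.mkQ_apply _ a, (Submodule.Quotient.mk_eq_zero _).2 (h0 ha), zero_add]
    have hb' : h.carrier.mkQ b ∈ h.quotientModule.gr 1 := ⟨b, hb, rfl⟩
    rw [LinearMap.comp_apply, LinearMap.comp_apply, e, h.quotientModule.parityInv_of_mem hb',
      paritySign_one]
    simp
  have hmul : (h.quotientModule.parityInv : Module.End ℂ (𝔤 ⧸ h.carrier))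
      * h.quotientModule.act ⟨x, h0 hx⟩ = -h.quotientModule.act ⟨x, h0 hx⟩ := by
    rw [hpar]
    exact LinearMap.ext fun z => by simp
  rw [h.theta_even h0 hx, Superspace.supertrace, LinearMap.comp_apply, LinearMap.mulLeft_apply,
    hmul, map_neg, LieSuperalgebra.quotientTrace,
    trace_mapQ_congr (sup_oddPart h0) (G.bracket x) _ (fun _ hy => h.bracket_mem (h0 hx) hy)]
  rw [mul_neg, neg_mul]
  rfl

theorem theta_mem_charSpace (h0 : G.gr 0 ≤ h.carrier) : h.theta h0 ∈ G.charSpace :=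
  ⟨fun _ hx => h.theta_odd h0 hx,
    fun x hx y hy => (h.isCharacter_theta h0).2 x (h0 hx) y (h0 hy)⟩

/-- Such an x acts nilpotently on 𝔤/𝔥, and θ is a multiple of its trace there. -/
theorem theta_eq_zero_of_nilMod [FiniteDimensional ℂ 𝔤] (h0 : G.gr 0 ≤ h.carrier) {x : 𝔤}
    (hx : x ∈ G.gr 0) (hn : G.NilMod x h.oddPart) : h.theta h0 x = 0 := by
  rw [theta_eq h0 hx]
  have hnil : IsNilpotent ((G.gr 0 ⊔ h.oddPart).mapQ (G.gr 0 ⊔ h.oddPart) (G.bracket x)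
      (G.le_comap_bracket (evenStable_oddPart h0) hx)) := by
    refine ⟨4, Submodule.linearMap_qext _ (LinearMap.ext fun z => ?_)⟩
    change (G.gr 0 ⊔ h.oddPart).mkQ (G.bracket x (G.bracket x (G.bracket x (G.bracket x z)))) = 0
    refine (Submodule.Quotient.mk_eq_zero _).2 ?_
    obtain ⟨a, ha, b, hb, rfl⟩ := G.exists_add z
    have h1 : ∀ {a}, a ∈ G.gr 0 → G.bracket x a ∈ G.gr 0 := fun ha => G.bracket_mem_of_even hx ha
    simp only [map_add]
    exact add_mem (Submodule.mem_sup_left (h1 (h1 (h1 (h1 ha))))) (Submodule.mem_sup_right (hn b hb))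
  rw [LieSuperalgebra.quotientTrace, (LinearMap.isNilpotent_trace_of_isNilpotent hnil).eq_zero, mul_zero]

end LieSubsuperalgebra

/-! ### Structure of the induced modules -/

namespace LieSuperalgebra

variable {χ : Module.Dual ℂ 𝔤} {P : Submodule ℂ 𝔤}

/-- The module on a model that is defined over the whole odd part. -/
def InducedModel.toSuperModule (M : G.InducedModel χ P (G.gr 1)) : SuperModule G M.W where
  toSuperspace := Superspace.ofInvolution M.σ M.σ_σ
  act := M.ρ
  act_mem := by
    intro i j x w hx hw
    rw [Superspace.mem_ofInvolution] at hw ⊢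
    rcases parity_cases i with rfl | rfl
    · rw [M.σ_even x hx, hw, map_smul, zero_add]
    · rw [M.σ_odd x hx, hw, map_smul, paritySign_add, paritySign_one, neg_one_mul, neg_smul]
  act_bracket := by
    intro i j x y hx hy
    refine LinearMap.ext fun w => ?_
    rcases parity_cases i with rfl | rfl
    · rw [koszulSign_zero_left, one_smul]
      rcases parity_cases j with rfl | rfl
      · exact M.isRepOn.even_even x hx y hy w
      · exact M.isRepOn.even_odd x hx y hy w
    · rcases parity_cases j with rfl | rfl
      · have h1 : koszulSign 1 0 = 1 := by simp [koszulSign]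
        rw [h1, one_smul, G.bracket_skew_of_odd_even hx hy, map_neg, LinearMap.neg_apply,
          M.isRepOn.even_odd y hy x hx w]
        simp
      · rw [koszulSign_one_one, M.isRepOn.odd_odd x hx y hy w]
        simp

end LieSuperalgebra

namespace LieSubsuperalgebra

variable {χ : Module.Dual ℂ 𝔤} {h : LieSubsuperalgebra G} {hχ : h.IsCharacter χ}

theorem act_eq_of_isWeightVector (hL : χ ∈ G.charSpace) {V : Type*} [AddCommGroup V] [Module ℂ V]
    {N : SuperModule G V} {w : V} (hw : G.IsWeightVector χ h.oddPart N.act w) :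
    ∀ x ∈ h.carrier, N.act x w = χ x • w := by
  intro x hx
  obtain ⟨a, ha, b, hb, rfl⟩ := exists_add_of_mem hx
  rw [map_add, LinearMap.add_apply, hw.even a ha, hw.odd b hb, map_add, hL.1 b hb.2, add_zero,
    add_zero]

theorem isWeightVector_charVec (h0 : G.gr 0 ≤ h.carrier) (hL : χ ∈ G.charSpace) :
    G.IsWeightVector χ h.oddPart (h.charInd χ hχ).act (h.charVec χ hχ) where
  even x hx := charInd_act_charVec (h0 hx)
  odd y hy := by rw [charInd_act_charVec hy.1, hL.1 y hy.2, zero_smul]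

/-- Both sides have the same universal property; the two resulting maps exchange the generators, so
they are mutually inverse. -/
theorem exists_equiv_model (h0 : G.gr 0 ≤ h.carrier) (hL : χ ∈ G.charSpace)
    (M : G.InducedModel χ h.oddPart (G.gr 1)) :
    ∃ e : h.IndSpace (h.charModule χ hχ) ≃ₗ[ℂ] M.W, e (h.charVec χ hχ) = M.v ∧
      ∀ x z, e ((h.charInd χ hχ).act x z) = M.ρ x (e z) := by
  obtain ⟨T, hT, hTa⟩ := exists_charInd_hom (h := h) (hχ := hχ) M.toSuperModule
    (act_eq_of_isWeightVector (N := M.toSuperModule) hL M.isWeightVector)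
  change ∀ x z, T ((h.charInd χ hχ).act x z) = M.ρ x (T z) at hTa
  obtain ⟨S, hS, hS0, hS1⟩ := M.universal _ (h.charInd χ hχ).act (h.charInd χ hχ).isRepOn _
    (isWeightVector_charVec h0 hL)
  have hSa : ∀ x w, S (M.ρ x w) = (h.charInd χ hχ).act x (S w) := by
    intro x w
    obtain ⟨a, ha, b, hb, rfl⟩ := G.exists_add x
    simp only [map_add, LinearMap.add_apply, hS0 a ha, hS1 b hb]
  have h1 : S ∘ₗ T = LinearMap.id :=
    charInd_hom_ext (fun x w => (h.charInd χ hχ).act x w)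
      (fun x w => by rw [LinearMap.comp_apply, hTa, hSa, LinearMap.comp_apply])
      (fun x w => rfl) (by rw [LinearMap.comp_apply, hT, hS, LinearMap.id_apply])
  have h2 : T ∘ₗ S = LinearMap.id := by
    have : LinearMap.eqLocus (T ∘ₗ S) LinearMap.id = ⊤ := by
      have hst : ∀ x, ∀ w ∈ LinearMap.eqLocus (T ∘ₗ S) LinearMap.id,
          M.ρ x w ∈ LinearMap.eqLocus (T ∘ₗ S) LinearMap.id := by
        intro x w hw
        have hw' : T (S w) = w := hw
        change T (S (M.ρ x w)) = M.ρ x w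
        rw [hSa, hTa, hw']
      refine M.generates _ (fun x _ => hst x) (fun y _ => hst y) ?_
      change T (S M.v) = M.v
      rw [hS, hT]
    exact LinearMap.ext fun w =>
      (this ▸ Submodule.mem_top : w ∈ LinearMap.eqLocus (T ∘ₗ S) LinearMap.id)
  exact ⟨LinearEquiv.ofLinearMap T S h2 h1, hT, hTa⟩

/-! ### Induced modules of polarizations: dimension, trace, irreducibility and type -/

section MaxIsotropic

variable [FiniteDimensional ℂ 𝔤]

theorem finiteDimensional_charInd (hG : G.IsSolvable) (h0 : G.gr 0 ≤ h.carrier)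
    (hL : χ ∈ G.charSpace) (hm : G.MaxIsotropic χ h.oddPart) :
    FiniteDimensional ℂ (h.IndSpace (h.charModule χ hχ)) := by
  obtain ⟨-, -, -, -, M, -⟩ := hm.exists_model hG hL (evenStable_oddPart h0)
  obtain ⟨e, -⟩ := exists_equiv_model (hχ := hχ) h0 hL M
  exact Module.Finite.equiv e.symm

theorem charVec_ne_zero (hG : G.IsSolvable) (h0 : G.gr 0 ≤ h.carrier)
    (hL : χ ∈ G.charSpace) (hm : G.MaxIsotropic χ h.oddPart) : h.charVec χ hχ ≠ 0 := by
  obtain ⟨-, -, -, -, M, -⟩ := hm.exists_model hG hL (evenStable_oddPart h0)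
  obtain ⟨e, he, -⟩ := exists_equiv_model (hχ := hχ) h0 hL M
  intro hv
  rw [hv, map_zero] at he
  exact M.v_ne_zero he.symm

/-- The average of the weights of the induced module. -/
theorem trace_charInd (hG : G.IsSolvable) (h0 : G.gr 0 ≤ h.carrier)
    (hL : χ ∈ G.charSpace) (hm : G.MaxIsotropic χ h.oddPart) {x : 𝔤} (hx : x ∈ G.gr 0) :
    LinearMap.trace ℂ _ ((h.charInd χ hχ).act x)
      = Module.finrank ℂ (h.IndSpace (h.charModule χ hχ)) * (χ x - h.theta h0 x) := by
  obtain ⟨-, -, -, -, M, -⟩ := hm.exists_model hG hL (evenStable_oddPart h0)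
  obtain ⟨e, -, he⟩ := exists_equiv_model (hχ := hχ) h0 hL M
  have h1 : LinearMap.trace ℂ _ ((h.charInd χ hχ).act x) = LinearMap.trace ℂ _ (M.ρ x) := by
    rw [← LinearMap.trace_conj' _ e]
    congr 1
    refine LinearMap.ext fun w => ?_
    simp [LinearEquiv.conj_apply, he]
  -- The quotient of 𝔤 by 𝔤₀ ⊕ 𝔤₁ is zero.
  have h2 : G.quotientTrace M.stable' hx = 0 := by
    have htop : G.gr 0 ⊔ G.gr 1 = ⊤ := G.isCompl.sup_eq_top
    have : (G.gr 0 ⊔ G.gr 1).mapQ (G.gr 0 ⊔ G.gr 1) (G.bracket x)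
        (G.le_comap_bracket M.stable' hx) = 0 :=
      Submodule.linearMap_qext _ (LinearMap.ext fun z =>
        (Submodule.Quotient.mk_eq_zero _).2 (htop ▸ Submodule.mem_top))
    rw [LieSuperalgebra.quotientTrace, this, map_zero]
  have h3 := M.trace x hx
  rw [h2] at h3
  rw [h1, e.finrank_eq, theta_eq h0 hx]
  linear_combination h3 / 2

theorem eigenvalue_charInd (hG : G.IsSolvable) (h0 : G.gr 0 ≤ h.carrier)
    (hL : χ ∈ G.charSpace) (hm : G.MaxIsotropic χ h.oddPart) {x : 𝔤} (hx : x ∈ G.gr 0)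
    (hn : G.NilMod x h.oddPart) {w : h.IndSpace (h.charModule χ hχ)} (hw : w ≠ 0) {a : ℂ}
    (ha : (h.charInd χ hχ).act x w = a • w) : a = χ x := by
  obtain ⟨-, -, -, -, M, -⟩ := hm.exists_model hG hL (evenStable_oddPart h0)
  obtain ⟨e, -, he⟩ := exists_equiv_model (hχ := hχ) h0 hL M
  refine M.eigenvalue x hx hn (e w) ((map_ne_zero_iff e e.injective).2 hw) a ?_
  rw [← he, ha, map_smul]

theorem exists_mem_first (hG : G.IsSolvable) (h0 : G.gr 0 ≤ h.carrier)
    (hL : χ ∈ G.charSpace) (hm : G.MaxIsotropic χ h.oddPart) :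
    ∃ ω ∈ G.orth χ h.oddPart, (G.orth χ h.oddPart ≤ h.oddPart → ω = 0) ∧
      (¬ G.orth χ h.oddPart ≤ h.oddPart →
        χ (G.bracket ω ω) ≠ 0 ∧ ∀ x ∈ G.gr 0, G.bracket x ω ∈ h.oddPart) ∧
      ∀ U, (h.charInd χ hχ).IsInvariant U → U ≠ ⊥ → ∃ u ∈ U, u ≠ 0 ∧
        ∃ a b : ℂ, u = a • h.charVec χ hχ + b • (h.charInd χ hχ).act ω (h.charVec χ hχ) := by
  obtain ⟨ω, hω, hω0, hω1, M, F, hF⟩ := hm.exists_model hG hL (evenStable_oddPart h0)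
  obtain ⟨e, hev, he⟩ := exists_equiv_model (hχ := hχ) h0 hL M
  refine ⟨ω, hω, hω0, hω1, fun U hU hU0 => ?_⟩
  obtain ⟨_, ⟨u, hu, rfl⟩, hu0, hu1⟩ := hF.exists_mem_first (U := U.map e.toLinearMap) (by
    rintro ζ - _ ⟨u, hu, rfl⟩
    exact ⟨_, hU ζ u hu, he ζ u⟩) (fun hb => hU0 (Submodule.map_eq_bot_iff.1 hb))
  obtain ⟨a, b, hab⟩ := hF.first _ hu1
  refine ⟨u, hu, fun h => hu0 (by rw [h, map_zero]), a, b, e.injective ?_⟩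
  rw [map_add, map_smul, map_smul, he, hev]
  exact hab

theorem isGType_charInd (hG : G.IsSolvable) (h0 : G.gr 0 ≤ h.carrier)
    (hL : χ ∈ G.charSpace) (hm : G.MaxIsotropic χ h.oddPart)
    (hd : G.orth χ h.oddPart ≤ h.oddPart) : (h.charInd χ hχ).IsGType := by
  refine ⟨⟨⟨_, 0, charVec_ne_zero hG h0 hL hm⟩⟩, fun U hU => or_iff_not_imp_left.2 fun hU0 => ?_⟩
  obtain ⟨ω, -, hω, -, hfirst⟩ := exists_mem_first (hχ := hχ) hG h0 hL hm
  obtain ⟨u, hu, hu0, a, b, e⟩ := hfirst U hU hU0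
  rw [hω hd, map_zero, LinearMap.zero_apply, smul_zero, add_zero] at e
  have ha : a ≠ 0 := fun ha => hu0 (by rw [e, ha, zero_smul])
  refine charInd_generates hU ?_
  rw [e] at hu
  exact (Submodule.smul_mem_iff _ ha).1 hu

/-- When ω is present, gradedness separates a v + b ωv into its two parts, and ω² v is a nonzero
multiple of v; either part therefore yields v. -/
theorem isIrreducible_charInd (hG : G.IsSolvable) (h0 : G.gr 0 ≤ h.carrier)
    (hL : χ ∈ G.charSpace) (hm : G.MaxIsotropic χ h.oddPart) :
    (h.charInd χ hχ).IsIrreducible := by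
  refine ⟨⟨⟨_, 0, charVec_ne_zero hG h0 hL hm⟩⟩,
    fun U hU hUg => or_iff_not_imp_left.2 fun hU0 => ?_⟩
  by_cases hd : G.orth χ h.oddPart ≤ h.oddPart
  · exact ((isGType_charInd hG h0 hL hm hd).2 U hU).resolve_left hU0
  obtain ⟨ω, hω, -, hω1, hfirst⟩ := exists_mem_first (hχ := hχ) hG h0 hL hm
  obtain ⟨hωω, -⟩ := hω1 hd
  obtain ⟨u, hu, hu0, a, b, e⟩ := hfirst U hU hU0
  have hωv : (h.charInd χ hχ).act ω (h.charVec χ hχ) ∈ (h.charInd χ hχ).gr 1 := by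
    simpa using (h.charInd χ hχ).act_mem hω.1 (charVec_mem (hχ := hχ))
  have hu' := ((h.charInd χ hχ).isGraded_iff.1 hUg) u hu
  rw [e] at hu hu'
  rw [map_add, map_smul, map_smul, Superspace.parityInv_of_mem _ charVec_mem,
    Superspace.parityInv_of_mem _ hωv, paritySign_zero, paritySign_one] at hu'
  refine charInd_generates hU ?_
  by_cases ha : a = 0
  · have hb : b ≠ 0 := fun hb => hu0 (by rw [e, ha, hb]; simp)
    rw [ha, zero_smul, zero_add, Submodule.smul_mem_iff _ hb] at hu
    have h1 := hU ω _ hu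
    have h2 := (h.charInd χ hχ).act_odd hω.1 hω.1 (h.charVec χ hχ)
    rw [charInd_act_charVec (h0 (G.bracket_mem_of_odd hω.1 hω.1)), ← two_smul ℂ] at h2
    rw [← Submodule.smul_mem_iff _ hωω, h2]
    exact U.smul_mem _ h1
  · have h1 := add_mem hu hu'
    have h2 : a • h.charVec χ hχ + b • (h.charInd χ hχ).act ω (h.charVec χ hχ)
        + (a • (1 : ℂ) • h.charVec χ hχ + b • (-1 : ℂ) • (h.charInd χ hχ).act ω (h.charVec χ hχ))
        = (2 * a) • h.charVec χ hχ := by module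
    rw [h2] at h1
    exact (Submodule.smul_mem_iff _ (mul_ne_zero two_ne_zero ha)).1 h1

/-- ωv is again a weight vector for χ, so v ↦ ωv extends to an endomorphism J, odd but commuting
with the action without signs. J² is a nonzero scalar s², and ker(J − s) is a proper nonzero
invariant subspace. -/
theorem isQType_charInd (hG : G.IsSolvable) (h0 : G.gr 0 ≤ h.carrier)
    (hL : χ ∈ G.charSpace) (hm : G.MaxIsotropic χ h.oddPart)
    (hd : ¬ G.orth χ h.oddPart ≤ h.oddPart) : (h.charInd χ hχ).IsQType := by
  refine ⟨isIrreducible_charInd hG h0 hL hm, ?_⟩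
  obtain ⟨ω, hω, -, hω1, -⟩ := exists_mem_first (hχ := hχ) hG h0 hL hm
  obtain ⟨hωω, hωe⟩ := hω1 hd
  set I := h.charInd χ hχ
  set v := h.charVec χ hχ
  have hv0 : v ≠ 0 := charVec_ne_zero hG h0 hL hm
  have hv : v ∈ I.gr 0 := charVec_mem
  have hωv : I.act ω v ∈ I.gr 1 := by
    simpa using I.act_mem hω.1 hv
  have hvw := isWeightVector_charVec (hχ := hχ) h0 hL
  have hwt : G.IsWeightVector χ h.oddPart I.act (I.act ω v) := by
    refine ⟨fun x hx => ?_, fun y hy => ?_⟩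
    · have h1 := I.act_even hx hω.1 v
      rw [hvw.odd _ (hωe x hx), hvw.even x hx, map_smul] at h1
      exact sub_eq_zero.1 h1.symm
    · have h1 := I.act_odd hy.2 hω.1 v
      rw [hvw.odd y hy, map_zero, add_zero, hvw.even _ (G.bracket_mem_of_odd hy.2 hω.1),
        hω.2 y hy, zero_smul] at h1
      exact h1.symm
  obtain ⟨J, hJ, hJa⟩ := exists_charInd_hom (hχ := hχ) I (act_eq_of_isWeightVector hL hwt)
  have hωωv : I.act ω (I.act ω v) = (χ (G.bracket ω ω) / 2) • v := by
    have h1 := I.act_odd hω.1 hω.1 v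
    rw [hvw.even _ (G.bracket_mem_of_odd hω.1 hω.1)] at h1
    linear_combination (norm := module) (-1 / 2 : ℂ) • h1
  obtain ⟨s, hs⟩ := IsAlgClosed.exists_pow_nat_eq (χ (G.bracket ω ω) / 2) (n := 2) two_pos
  have hs0 : s ≠ 0 := by
    rintro rfl
    refine hωω ?_
    have : χ (G.bracket ω ω) / 2 = 0 := by rw [← hs]; simp
    simpa using this
  have hJJ : J ∘ₗ J = (s ^ 2) • LinearMap.id := by
    refine charInd_hom_ext (fun x w => I.act x w) (fun x w => ?_) (fun x w => ?_) ?_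
    · rw [LinearMap.comp_apply, hJa, hJa, LinearMap.comp_apply]
    · simp only [LinearMap.smul_apply, LinearMap.id_apply, map_smul]
      rfl
    · rw [LinearMap.comp_apply, hJ, hJa, hJ, hωωv, hs]
      rfl
  have hne : ∀ t : ℂ, t ≠ 0 → I.act ω v ≠ t • v := by
    intro t ht e
    have h1 : t • v ∈ I.gr 1 := e ▸ hωv
    rw [Submodule.smul_mem_iff _ ht] at h1
    exact hv0 (Submodule.disjoint_def.1 I.isCompl.disjoint v hv h1)
  refine ⟨LinearMap.ker (J - s • LinearMap.id), fun x w hw => ?_, fun hbot => ?_, fun htop => ?_⟩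
  · rw [LinearMap.mem_ker, LinearMap.sub_apply, sub_eq_zero] at hw ⊢
    rw [hJa, hw]
    simp
  -- (J − s)(J + s) = 0 puts this vector in the kernel; it is nonzero because Jv is odd and s v is
  -- even and nonzero.
  · have h1 : J v + s • v ∈ LinearMap.ker (J - s • LinearMap.id) := by
      have h2 := LinearMap.congr_fun hJJ v
      simp only [LinearMap.comp_apply, LinearMap.smul_apply, LinearMap.id_apply] at h2
      simp only [LinearMap.mem_ker, LinearMap.sub_apply, LinearMap.smul_apply, LinearMap.id_apply,
        map_add, map_smul, h2]
      module
    rw [hbot, Submodule.mem_bot, hJ] at h1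
    exact hne (-s) (neg_ne_zero.2 hs0) (by rw [neg_smul]; exact eq_neg_of_add_eq_zero_left h1)
  · have h1 : v ∈ LinearMap.ker (J - s • LinearMap.id) := htop ▸ Submodule.mem_top
    rw [LinearMap.mem_ker, LinearMap.sub_apply, hJ, sub_eq_zero] at h1
    exact hne s hs0 h1

end MaxIsotropic

end LieSubsuperalgebra

/-! ### Irreducible modules are induced -/

namespace LieSuperalgebra

theorem charSpace_ext {l m : Module.Dual ℂ 𝔤} (hl : l ∈ G.charSpace) (hm : m ∈ G.charSpace)
    (h : ∀ x ∈ G.gr 0, l x = m x) : l = m := by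
  refine G.linearMap_ext fun i x hx => ?_
  rcases parity_cases i with rfl | rfl
  · exact h x hx
  · rw [hl.1 x hx, hm.1 x hx]

end LieSuperalgebra

namespace SuperModule

variable {V : Type*} [AddCommGroup V] [Module ℂ V] {M : SuperModule G V}

theorem IsIrreducible.parityChange (h : M.IsIrreducible) : M.parityChange.IsIrreducible := by
  refine ⟨h.1, fun U hU hUg => h.2 U (fun x v hv => ?_) ?_⟩
  · have h1 : M.act (G.parityInv (G.parityInv x)) v ∈ U := hU (G.parityInv x) v hv
    rwa [G.parityInv_parityInv] at h1
  · have h2 : (1 + 1 : ZMod 2) = 0 := by decide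
    have h3 : U = (U ⊓ M.gr (0 + 1)) ⊔ (U ⊓ M.gr (1 + 1)) := hUg
    rw [h2, zero_add, sup_comm] at h3
    exact h3

theorem isWeightVector_parityChange {χ : Module.Dual ℂ 𝔤} {P : Submodule ℂ 𝔤} (hP : P ≤ G.gr 1)
    {w : V} (hw : G.IsWeightVector χ P M.act w) :
    G.IsWeightVector χ P M.parityChange.act w where
  even x hx := by
    change M.act (G.parityInv x) w = _
    rw [G.parityInv_of_mem hx, paritySign_zero, one_smul, hw.even x hx]
  odd y hy := by
    change M.act (G.parityInv y) w = _
    rw [G.parityInv_of_mem (hP hy), map_smul, LinearMap.smul_apply, hw.odd y hy, smul_zero]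

theorem isotropic_of_isWeightVector {χ : Module.Dual ℂ 𝔤} {P : Submodule ℂ 𝔤} (hP : P ≤ G.gr 1)
    {w : V} (hw0 : w ≠ 0) (hw : G.IsWeightVector χ P M.act w) :
    ∀ x ∈ P, ∀ y ∈ P, χ (G.bracket x y) = 0 := by
  intro x hx y hy
  have h := M.act_odd (hP hx) (hP hy) w
  rw [hw.even _ (G.bracket_mem_of_odd (hP hx) (hP hy)), hw.odd x hx, hw.odd y hy, map_zero,
    map_zero, add_zero] at h
  exact (smul_eq_zero.1 h).resolve_right hw0

/-- Even elements preserve both components of V, so each homogeneous part of a weight vector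
satisfies the same weight equation. -/
theorem exists_homogeneous_weight_vector [FiniteDimensional ℂ V] [Nontrivial V]
    (hG : G.IsSolvable) [FiniteDimensional ℂ 𝔤] (M : SuperModule G V) :
    ∃ μ ∈ G.charSpace, ∃ i, ∃ w ∈ M.gr i, w ≠ 0 ∧ ∀ x ∈ G.gr 0, M.act x w = μ x • w := by
  obtain ⟨μ, hμ, w, hw0, hw⟩ := G.exists_weight_vector hG M.act
    (fun x hx y hy w => M.act_even hx hy w)
  obtain ⟨a, ha, b, hb, rfl⟩ := M.exists_add w
  have key : ∀ x ∈ G.gr 0, M.act x a = μ x • a ∧ M.act x b = μ x • b := by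
    intro x hx
    have h1 := hw x hx
    rw [map_add, smul_add] at h1
    have h2 : M.act x a - μ x • a = -(M.act x b - μ x • b) := by
      linear_combination (norm := module) h1
    have h3 : M.act x a - μ x • a = 0 := by
      refine Submodule.disjoint_def.1 M.isCompl.disjoint _
        (sub_mem (M.act_even_mem hx ha) (Submodule.smul_mem _ _ ha)) ?_
      rw [h2]
      exact neg_mem (sub_mem (M.act_even_mem hx hb) (Submodule.smul_mem _ _ hb))
    rw [h3] at h2
    exact ⟨sub_eq_zero.1 h3, sub_eq_zero.1 (neg_eq_zero.1 h2.symm)⟩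
  by_cases h0 : a = 0
  · exact ⟨μ, hμ, 1, b, hb, fun hb0 => hw0 (by rw [h0, hb0, add_zero]), fun x hx => (key x hx).2⟩
  · exact ⟨μ, hμ, 0, a, ha, h0, fun x hx => (key x hx).1⟩

/-- A homogeneous weight vector for `P` yields one for `P ⊕ ℂ ζ`. -/
theorem exists_weight_vector_sup {μ : Module.Dual ℂ 𝔤} (hμ : μ ∈ G.charSpace)
    {P : Submodule ℂ 𝔤} (hP : P ≤ G.gr 1) {i : ZMod 2} {w : V} (hwi : w ∈ M.gr i) (hw0 : w ≠ 0)
    (hw : G.IsWeightVector μ P M.act w) {ζ : 𝔤} (hζ : ζ ∈ G.gr 1)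
    (hζe : ∀ x ∈ G.gr 0, ∃ c : ℂ, G.bracket x ζ - c • ζ ∈ P)
    (hPζ : ∀ p ∈ P, μ (G.bracket p ζ) = 0) (hζζ : μ (G.bracket ζ ζ) = 0) :
    ∃ μ ∈ G.charSpace, ∃ i, ∃ w ∈ M.gr i, w ≠ 0 ∧ G.IsWeightVector μ (P ⊔ ℂ ∙ ζ) M.act w := by
  have hsup : ∀ {w}, (∀ p ∈ P, M.act p w = 0) → M.act ζ w = 0 →
      ∀ y ∈ P ⊔ ℂ ∙ ζ, M.act y w = 0 := by
    intro w h1 h2 y hy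
    obtain ⟨p, hp, q, hq, rfl⟩ := Submodule.mem_sup.1 hy
    obtain ⟨s, rfl⟩ := Submodule.mem_span_singleton.1 hq
    simp [h1 p hp, h2]
  by_cases h0 : M.act ζ w = 0
  · exact ⟨μ, hμ, i, w, hwi, hw0, hw.even, hsup hw.odd h0⟩
  -- If ζw ≠ 0, it replaces w, with weight μ shifted by the weight of ζ modulo P. It is killed by P
  -- and by ζ because μ([p,ζ]) = 0 and ζ²w = ½ μ([ζ,ζ]) w = 0.
  have he : ∀ x ∈ G.gr 0, ∃ c : ℂ, M.act x (M.act ζ w) = c • M.act ζ w := by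
    intro x hx
    obtain ⟨c, hc⟩ := hζe x hx
    have h1 := hw.odd _ hc
    have h2 := M.act_even hx hζ w
    rw [map_sub, map_smul, LinearMap.sub_apply, LinearMap.smul_apply] at h1
    rw [hw.even x hx, map_smul] at h2
    exact ⟨c + μ x, by linear_combination (norm := module) h1 - h2⟩
  obtain ⟨ν, hν, hν'⟩ := G.exists_weight_of_eigenvector M.act
    (fun x hx y hy w => M.act_even hx hy w) h0 he
  refine ⟨ν, hν, 1 + i, M.act ζ w, M.act_mem hζ hwi, h0, hν', hsup (fun p hp => ?_) ?_⟩
  · have h1 := M.act_odd (hP hp) hζ w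
    rw [hw.even _ (G.bracket_mem_of_odd (hP hp) hζ), hPζ p hp, zero_smul, hw.odd p hp, map_zero,
      add_zero] at h1
    exact h1.symm
  · have h1 := M.act_odd hζ hζ w
    rw [hw.even _ (G.bracket_mem_of_odd hζ hζ), hζζ, zero_smul] at h1
    linear_combination (norm := module) (-1 / 2 : ℂ) • h1

/-- P is chosen maximal inside T with the weight free to vary, since enlarging P may change μ. T =
𝔤₁ serves exhaustion, and T = 𝔱₁ the comparison of polarizations. -/
theorem exists_maximal_weight_vector [FiniteDimensional ℂ V] [Nontrivial V]
    (hG : G.IsSolvable) [FiniteDimensional ℂ 𝔤] (M : SuperModule G V) {T : Submodule ℂ 𝔤}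
    (hT : T ≤ G.gr 1) :
    ∃ P ≤ T, G.EvenStable P ∧ ∃ μ ∈ G.charSpace, ∃ i, ∃ w ∈ M.gr i, w ≠ 0 ∧
      G.IsWeightVector μ P M.act w ∧ ∀ ζ ∈ T, ζ ∉ P →
        (∀ x ∈ G.gr 0, ∃ c : ℂ, G.bracket x ζ - c • ζ ∈ P) →
          (∀ p ∈ P, μ (G.bracket p ζ) = 0) → μ (G.bracket ζ ζ) ≠ 0 := by
  let S : Set (Submodule ℂ 𝔤) := {P | P ≤ T ∧ G.EvenStable P ∧ ∃ μ ∈ G.charSpace, ∃ i,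
    ∃ w ∈ M.gr i, w ≠ 0 ∧ G.IsWeightVector μ P M.act w}
  have hS : S.Nonempty := by
    obtain ⟨μ, hμ, i, w, hw, hw0, hwe⟩ := M.exists_homogeneous_weight_vector hG
    exact ⟨⊥, bot_le, G.evenStable_bot, μ, hμ, i, w, hw, hw0, hwe, fun y hy => by
      simp [(Submodule.mem_bot ℂ).1 hy]⟩
  obtain ⟨P, ⟨hPT, hP, μ, hμ, i, w, hw, hw0, hwv⟩, hmax⟩ :=
    WellFounded.has_min (wellFounded_gt (α := Submodule ℂ 𝔤)) S hS
  refine ⟨P, hPT, hP, μ, hμ, i, w, hw, hw0, hwv, fun ζ hζ hζP hζe hPζ hζζ => ?_⟩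
  refine hmax (P ⊔ ℂ ∙ ζ) ⟨?_, ?_, ?_⟩ ?_
  · exact sup_le hPT ((Submodule.span_singleton_le_iff_mem _ _).2 hζ)
  · refine hP.sup_span fun x hx => ?_
    obtain ⟨c, hc⟩ := hζe x hx
    exact Submodule.mem_sup.2 ⟨_, hc, c • ζ,
      Submodule.smul_mem _ _ (Submodule.mem_span_singleton_self ζ), by simp⟩
  · exact exists_weight_vector_sup hμ (hPT.trans hT) hw hw0 hwv (hT hζ) hζe hPζ hζζ
  · refine lt_of_le_of_ne le_sup_left fun h => hζP ?_
    rw [h]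
    exact Submodule.mem_sup_right (Submodule.mem_span_singleton_self ζ)

end SuperModule

/-! ### Recognizing induced modules by a weight vector -/

namespace LieSubsuperalgebra

variable [FiniteDimensional ℂ 𝔤] {χ : Module.Dual ℂ 𝔤} {h : LieSubsuperalgebra G}
  {hχ : h.IsCharacter χ} {V : Type*} [AddCommGroup V] [Module ℂ V] {N : SuperModule G V}

/-- Schur's lemma for the Frobenius map: it is even, so its kernel and range are graded and
invariant. -/
theorem isIso_charInd (hG : G.IsSolvable) (h0 : G.gr 0 ≤ h.carrier) (hL : χ ∈ G.charSpace)
    (hm : G.MaxIsotropic χ h.oddPart) (hN : N.IsIrreducible) {w : V} (hwi : w ∈ N.gr 0)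
    (hw0 : w ≠ 0) (hw : G.IsWeightVector χ h.oddPart N.act w) : N.IsIso (h.charInd χ hχ) := by
  obtain ⟨T, hT, hTa⟩ := exists_charInd_hom (hχ := hχ) N (act_eq_of_isWeightVector hL hw)
  have hgr := charInd_hom_mem_gr hTa (hT ▸ hwi)
  have hpar : ∀ z, T ((h.charInd χ hχ).parityInv z) = N.parityInv (T z) := by
    have : T ∘ₗ (h.charInd χ hχ).parityInv = N.parityInv ∘ₗ T :=
      (h.charInd χ hχ).linearMap_ext fun i z hz => by
        rw [LinearMap.comp_apply, LinearMap.comp_apply, Superspace.parityInv_of_mem _ hz,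
          N.parityInv_of_mem (hgr i z hz), map_smul]
    exact LinearMap.congr_fun this
  have hker : LinearMap.ker T = ⊥ := by
    refine ((isIrreducible_charInd (hχ := hχ) hG h0 hL hm).2 _ (fun x z hz => ?_)
      ((SuperModule.isGraded_iff _).2 fun z hz => ?_)).resolve_right fun htop => ?_
    · rw [LinearMap.mem_ker] at hz ⊢
      rw [hTa, hz, map_zero]
    · rw [LinearMap.mem_ker] at hz ⊢
      rw [hpar, hz, map_zero]
    · have h1 : h.charVec χ hχ ∈ LinearMap.ker T := htop ▸ Submodule.mem_top
      rw [LinearMap.mem_ker, hT] at h1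
      exact hw0 h1
  have hran : LinearMap.range T = ⊤ := by
    refine (hN.2 _ ?_ ((SuperModule.isGraded_iff _).2 ?_)).resolve_left fun hbot => ?_
    · rintro x _ ⟨z, rfl⟩
      exact ⟨_, hTa x z⟩
    · rintro _ ⟨z, rfl⟩
      exact ⟨_, hpar z⟩
    · have h1 : w ∈ LinearMap.range T := ⟨_, hT⟩
      rw [hbot] at h1
      exact hw0 h1
  exact SuperModule.IsIso.symm
    ⟨LinearEquiv.ofBijective T ⟨LinearMap.ker_eq_bot.1 hker, LinearMap.range_eq_top.1 hran⟩,
      hgr, hTa⟩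

theorem isIsoUpToParity_charInd (hG : G.IsSolvable) (h0 : G.gr 0 ≤ h.carrier)
    (hL : χ ∈ G.charSpace) (hm : G.MaxIsotropic χ h.oddPart) (hN : N.IsIrreducible) {i : ZMod 2}
    {w : V} (hwi : w ∈ N.gr i) (hw0 : w ≠ 0) (hw : G.IsWeightVector χ h.oddPart N.act w) :
    N.IsIsoUpToParity (h.charInd χ hχ) := by
  rcases parity_cases i with rfl | rfl
  · exact Or.inl (isIso_charInd hG h0 hL hm hN hwi hw0 hw)
  · have hwi' : w ∈ N.parityChange.gr 0 := by
      change w ∈ N.gr (0 + 1)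
      rwa [zero_add]
    have h1 := isIso_charInd (hχ := hχ) hG h0 hL hm hN.parityChange hwi' hw0
      (SuperModule.isWeightVector_parityChange hm.le hw)
    exact Or.inr (N.parityChange_parityChange_isIso.symm.trans h1.parityChange)

end LieSubsuperalgebra

/-! ### Twisting by θ, the trace invariant and independence of the polarization -/

namespace LieSuperalgebra

variable {l : Module.Dual ℂ 𝔤} {h t : LieSubsuperalgebra G}

theorem IsPolarization.theta_mem (hp : G.IsPolarization l h) : hp.theta ∈ G.charSpace :=
  LieSubsuperalgebra.theta_mem_charSpace hp.even_le

variable [FiniteDimensional ℂ 𝔤]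

theorem IsPolarization.theta_eq_zero (hp : G.IsPolarization l h) {x : 𝔤} (hx : x ∈ G.gr 0)
    (hn : G.NilMod x (G.orth l (G.gr 1))) : hp.theta x = 0 :=
  LieSubsuperalgebra.theta_eq_zero_of_nilMod hp.even_le hx (hn.mono hp.maxIsotropic.orth_le)

theorem IsPolarization.add_theta (hG : G.IsSolvable) (hl : l ∈ G.charSpace)
    (hp : G.IsPolarization l h) : G.IsPolarization (l + hp.theta) h := by
  have hL := add_mem hl hp.theta_mem
  refine MaxIsotropic.isPolarization hL hp.even_le (hp.maxIsotropic.perturb hG hl hL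
    (LieSubsuperalgebra.evenStable_oddPart hp.even_le) fun x hx hn => ?_)
  rw [LinearMap.add_apply, hp.theta_eq_zero hx hn, add_zero]

theorem IsPolarization.sub_theta (hG : G.IsSolvable) (hl : l ∈ G.charSpace)
    (hp : G.IsPolarization l h) : G.IsPolarization (l - hp.theta) h := by
  have hL := sub_mem hl hp.theta_mem
  refine MaxIsotropic.isPolarization hL hp.even_le (hp.maxIsotropic.perturb hG hl hL
    (LieSubsuperalgebra.evenStable_oddPart hp.even_le) fun x hx hn => ?_)
  rw [LinearMap.sub_apply, hp.theta_eq_zero hx hn, sub_zero]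

theorem exists_isIsoUpToParity_charInd (hG : G.IsSolvable) {V : Type*} [AddCommGroup V]
    [Module ℂ V] [FiniteDimensional ℂ V] {M : SuperModule G V} (hM : M.IsIrreducible) :
    ∃ χ ∈ G.charSpace, ∃ h : LieSubsuperalgebra G, G.IsPolarization χ h ∧
      ∀ hχ : h.IsCharacter χ, M.IsIsoUpToParity (h.charInd χ hχ) := by
  have := hM.1
  obtain ⟨P, hP1, hP, μ, hμ, i, w, hwi, hw0, hw, hmax⟩ :=
    M.exists_maximal_weight_vector hG (T := G.gr 1) le_rfl
  have hm : G.MaxIsotropic μ P := by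
    by_contra hnot
    obtain ⟨ζ, hζ, hζP, hζζ, hζe⟩ := exists_isotropic_extension hG hμ hP1 hP
      (SuperModule.isotropic_of_isWeightVector hP1 hw0 hw) hnot
    exact hmax ζ hζ.1 hζP hζe hζ.2 hζζ
  obtain ⟨h, h0, rfl⟩ := hm.exists_subsuperalgebra hP
  exact ⟨μ, hμ, h, hm.isPolarization hμ h0, fun hχ =>
    LieSubsuperalgebra.isIsoUpToParity_charInd hG h0 hμ hm hM hwi hw0 hw⟩

/-- Compare the traces of even elements and divide by the common dimension, which is nonzero. -/
theorem eq_of_isIsoUpToParity (hG : G.IsSolvable) {χ ψ : Module.Dual ℂ 𝔤}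
    (hχL : χ ∈ G.charSpace) (hψL : ψ ∈ G.charSpace) (hp : G.IsPolarization χ h)
    (ht : G.IsPolarization ψ t) {hχ : h.IsCharacter χ} {hψ : t.IsCharacter ψ}
    (hiso : (h.charInd χ hχ).IsIsoUpToParity (t.charInd ψ hψ)) :
    χ - hp.theta = ψ - ht.theta := by
  refine charSpace_ext (sub_mem hχL hp.theta_mem) (sub_mem hψL ht.theta_mem) fun x hx => ?_
  obtain ⟨h1, h2⟩ := hiso.trace_eq hx
  have hv := LieSubsuperalgebra.charVec_ne_zero (hχ := hψ) hG ht.even_le hψL ht.maxIsotropic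
  have hfd := LieSubsuperalgebra.finiteDimensional_charInd (hχ := hψ) hG ht.even_le hψL
    ht.maxIsotropic
  have hnt : Nontrivial (t.IndSpace (t.charModule ψ hψ)) := ⟨⟨_, 0, hv⟩⟩
  rw [LieSubsuperalgebra.trace_charInd hG hp.even_le hχL hp.maxIsotropic hx,
    LieSubsuperalgebra.trace_charInd hG ht.even_le hψL ht.maxIsotropic hx, h2] at h1
  have hn : (Module.finrank ℂ (t.IndSpace (t.charModule ψ hψ)) : ℂ) ≠ 0 :=
    Nat.cast_ne_zero.2 Module.finrank_pos.ne'
  simpa using mul_left_cancel₀ hn h1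

/-- The twisted induced modules do not depend on the polarization. -/
theorem isIsoUpToParity_charInd_add_theta (hG : G.IsSolvable) {χ ψ : Module.Dual ℂ 𝔤}
    (hl : l ∈ G.charSpace) (hp : G.IsPolarization l h) (ht : G.IsPolarization l t)
    (hχl : χ = l + hp.theta) (hψl : ψ = l + ht.theta) {hχ : h.IsCharacter χ}
    {hψ : t.IsCharacter ψ} : (h.charInd χ hχ).IsIsoUpToParity (t.charInd ψ hψ) := by
  have hχp : G.IsPolarization χ h := hχl ▸ hp.add_theta hG hl
  have hχL : χ ∈ G.charSpace := hχl ▸ add_mem hl hp.theta_mem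
  have hψL : ψ ∈ G.charSpace := hψl ▸ add_mem hl ht.theta_mem
  have hts := LieSubsuperalgebra.evenStable_oddPart ht.even_le
  have hfd := LieSubsuperalgebra.finiteDimensional_charInd (hχ := hχ) hG hχp.even_le hχL
    hχp.maxIsotropic
  have hirr := LieSubsuperalgebra.isIrreducible_charInd (hχ := hχ) hG hχp.even_le hχL
    hχp.maxIsotropic
  have hnt := hirr.1
  obtain ⟨P, hPT, hP, μ, hμ, i, w, hwi, hw0, hw, hmax⟩ :=
    (h.charInd χ hχ).exists_maximal_weight_vector hG (T := t.oddPart) ht.maxIsotropic.le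
  -- A nil x has λ(x) as its only eigenvalue on the module, because θ_𝔥 vanishes on it; so any
  -- weight μ occurring there agrees with l on nil elements.
  have hμl : ∀ x ∈ G.gr 0, G.NilMod x (G.orth l (G.gr 1)) → μ x = l x := by
    intro x hx hn
    rw [LieSubsuperalgebra.eigenvalue_charInd hG hχp.even_le hχL hχp.maxIsotropic hx
      (hn.mono hp.maxIsotropic.orth_le) hw0 (hw.even x hx), hχl, LinearMap.add_apply,
      hp.theta_eq_zero hx hn, add_zero]
  have hiso : ∀ a ∈ t.oddPart, ∀ b ∈ t.oddPart, μ (G.bracket a b) = 0 := by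
    intro a ha b hb
    rw [hμl _ (G.bracket_mem_of_odd ha.2 hb.2) (nilMod_bracket hl hts ht.maxIsotropic ha hb)]
    exact ht.maxIsotropic.isotropic a ha b hb
  -- Brackets within 𝔱₁ are nil, so 𝔱₁ is isotropic for μ and nothing obstructs enlarging P up to
  -- 𝔱₁.
  obtain rfl : P = t.oddPart := by
    refine le_antisymm hPT ?_
    by_contra hnot
    obtain ⟨ζ, hζ, hζP, hζe⟩ := exists_eigenvector_mod hG hP hts hnot
    exact hmax ζ hζ hζP hζe (fun p hp => hiso p (hPT hp) ζ hζ) (hiso ζ hζ ζ hζ)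
  have hμm : G.MaxIsotropic μ t.oddPart := ht.maxIsotropic.perturb hG hl hμ hts hμl
  have hμp := hμm.isPolarization hμ ht.even_le
  have h1 := LieSubsuperalgebra.isIsoUpToParity_charInd (hχ := hμp.isCharacter hμ) hG ht.even_le
    hμ hμm hirr hwi hw0 hw
  -- The module is now Ind_𝔱(μ), and the trace invariant gives l = μ − θ_𝔱.
  obtain rfl : μ = ψ := by
    have h2 : χ - hp.theta = μ - ht.theta := eq_of_isIsoUpToParity hG hχL hμ hχp hμp h1
    rw [hχl, add_sub_cancel_right] at h2
    rw [hψl]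
    exact (eq_sub_iff_add_eq.1 h2).symm
  exact h1

end LieSuperalgebra

/-! ### The parity of the rank -/

namespace LieSuperalgebra

variable [FiniteDimensional ℂ 𝔤] {l : Module.Dual ℂ 𝔤} {P : Submodule ℂ 𝔤}

/-- Since P contains the radical, dim P + dim P^⊥ = dim 𝔤₁ + dim rad, and the rank is dim 𝔤₁ − dim
rad. -/
theorem MaxIsotropic.finrank_eq (hm : G.MaxIsotropic l P) :
    G.oddRank l + Module.finrank ℂ P + Module.finrank ℂ (G.orth l P)
      = 2 * Module.finrank ℂ (G.gr 1) := by
  have hsymm : ∀ x y, G.oddForm l x y = G.oddForm l y x := fun x y =>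
    congrArg l (G.bracket_comm_of_odd x.2 y.2)
  have h1 := LinearMap.BilinForm.finrank_add_finrank_orthogonal' (B := G.oddForm l)
    (P.comap (G.gr 1).subtype)
  have hker : P.comap (G.gr 1).subtype ⊓ LinearMap.ker (G.oddForm l)
      = LinearMap.ker (G.oddForm l) := by
    refine inf_eq_right.2 fun x hx => ?_
    refine hm.orth_le ⟨x.2, fun p hp => ?_⟩
    have h2 : G.oddForm l ⟨p, hp⟩ x = 0 := by
      rw [hsymm, LinearMap.mem_ker.1 hx, LinearMap.zero_apply]
    exact h2
  have horth : (G.oddForm l).orthogonal (P.comap (G.gr 1).subtype)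
      = (G.orth l P).comap (G.gr 1).subtype := by
    ext x
    rw [LinearMap.BilinForm.mem_orthogonal_iff]
    exact ⟨fun h => ⟨x.2, fun p hp => h ⟨p, hm.le hp⟩ hp⟩, fun h p hp => h.2 p hp⟩
  have hP := (Submodule.comapSubtypeEquivOfLe hm.le).finrank_eq
  have hO := (Submodule.comapSubtypeEquivOfLe (p := G.orth l P) (q := G.gr 1)
    (fun _ h => h.1)).finrank_eq
  have h3 := LinearMap.finrank_range_add_finrank_ker (G.oddForm l)
  rw [horth] at h1
  change _ = _ + Module.finrank ℂ
    (P.comap (G.gr 1).subtype ⊓ LinearMap.ker (G.oddForm l) : Submodule ℂ (G.gr 1)) at h1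
  rw [hker] at h1
  rw [oddRank]
  omega

/-- dim P^⊥ is dim P or dim P + 1, and by the dimension formula its parity relative to dim P is that
of the rank. -/
theorem MaxIsotropic.even_oddRank_iff (hG : G.IsSolvable) (hl : l ∈ G.charSpace)
    (hP : G.EvenStable P) (hm : G.MaxIsotropic l P) :
    Even (G.oddRank l) ↔ G.orth l P ≤ P := by
  have h1 := hm.finrank_eq
  constructor
  · intro he
    by_contra hnot
    obtain ⟨ω, hω, hωP, -, hle, -⟩ := hm.exists_orth_le hG hl hP hnot
    have h2 : G.orth l P = P ⊔ ℂ ∙ ω := le_antisymm hle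
      (sup_le hm.le_orth ((Submodule.span_singleton_le_iff_mem _ _).2 hω))
    have h3 : P ⊓ ℂ ∙ ω = ⊥ := by
      refine (Submodule.disjoint_span_singleton' ?_).2 hωP |>.eq_bot
      rintro rfl
      exact hωP (zero_mem _)
    have h4 := Submodule.finrank_sup_add_finrank_inf_eq P (ℂ ∙ ω)
    rw [h3, finrank_bot, finrank_span_singleton (fun h0 : ω = 0 => hωP (h0 ▸ zero_mem P)), ← h2] at h4
    obtain ⟨r, hr⟩ := he
    omega
  · intro hle
    rw [le_antisymm hle hm.le_orth] at h1
    exact ⟨Module.finrank ℂ (G.gr 1) - Module.finrank ℂ P, by omega⟩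

end LieSuperalgebra

/-! ### The four statements in terms of twisted and untwisted induction -/

namespace LieSuperalgebra

variable [FiniteDimensional ℂ 𝔤] {l m : Module.Dual ℂ 𝔤} {h t : LieSubsuperalgebra G}

theorem IsPolarization.orth_add_theta_le_iff (hG : G.IsSolvable) (hl : l ∈ G.charSpace)
    (hp : G.IsPolarization l h) :
    G.orth (l + hp.theta) h.oddPart ≤ h.oddPart ↔ Even (G.oddRank l) := by
  have hs := LieSubsuperalgebra.evenStable_oddPart hp.even_le
  rw [hp.maxIsotropic.even_oddRank_iff hG hl hs]
  refine hp.maxIsotropic.perturb_orth_le hG hl (add_mem hl hp.theta_mem) hs fun x hx hn => ?_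
  rw [LinearMap.add_apply, hp.theta_eq_zero hx hn, add_zero]

theorem isIsoUpToParity_twistedInd_iff (hG : G.IsSolvable) (hl : l ∈ G.charSpace)
    (hm : m ∈ G.charSpace) (hp : G.IsPolarization l h) (ht : G.IsPolarization m t) :
    (twistedInd hl hp).IsIsoUpToParity (twistedInd hm ht) ↔ l = m := by
  constructor
  · intro hiso
    have h1 : l + hp.theta - hp.theta = m + ht.theta - ht.theta :=
      eq_of_isIsoUpToParity hG (add_mem hl hp.theta_mem) (add_mem hm ht.theta_mem)
        (hp.add_theta hG hl) (ht.add_theta hG hm) hiso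
    simpa using h1
  · rintro rfl
    exact isIsoUpToParity_charInd_add_theta hG hl hp ht rfl rfl

theorem isIsoUpToParity_indPol_iff (hG : G.IsSolvable) (hl : l ∈ G.charSpace)
    (hm : m ∈ G.charSpace) (hp : G.IsPolarization l h) (ht : G.IsPolarization m t) :
    (indPol hl hp).IsIsoUpToParity (indPol hm ht) ↔ l - hp.theta = m - ht.theta := by
  constructor
  · exact eq_of_isIsoUpToParity hG hl hm hp ht
  · intro e
    -- Ind_𝔥(λ) is I_𝔥(λ − θ_𝔥), so when the two differences coincide, both modules are twisted
    -- modules of the same functional.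
    have ht' : G.IsPolarization (l - hp.theta) t := e ▸ ht.sub_theta hG hm
    exact isIsoUpToParity_charInd_add_theta hG (sub_mem hl hp.theta_mem) (hp.sub_theta hG hl) ht'
      (sub_add_cancel l hp.theta).symm (sub_eq_iff_eq_add.1 e.symm)

theorem exists_isIsoUpToParity_twistedInd (hG : G.IsSolvable) {V : Type*} [AddCommGroup V]
    [Module ℂ V] [FiniteDimensional ℂ V] {M : SuperModule G V} (hM : M.IsIrreducible) :
    ∃ (l : Module.Dual ℂ 𝔤) (hl : l ∈ G.charSpace) (h : LieSubsuperalgebra G)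
      (hp : G.IsPolarization l h), M.IsIsoUpToParity (twistedInd hl hp) := by
  obtain ⟨χ, hχL, h, hp, hiso⟩ := exists_isIsoUpToParity_charInd hG hM
  refine ⟨χ - hp.theta, sub_mem hχL hp.theta_mem, h, hp.sub_theta hG hχL, ?_⟩
  refine (hiso (hp.isCharacter hχL)).trans ?_
  exact isIsoUpToParity_charInd_add_theta hG (sub_mem hχL hp.theta_mem) (hp.sub_theta hG hχL)
    (hp.sub_theta hG hχL) (sub_add_cancel χ hp.theta).symm rfl

end LieSuperalgebra

end

open LieSuperalgebra in
theorem mainTheorem1 {𝔤 : Type*} [AddCommGroup 𝔤] [Module ℂ 𝔤] [FiniteDimensional ℂ 𝔤]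
    (G : LieSuperalgebra 𝔤) (hG : G.IsSolvable) :
    -- every irreducible module is, up to parity, some `I(l)`
    (∀ (V : Type*) [AddCommGroup V] [Module ℂ V] [FiniteDimensional ℂ V] (M : SuperModule G V),
      M.IsIrreducible →
        ∃ (l : Module.Dual ℂ 𝔤) (hl : l ∈ G.charSpace) (h : LieSubsuperalgebra G)
          (hp : G.IsPolarization l h), M.IsIsoUpToParity (twistedInd hl hp)) ∧
    -- `l ↦ I(l)` is defined for every `l ∈ L`, does not depend on the polarization, takes values
    -- in the finite-dimensional irreducible modules, and is bijective, all up to parity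
    ((∀ l ∈ G.charSpace, ∃ h : LieSubsuperalgebra G, G.IsPolarization l h) ∧
      (∀ (l : Module.Dual ℂ 𝔤) (hl : l ∈ G.charSpace) (h : LieSubsuperalgebra G)
        (hp : G.IsPolarization l h),
        FiniteDimensional ℂ (h.IndSpace (twistedChar hl hp)) ∧
          (twistedInd hl hp).IsIrreducible) ∧
      (∀ (l m : Module.Dual ℂ 𝔤) (hl : l ∈ G.charSpace) (hm : m ∈ G.charSpace)
        (h t : LieSubsuperalgebra G) (hp : G.IsPolarization l h) (ht : G.IsPolarization m t),
        (twistedInd hl hp).IsIsoUpToParity (twistedInd hm ht) ↔ l = m) ∧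
      (∀ (V : Type*) [AddCommGroup V] [Module ℂ V] [FiniteDimensional ℂ V]
        (M : SuperModule G V), M.IsIrreducible →
          ∃! l : G.charSpace, ∀ (h : LieSubsuperalgebra G) (hp : G.IsPolarization l.1 h),
            M.IsIsoUpToParity (twistedInd l.2 hp))) ∧
    -- the untwisted induced modules
    (∀ (l m : Module.Dual ℂ 𝔤) (hl : l ∈ G.charSpace) (hm : m ∈ G.charSpace)
      (h t : LieSubsuperalgebra G) (hp : G.IsPolarization l h) (ht : G.IsPolarization m t),
      (indPol hl hp).IsIsoUpToParity (indPol hm ht) ↔ l - hp.theta = m - ht.theta) ∧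
    -- the type of `I(l)`
    (∀ (l : Module.Dual ℂ 𝔤) (hl : l ∈ G.charSpace) (h : LieSubsuperalgebra G)
      (hp : G.IsPolarization l h),
      (Even (G.oddRank l) → (twistedInd hl hp).IsGType) ∧
        (Odd (G.oddRank l) → (twistedInd hl hp).IsQType)) := by
  refine ⟨fun V _ _ _ M hM => exists_isIsoUpToParity_twistedInd hG hM,
    ⟨fun l hl => exists_isPolarization hG hl, fun l hl h hp => ?_,
      fun l m hl hm h t hp ht => isIsoUpToParity_twistedInd_iff hG hl hm hp ht,
      fun V _ _ _ M hM => ?_⟩,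
    fun l m hl hm h t hp ht => isIsoUpToParity_indPol_iff hG hl hm hp ht,
    fun l hl h hp => ⟨fun he => ?_, fun ho => ?_⟩⟩
  · have hL := add_mem hl hp.theta_mem
    have hm := (hp.add_theta hG hl).maxIsotropic
    exact ⟨LieSubsuperalgebra.finiteDimensional_charInd hG hp.even_le hL hm,
      LieSubsuperalgebra.isIrreducible_charInd hG hp.even_le hL hm⟩
  · obtain ⟨l, hl, h, hp, hiso⟩ := exists_isIsoUpToParity_twistedInd hG hM
    refine ⟨⟨l, hl⟩, fun t ht =>
      hiso.trans ((isIsoUpToParity_twistedInd_iff hG hl hl hp ht).2 rfl), fun m hm => ?_⟩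
    -- Existence of a polarization keeps the condition over all polarizations of m from being
    -- vacuous.
    obtain ⟨t, ht⟩ := exists_isPolarization hG m.2
    exact Subtype.ext
      ((isIsoUpToParity_twistedInd_iff hG m.2 hl ht hp).1 ((hm t ht).symm.trans hiso))
  · exact LieSubsuperalgebra.isGType_charInd hG hp.even_le (add_mem hl hp.theta_mem)
      (hp.add_theta hG hl).maxIsotropic ((hp.orth_add_theta_le_iff hG hl).2 he)
  · exact LieSubsuperalgebra.isQType_charInd hG hp.even_le (add_mem hl hp.theta_mem)
      (hp.add_theta hG hl).maxIsotropic fun hle =>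
        Nat.not_even_iff_odd.2 ho ((hp.orth_add_theta_le_iff hG hl).1 hle)
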